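/- Let $M^{2n+1}$ ($n\ge 1$) be a smooth manifold with a Riemannian metric $g$ with Levi-Civita connection $\nabla$ and curvature $R_{X,Y}Z=\nabla_X\nabla_YZ-\nabla_Y\nabla_XZ-\nabla_{[X,Y]}Z$. Let $(\varphi,Q,\xi,\eta,g)$ be a weak nearly Sasakian structure on $M$, that is: $\varphi$ and $Q$ are smooth $(1,1)$-tensors with $Q$ nonsingular, $\xi$ is a smooth vector field and $\eta$ a smooth 1-form such that $$\varphi^2=-Q+\eta\otimes\xi,\quad \eta(\xi)=1,\quad Q\xi=\xi,\quad \varphi(\ker\eta)\subset\ker\eta,\quad g(\varphi X,\varphi Y)=g(X,QY)-\eta(X)\eta(Y),$$ $$(\nabla_Y\varphi)Y=g(Y,Y)\,\xi-\eta(Y)\,Y\quad\text{for all vector fields } X, Y.$$ Put $\widetilde Q=Q-\mathrm{id}$ and $h=\nabla\xi+\varphi$, and assume that $$(\nabla_X\widetilde Q)Y=0\ \ (X\in TM,\ Y\in\ker\eta),\qquad R_{\widetilde QX,Y}Z\in\ker\eta\ \ (X\in TM,\ Y,Z\in\ker\eta).$$ Let $\lambda_1,\dots,\lambda_r>0$ $(r\ge0)$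 be pairwise distinct reals and $p\ge0$ an integer such that every connected component of $M$ contains a point at which $\mathrm{Spec}(h^2)=\{0,-\lambda_1^2,\dots,-\lambda_r^2\}$ and the eigenvalue $0$ of $h^2$ has multiplicity $2p+1$. Then this holds at every point of $M$. Let $[\xi]$ be the distribution spanned by $\xi$, let $D_0$ be the distribution of the eigenvectors of $h^2$ with eigenvalue $0$ orthogonal to $\xi$, and let $D_i$ $(1\le i\le r)$ be the distribution of the eigenvectors of $h^2$ with eigenvalue $-\lambda_i^2$. Then the distribution $[\xi]\oplus D_0$ and each distribution $[\xi]\oplus D_i$ $(i=1,\dots,r)$ are smooth and integrable (closed under the Lie bracket) with totally geodesic leaves. If $p>0$, then (a) the distribution $[\xi]\oplus D_1\oplus\dots\oplus D_r$ is smooth and integrable and defines a Riemannian foliation with totally geodesic leaves; (b) the leaves of $[\xi]\oplus D_0$ are $(2p+1)$-dimensional Sasakian manifolds: on every leaf, $(\varphi,\xi,\eta,g)$ induces a structure $(\varphi',\xi',\eta',g')$ with $\varphi'^2=-\mathrm{id}+\eta'\otimes\xi'$, $\eta'(\xi')=1$, $g'(\varphi'X,\varphi'Y)=g'(X,Y)-\eta'(X)\eta'(Y)$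 and $(\nabla'_X\varphi')Y=g'(X,Y)\,\xi'-\eta'(Y)X$, where $\nabla'$ is the Levi-Civita connection of $g'$. -/

import Mathlib

open Set Filter Topology Bundle FiberBundle VectorField Module
open scoped Manifold ContDiff

universe u

namespace WNS

noncomputable section

section Riemannian

variable {E : Type*} [NormedAddCommGroup E] [NormedSpace ℝ E] [FiniteDimensional ℝ E]
  {M : Type*} [TopologicalSpace M] [ChartedSpace E M] [IsManifold 𝓘(ℝ, E) ∞ M]

/-- A smooth Riemannian metric on the (boundaryless) smooth manifold `M` modelled on `E`. -/
abbrev RiemMetric (E : Type*) [NormedAddCommGroup E] [NormedSpace ℝ E]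
    (M : Type*) [TopologicalSpace M] [ChartedSpace E M] [IsManifold 𝓘(ℝ, E) ∞ M] :=
  ContMDiffRiemannianMetric 𝓘(ℝ, E) ∞ E (fun x : M => TangentSpace 𝓘(ℝ, E) x)

set_option linter.unusedSectionVars false

variable (g : RiemMetric E M)
 {X X' Y Y' Z Z' : Π x : M, TangentSpace 𝓘(ℝ, E) x} {x : M}

/-- The function `g(X, Y)`. -/
def gfun (X Y : Π x : M, TangentSpace 𝓘(ℝ, E) x) : M → ℝ := fun y => g.inner y (X y) (Y y)

lemma mdiffAt_gfun
    (hX : MDiffAt (T% X) x) (hY : MDiffAt (T% Y) x) : MDiffAt (gfun g X Y) x := by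
  have hg : MDiffAt (fun b : M => TotalSpace.mk' (E →L[ℝ] E →L[ℝ] ℝ)
     (E := fun x : M => TangentSpace 𝓘(ℝ, E) x →L[ℝ] TangentSpace 𝓘(ℝ, E) x →L[ℝ] ℝ) b (g.inner b)) x :=
    (g.contMDiff x).mdifferentiableAt (by simp)
  have : MDifferentiableAt 𝓘(ℝ, E) (𝓘(ℝ, E).prod 𝓘(ℝ))
      (fun m ↦ TotalSpace.mk' ℝ (E := Bundle.Trivial M ℝ) m (g.inner m (X m) (Y m))) x :=
    MDifferentiableAt.clm_bundle_apply₂ (F₁ := E) (F₂ := E) hg hX hY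
  simp only [mdifferentiableAt_totalSpace] at this
  exact this.2

/-- Half of the right-hand side of the Koszul formula:
`½ (X g(Y,Z) + Y g(X,Z) - Z g(X,Y) + g([X,Y],Z) - g([X,Z],Y) - g([Y,Z],X))`. -/
def koszul (X Y Z : Π x : M, TangentSpace 𝓘(ℝ, E) x) (x : M) : ℝ :=
  (1 / 2 : ℝ) * (d% (gfun g Y Z) x (X x) + d% (gfun g X Z) x (Y x) - d% (gfun g X Y) x (Z x)
    + g.inner x (mlieBracket 𝓘(ℝ, E) X Y x) (Z x)
    - g.inner x (mlieBracket 𝓘(ℝ, E) X Z x) (Y x)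
    - g.inner x (mlieBracket 𝓘(ℝ, E) Y Z x) (X x))

lemma gfun_comm : gfun g X Y = gfun g Y X := funext fun _ => g.symm _ _ _

lemma d_gfun_smul_left {f : M → ℝ} (hf : MDiffAt f x)
    (hX : MDiffAt (T% X) x) (hY : MDiffAt (T% Y) x) (v : TangentSpace 𝓘(ℝ, E) x) :
    d% (gfun g (f • X) Y) x v = f x * d% (gfun g X Y) x v + d% f x v * gfun g X Y x := by
  have : gfun g (f • X) Y = f * gfun g X Y := by
    ext y; simp [gfun]
  rw [this, mvfderiv_mul hf (mdiffAt_gfun g hX hY)]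
  simp; ring

lemma d_gfun_add_left
    (hX : MDiffAt (T% X) x) (hX' : MDiffAt (T% X') x) (hY : MDiffAt (T% Y) x)
    (v : TangentSpace 𝓘(ℝ, E) x) :
    d% (gfun g (X + X') Y) x v = d% (gfun g X Y) x v + d% (gfun g X' Y) x v := by
  have : gfun g (X + X') Y = gfun g X Y + gfun g X' Y := by
    ext y; simp [gfun]
  rw [this, mvfderiv_add (mdiffAt_gfun g hX hY) (mdiffAt_gfun g hX' hY)]
  simp

lemma koszul_tensorial_left (hY : MDiffAt (T% Y) x) (hZ : MDiffAt (T% Z) x) :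
    TensorialAt 𝓘(ℝ, E) E (fun X => koszul g X Y Z x) x where
  smul {f X} hf hX := by
    simp only [koszul, d_gfun_smul_left g hf hX hY, d_gfun_smul_left g hf hX hZ,
      mlieBracket_smul_left hf hX]
    simp only [Pi.smul_apply', map_smul, map_add, map_neg, neg_smul, gfun, smul_eq_mul,
      _root_.add_apply, _root_.smul_apply, _root_.neg_apply]
    ring
  add {X X'} hX hX' := by
    simp only [koszul, d_gfun_add_left g hX hX' hY, d_gfun_add_left g hX hX' hZ,
      mlieBracket_add_left hX hX']
    simp only [Pi.add_apply, map_add, _root_.add_apply]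
    ring

lemma koszul_tensorial_right (hX : MDiffAt (T% X) x) (hY : MDiffAt (T% Y) x) :
    TensorialAt 𝓘(ℝ, E) E (fun Z => koszul g X Y Z x) x where
  smul {f Z} hf hZ := by
    simp only [koszul, gfun_comm g (Y := f • Z), d_gfun_smul_left g hf hZ hX,
      d_gfun_smul_left g hf hZ hY, mlieBracket_smul_right hf hZ, gfun_comm g (X := Z)]
    simp only [Pi.smul_apply', map_smul, map_add, gfun, smul_eq_mul,
      _root_.add_apply, _root_.smul_apply, g.symm x (Z x)]
    ring
  add {Z Z'} hZ hZ' := by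
    simp only [koszul, gfun_comm g (Y := Z + Z'), d_gfun_add_left g hZ hZ' hX,
      d_gfun_add_left g hZ hZ' hY, mlieBracket_add_right hZ hZ', gfun_comm g (X := Z),
      gfun_comm g (X := Z')]
    simp only [Pi.add_apply, map_add, _root_.add_apply]
    ring

/-- The bilinear form `(X, Z) ↦ g(∇_X Y, Z)` on `T_x M` given by the Koszul formula. -/
def koszulForm (Y : Π x : M, TangentSpace 𝓘(ℝ, E) x) (x : M) (hY : MDiffAt (T% Y) x) :
    TangentSpace 𝓘(ℝ, E) x →L[ℝ] TangentSpace 𝓘(ℝ, E) x →L[ℝ] ℝ :=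
  TensorialAt.mkHom₂ (fun X Z => koszul g X Y Z x) x
    (fun _ hZ => koszul_tensorial_left g hY hZ) (fun _ hX => koszul_tensorial_right g hX hY)

lemma inner_bijective (x : M) : Function.Bijective (g.inner x).toLinearMap := by
  have : FiniteDimensional ℝ (TangentSpace 𝓘(ℝ, E) x) := inferInstanceAs (FiniteDimensional ℝ E)
  have : T2Space (TangentSpace 𝓘(ℝ, E) x) := inferInstanceAs (T2Space E)
  have hinj : Function.Injective (g.inner x).toLinearMap := by
    rw [← LinearMap.ker_eq_bot, LinearMap.ker_eq_bot']
    intro v hv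
    by_contra hne
    have h := g.pos x v hne
    have h2 : g.inner x v = 0 := hv
    simp [h2] at h
  let e : (TangentSpace 𝓘(ℝ, E) x →ₗ[ℝ] ℝ) ≃ₗ[ℝ] (TangentSpace 𝓘(ℝ, E) x →L[ℝ] ℝ) :=
    LinearMap.toContinuousLinearMap
  have h1 : Function.Injective (e.symm.toLinearMap ∘ₗ (g.inner x).toLinearMap) :=
    e.symm.injective.comp hinj
  have h2 := (LinearMap.injective_iff_surjective_of_finrank_eq_finrank
    (Subspace.dual_finrank_eq (K := ℝ) (V := TangentSpace 𝓘(ℝ, E) x)).symm).1 h1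
  refine ⟨hinj, fun ℓ => ?_⟩
  obtain ⟨v, hv⟩ := h2 (e.symm ℓ)
  exact ⟨v, e.symm.injective hv⟩

/-- The musical isomorphism `T_x M ≃ T_x^* M`, `v ↦ g(v, ·)`. -/
def flat (x : M) : TangentSpace 𝓘(ℝ, E) x ≃ₗ[ℝ] (TangentSpace 𝓘(ℝ, E) x →L[ℝ] ℝ) :=
  LinearEquiv.ofBijective (g.inner x).toLinearMap (inner_bijective g x)

open Classical in
/-- The linear map `v ↦ ∇_v Y` on `T_x M` (and `0` if `Y` is not differentiable at `x`). -/
def nablaAt (Y : Π x : M, TangentSpace 𝓘(ℝ, E) x) (x : M) :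
    TangentSpace 𝓘(ℝ, E) x →L[ℝ] TangentSpace 𝓘(ℝ, E) x :=
  haveI : FiniteDimensional ℝ (TangentSpace 𝓘(ℝ, E) x) := inferInstanceAs (FiniteDimensional ℝ E)
  haveI : T2Space (TangentSpace 𝓘(ℝ, E) x) := inferInstanceAs (T2Space E)
  if hY : MDiffAt (T% Y) x then
    LinearMap.toContinuousLinearMap ((flat g x).symm.toLinearMap ∘ₗ (koszulForm g Y x hY).toLinearMap)
  else 0

lemma inner_nablaAt (hX : MDiffAt (T% X) x) (hY : MDiffAt (T% Y) x) (hZ : MDiffAt (T% Z) x) :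
    g.inner x (nablaAt g Y x (X x)) (Z x) = koszul g X Y Z x := by
  have h1 : g.inner x (nablaAt g Y x (X x)) = koszulForm g Y x hY (X x) := by
    rw [nablaAt, dif_pos hY]
    exact (flat g x).apply_symm_apply _
  rw [h1]
  exact TensorialAt.mkHom₂_apply _ _ hX hZ

lemma tangent_ext {v w : TangentSpace 𝓘(ℝ, E) x}
    (h : ∀ u, g.inner x v u = g.inner x w u) : v = w :=
  (inner_bijective g x).1 (ContinuousLinearMap.ext h)

/-- The Levi-Civita connection of `g`; `leviCivita g Y x v` is `(∇_v Y)(x)`.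
By `leviCivita_torsion` and `leviCivita_metric` below it is torsion-free and metric. -/
def leviCivita : CovariantDerivative 𝓘(ℝ, E) E (fun x : M => TangentSpace 𝓘(ℝ, E) x) where
  toFun := nablaAt g
  isCovariantDerivativeOnUniv :=
    { add := by
        intro Y Y' x hY hY' _
        ext v
        refine tangent_ext g fun w => ?_
        have hv := mdifferentiableAt_extend (I := 𝓘(ℝ, E)) (F := E) v
        have hw := mdifferentiableAt_extend (I := 𝓘(ℝ, E)) (F := E) w
        have h := inner_nablaAt g hv (mdifferentiableAt_add_section hY hY') hw
        have h1 := inner_nablaAt g hv hY hw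
        have h2 := inner_nablaAt g hv hY' hw
        rw [extend_apply_self, extend_apply_self] at h h1 h2
        rw [_root_.add_apply, map_add, _root_.add_apply, h, h1, h2]
        simp only [koszul, gfun_comm g (X := extend E v), d_gfun_add_left g hY hY' hv,
          d_gfun_add_left g hY hY' hw, mlieBracket_add_left hY hY', mlieBracket_add_right hY hY']
        simp only [Pi.add_apply, map_add, _root_.add_apply]
        ring
      leibniz := by
        intro Y f x hY hf _
        ext v
        refine tangent_ext g fun w => ?_
        have hv := mdifferentiableAt_extend (I := 𝓘(ℝ, E)) (F := E) v
        have hw := mdifferentiableAt_extend (I := 𝓘(ℝ, E)) (F := E) w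
        have h := inner_nablaAt g hv (hf.smul_section hY) hw
        have h1 := inner_nablaAt g hv hY hw
        rw [extend_apply_self, extend_apply_self] at h h1
        simp only [_root_.add_apply, map_add, _root_.smul_apply,
          map_smul, ContinuousLinearMap.smulRight_apply]
        rw [h, h1]
        simp only [koszul, gfun_comm g (X := extend E v), d_gfun_smul_left g hf hY hv,
          d_gfun_smul_left g hf hY hw, mlieBracket_smul_left hf hY, mlieBracket_smul_right hf hY]
        simp only [Pi.smul_apply', map_smul, map_add, map_neg, neg_smul, gfun, smul_eq_mul,
          _root_.add_apply, _root_.smul_apply,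
          _root_.neg_apply, extend_apply_self]
        ring }

lemma leviCivita_torsion (hX : MDiffAt (T% X) x) (hY : MDiffAt (T% Y) x) :
    leviCivita g Y x (X x) - leviCivita g X x (Y x) = mlieBracket 𝓘(ℝ, E) X Y x := by
  refine tangent_ext g fun w => ?_
  have hw := mdifferentiableAt_extend (I := 𝓘(ℝ, E)) (F := E) w
  have h1 := inner_nablaAt g hX hY hw
  have h2 := inner_nablaAt g hY hX hw
  rw [extend_apply_self] at h1 h2
  change g.inner x (nablaAt g Y x (X x) - nablaAt g X x (Y x)) w = _
  rw [map_sub, _root_.sub_apply, h1, h2]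
  simp only [koszul, gfun_comm g (X := Y) (Y := X), mlieBracket_swap_apply (V := Y) (W := X)]
  simp only [map_neg, _root_.neg_apply, extend_apply_self]
  ring

lemma leviCivita_metric (hX : MDiffAt (T% X) x) (hY : MDiffAt (T% Y) x) (v : TangentSpace 𝓘(ℝ, E) x) :
    d% (fun y => g.inner y (X y) (Y y)) x v =
      g.inner x (leviCivita g X x v) (Y x) + g.inner x (X x) (leviCivita g Y x v) := by
  have hv := mdifferentiableAt_extend (I := 𝓘(ℝ, E)) (F := E) v
  have h1 := inner_nablaAt g hv hX hY
  have h2 := inner_nablaAt g hv hY hX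
  rw [extend_apply_self] at h1 h2
  rw [g.symm x (X x)]
  change d% (gfun g X Y) x v = g.inner x (nablaAt g X x v) (Y x) + g.inner x (nablaAt g Y x v) (X x)
  rw [h1, h2]
  simp only [koszul, gfun_comm g (X := Y) (Y := X), mlieBracket_swap_apply (V := Y) (W := X)]
  simp only [map_neg, _root_.neg_apply, extend_apply_self]
  ring

/- ### Vector fields, tensor fields, curvature -/

variable (E M) in
/-- A (not necessarily smooth) vector field on `M`. -/
abbrev VField := Π x : M, TangentSpace 𝓘(ℝ, E) x

variable (E M) in
/-- A (not necessarily smooth) `(1,1)`-tensor field on `M`. -/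
abbrev EndoField := Π x : M, TangentSpace 𝓘(ℝ, E) x →L[ℝ] TangentSpace 𝓘(ℝ, E) x

variable (E M) in
/-- A (not necessarily smooth) 1-form on `M`. -/
abbrev OneForm := Π x : M, TangentSpace 𝓘(ℝ, E) x →L[ℝ] ℝ

variable (E M) in
/-- A family of tangent subspaces. -/
abbrev Distribution := Π x : M, Submodule ℝ (TangentSpace 𝓘(ℝ, E) x)

/-- The vector field `X` is smooth on a neighbourhood of `x`. -/
def SmoothNear (X : VField E M) (x : M) : Prop := ∀ᶠ y in 𝓝 x, CMDiffAt ∞ (T% X) y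

/-- Smoothness of a `(1,1)`-tensor field. -/
def SmoothEndo (A : EndoField E M) : Prop :=
  ContMDiff 𝓘(ℝ, E) (𝓘(ℝ, E).prod 𝓘(ℝ, E →L[ℝ] E)) ∞
    (fun x => TotalSpace.mk' (E →L[ℝ] E)
      (E := fun x : M => TangentSpace 𝓘(ℝ, E) x →L[ℝ] TangentSpace 𝓘(ℝ, E) x) x (A x))

/-- Smoothness of a 1-form. -/
def SmoothOneForm (η : OneForm E M) : Prop :=
  ContMDiff 𝓘(ℝ, E) (𝓘(ℝ, E).prod 𝓘(ℝ, E →L[ℝ] ℝ)) ∞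
    (fun x => TotalSpace.mk' (E →L[ℝ] ℝ)
      (E := fun x : M => TangentSpace 𝓘(ℝ, E) x →L[ℝ] ℝ) x (η x))

/-- `(∇_v A) Y = ∇_v (A Y) - A (∇_v Y)` at the point `x`, for a `(1,1)`-tensor field `A`. -/
def covDerivEndo (A : EndoField E M) (Y : VField E M) (x : M) (v : TangentSpace 𝓘(ℝ, E) x) :
    TangentSpace 𝓘(ℝ, E) x :=
  leviCivita g (fun y => A y (Y y)) x v - A x (leviCivita g Y x v)

/-- `R_{X,Y} Z = ∇_X ∇_Y Z - ∇_Y ∇_X Z - ∇_{[X,Y]} Z`. -/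
def curvature (X Y Z : VField E M) (x : M) : TangentSpace 𝓘(ℝ, E) x :=
  leviCivita g (fun y => leviCivita g Z y (Y y)) x (X x)
    - leviCivita g (fun y => leviCivita g Z y (X y)) x (Y x)
    - leviCivita g Z x (mlieBracket 𝓘(ℝ, E) X Y x)

/-- The Lie derivative `(£_X g)(Y, Z) = X g(Y, Z) - g([X, Y], Z) - g(Y, [X, Z])`. -/
def lieDerivMetric (X Y Z : VField E M) (x : M) : ℝ :=
  d% (fun y => g.inner y (Y y) (Z y)) x (X x)
    - g.inner x (mlieBracket 𝓘(ℝ, E) X Y x) (Z x)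
    - g.inner x (Y x) (mlieBracket 𝓘(ℝ, E) X Z x)

/- ### Weak almost contact metric structures -/

/-- `(φ, Q, ξ, η, g)` is a weak almost contact metric structure on `M`. -/
structure IsWeakAlmostContactMetric (g : RiemMetric E M) (φ Q : EndoField E M) (ξ : VField E M)
    (η : OneForm E M) : Prop where
  smooth_φ : SmoothEndo φ
  smooth_Q : SmoothEndo Q
  smooth_ξ : CMDiff ∞ (T% ξ)
  smooth_η : SmoothOneForm η
  φ_sq : ∀ x v, φ x (φ x v) = -Q x v + η x v • ξ x
  η_ξ : ∀ x, η x (ξ x) = 1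
  Q_ξ : ∀ x, Q x (ξ x) = ξ x
  Q_nonsingular : ∀ x, Function.Bijective (Q x)
  ker_invariant : ∀ x v, η x v = 0 → η x (φ x v) = 0
  compatible : ∀ x v w, g.inner x (φ x v) (φ x w) = g.inner x v (Q x w) - η x v * η x w

/-- `(φ, Q, ξ, η, g)` is a weak nearly Sasakian structure:
`(∇_Y φ) Y = g(Y, Y) ξ - η(Y) Y` for all smooth (local) vector fields `Y`. -/
structure IsWeakNearlySasakian (g : RiemMetric E M) (φ Q : EndoField E M) (ξ : VField E M)
    (η : OneForm E M) : Prop extends IsWeakAlmostContactMetric g φ Q ξ η where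
  nearly : ∀ (x : M) (Y : VField E M), SmoothNear Y x →
    covDerivEndo g φ Y x (Y x) = g.inner x (Y x) (Y x) • ξ x - η x (Y x) • Y x

/-- `(φ, ξ, η, g)` is a Sasakian structure: an almost contact metric structure (`Q = id`) with
`(∇_X φ) Y = g(X, Y) ξ - η(Y) X`. -/
structure IsSasakian (g : RiemMetric E M) (φ : EndoField E M) (ξ : VField E M)
    (η : OneForm E M) : Prop extends
    IsWeakAlmostContactMetric g φ (fun _ => ContinuousLinearMap.id ℝ _) ξ η where
  sasaki : ∀ (x : M) (X Y : VField E M), SmoothNear X x → SmoothNear Y x →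
    covDerivEndo g φ Y x (X x) = g.inner x (X x) (Y x) • ξ x - η x (Y x) • X x

/-- The tensor `Q̃ = Q - id`. -/
def smallTensor (Q : EndoField E M) : EndoField E M :=
  fun x => Q x - ContinuousLinearMap.id ℝ _

/-- The tensor `h = ∇ξ + φ`. -/
def hTensor (g : RiemMetric E M) (φ : EndoField E M) (ξ : VField E M) : EndoField E M :=
  fun x => leviCivita g ξ x + φ x

/-- The operator `h²` on `T_x M`. -/
def hSq (g : RiemMetric E M) (φ : EndoField E M) (ξ : VField E M) (x : M) :
    Module.End ℝ (TangentSpace 𝓘(ℝ, E) x) :=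
  (hTensor g φ ξ x).toLinearMap ∘ₗ (hTensor g φ ξ x).toLinearMap

/-- At the point `x`, `Spec(h²) = {0, -l₁², …, -l_r²}` and the eigenvalue `0` of the (self-adjoint)
operator `h²` has multiplicity `2p + 1`. -/
def HasSpectralForm (g : RiemMetric E M) (φ : EndoField E M) (ξ : VField E M) {r : ℕ}
    (l : Fin r → ℝ) (p : ℕ) (x : M) : Prop :=
  spectrum ℝ (hSq g φ ξ x) = insert 0 (range fun i => -(l i) ^ 2) ∧
    finrank ℝ ((hSq g φ ξ x).eigenspace 0) = 2 * p + 1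

/-- The distribution `[ξ]` spanned by `ξ`. -/
def spanXi (ξ : VField E M) : Distribution E M := fun x => Submodule.span ℝ {ξ x}

/-- The distribution `D₀` of the eigenvectors of `h²` with eigenvalue `0` orthogonal to `ξ`. -/
def D0 (g : RiemMetric E M) (φ : EndoField E M) (ξ : VField E M) : Distribution E M :=
  fun x => (hSq g φ ξ x).eigenspace 0 ⊓ LinearMap.ker (g.inner x (ξ x)).toLinearMap

/-- The distribution of the eigenvectors of `h²` with eigenvalue `-c²`. -/
def Dev (g : RiemMetric E M) (φ : EndoField E M) (ξ : VField E M) (c : ℝ) : Distribution E M :=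
  fun x => (hSq g φ ξ x).eigenspace (-c ^ 2)

/- ### Foliations -/

/-- The vector field `X` is tangent to `D` near `x`. -/
def TangentNear (D : Distribution E M) (X : VField E M) (x : M) : Prop := ∀ᶠ y in 𝓝 x, X y ∈ D y

/-- `D` is a smooth distribution: its rank is locally constant and it is spanned by smooth local
sections. -/
def IsSmoothDistribution (D : Distribution E M) : Prop :=
  IsLocallyConstant (fun x => finrank ℝ (D x)) ∧
    ∀ x, ∀ v ∈ D x, ∃ X : VField E M, SmoothNear X x ∧ TangentNear D X x ∧ X x = v

/-- `D` is a smooth distribution that is integrable: `[X, Y]` is a section of `D` for all smooth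
(local) sections `X`, `Y` of `D`. -/
def IsIntegrable (D : Distribution E M) : Prop :=
  IsSmoothDistribution D ∧
    ∀ (x : M) (X Y : VField E M), SmoothNear X x → SmoothNear Y x →
      TangentNear D X x → TangentNear D Y x → mlieBracket 𝓘(ℝ, E) X Y x ∈ D x

end Riemannian

section Leaves

variable {E : Type*} [NormedAddCommGroup E] [NormedSpace ℝ E] [FiniteDimensional ℝ E]
  {M : Type u} [TopologicalSpace M] [ChartedSpace E M] [IsManifold 𝓘(ℝ, E) ∞ M]
  (d : ℕ) {N : Type u} [TopologicalSpace N] [ChartedSpace (EuclideanSpace ℝ (Fin d)) N]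
  [IsManifold (𝓡 d) ∞ N]

/-- `f : N → M` is a connected integral manifold of `D`: an injectively immersed connected smooth
manifold whose tangent spaces are the subspaces in `D`. The leaves of an integrable distribution
are its maximal connected integral manifolds. -/
structure IsIntegralManifold (D : Distribution E M) (f : N → M) : Prop where
  connected : ConnectedSpace N
  smooth : ContMDiff (𝓡 d) 𝓘(ℝ, E) ∞ f
  injective : Function.Injective f
  immersion : ∀ m, Function.Injective (mfderiv (𝓡 d) 𝓘(ℝ, E) f m)
  tangent : ∀ m, LinearMap.range (mfderiv (𝓡 d) 𝓘(ℝ, E) f m).toLinearMap = D (f m)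

/-- The immersed submanifold `f : N → M` is totally geodesic, i.e. its second fundamental form
`(X, Y) ↦ (∇_X Y)^⊥` vanishes: `∇_X Y` is tangent to it at `f m` for all smooth vector fields `X`,
`Y` of `M` near `f m` that are tangent to it along it. -/
def IsTotallyGeodesic (g : RiemMetric E M) (f : N → M) : Prop :=
  ∀ (m : N) (X Y : VField E M), SmoothNear X (f m) → SmoothNear Y (f m) →
    (∀ᶠ k in 𝓝 m, X (f k) ∈ LinearMap.range (mfderiv (𝓡 d) 𝓘(ℝ, E) f k).toLinearMap) →
    (∀ᶠ k in 𝓝 m, Y (f k) ∈ LinearMap.range (mfderiv (𝓡 d) 𝓘(ℝ, E) f k).toLinearMap) →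
    leviCivita g Y (f m) (X (f m)) ∈ LinearMap.range (mfderiv (𝓡 d) 𝓘(ℝ, E) f m).toLinearMap

/-- `D` is integrable with totally geodesic leaves. Total geodesy is stated both on `M`
(`∇_X Y` is a section of `D` for all smooth local sections `X`, `Y` of `D`) and on every connected
integral manifold, in particular on every leaf. -/
structure IsTotallyGeodesicFoliation (g : RiemMetric E M) (D : Distribution E M) : Prop where
  integrable : IsIntegrable D
  autoparallel : ∀ (x : M) (X Y : VField E M), SmoothNear X x → SmoothNear Y x →
    TangentNear D X x → TangentNear D Y x → leviCivita g Y x (X x) ∈ D x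
  leaves : ∀ (d : ℕ) (N : Type u) [TopologicalSpace N] [ChartedSpace (EuclideanSpace ℝ (Fin d)) N]
    [IsManifold (𝓡 d) ∞ N] (f : N → M), IsIntegralManifold d D f →
    IsTotallyGeodesic d g f

/-- `D` defines a Riemannian foliation: it is integrable and the metric is invariant in the
directions transverse to `D` along `D`, i.e. `(£_X g)(Z, Z') = 0` for all smooth local vector fields
`X` tangent to `D` and `Z`, `Z'` orthogonal to `D`. -/
def IsRiemannianFoliation (g : RiemMetric E M) (D : Distribution E M) : Prop :=
  IsIntegrable D ∧
    ∀ (x : M) (X Z Z' : VField E M), SmoothNear X x → SmoothNear Z x → SmoothNear Z' x →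
      TangentNear D X x → (∀ᶠ y in 𝓝 x, ∀ u ∈ D y, g.inner y (Z y) u = 0) →
      (∀ᶠ y in 𝓝 x, ∀ u ∈ D y, g.inner y (Z' y) u = 0) → lieDerivMetric g X Z Z' x = 0

/-- The structure `(φ, ξ, η, g)` of `M` induces a Sasakian structure on the immersed submanifold
`f : N → M`: it restricts to tensors `(φ', ξ', η', g')` on `N`, and these are Sasakian. -/
def InducesSasakian (g : RiemMetric E M) (φ : EndoField E M) (ξ : VField E M) (η : OneForm E M)
    (f : N → M) : Prop :=
  ∃ (g' : RiemMetric (EuclideanSpace ℝ (Fin d)) N) (φ' : EndoField (EuclideanSpace ℝ (Fin d)) N)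
    (ξ' : VField (EuclideanSpace ℝ (Fin d)) N) (η' : OneForm (EuclideanSpace ℝ (Fin d)) N),
    (∀ m v w, g'.inner m v w =
      g.inner (f m) (mfderiv (𝓡 d) 𝓘(ℝ, E) f m v) (mfderiv (𝓡 d) 𝓘(ℝ, E) f m w)) ∧
    (∀ m v, mfderiv (𝓡 d) 𝓘(ℝ, E) f m (φ' m v) = φ (f m) (mfderiv (𝓡 d) 𝓘(ℝ, E) f m v)) ∧
    (∀ m, mfderiv (𝓡 d) 𝓘(ℝ, E) f m (ξ' m) = ξ (f m)) ∧
    (∀ m v, η' m v = η (f m) (mfderiv (𝓡 d) 𝓘(ℝ, E) f m v)) ∧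
    IsSasakian g' φ' ξ' η'

end Leaves

end

end WNS

open WNS

/-!
# Weak nearly Sasakian manifolds whose tensor `h²` has constant spectrum

Write `B = ∇ξ`, `P = id - η ⊗ ξ` and `Q̃ = Q - id`.

Differentiating `φ² = -Q + η ⊗ ξ` along `ξ` gives `φ B + B φ = 2 P` and the skewness of `B`, so `ξ`
is a Killing field. The tensor `∇Q̃` is symmetric and vanishes on `ker η`, whence `Q̃ B = 0`, and
`φ B + B φ = 2 P` then yields `Q̃ = 0` (`IsWeakNearlySasakian.Q_eq`): the structure is an honest
nearly Sasakian one. Consequently `h² = B² + P`.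

The heart of the matter is the curvature identity `(∇_v B) Y = g(B² v, Y) ξ - η(Y) B² v`
(`MetricConnection.IsNearlySasakian.hess_eq`). The Ricci identity for `φ` and the pair `(W, ξ)`,
combined with the derivative of `φ B + B φ = 2 P`, shows `(∇_W B) φ W = 0`. As a consequence
`g((∇_W B) φ U, φ Z)` is totally skew in `W, U, Z`. Since `B` is closed as a 2-form, `φ` acts on
this 3-form as a derivation by zero, which forces it to vanish. This part is an algebraic
computation in a connection over a commutative ring, applied to the ring of smooth functions and the
module of smooth vector fields.

It follows by induction that `(∇_v m(h²)) Y = -g(w, Y) ξ - η(Y) w` with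
`w = B (m(h²) v - m(0) v)`, for every real polynomial `m`
(`IsWeakNearlySasakian.covDerivEndo_polyTensor`). The right-hand side has trace zero because `w` is
orthogonal to `ξ`, so the trace of `m(h²)` is locally constant. As `h²` is symmetric, it is
diagonalizable, and `f(h²)` vanishes wherever the trace of `f(h²)²` does. Hence the spectrum of `h²`
and the multiplicities, which are traces of polynomials in `h²`, are constant on components
(`IsWeakNearlySasakian.hasSpectralForm`).

All the distributions in question are the images of projections `Π = e(h²) P + η ⊗ ξ` with a
polynomial `e` that takes the values `0` and `1` on the spectrum. The formula for `∇ e(h²)` becomes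
`(∇_v Π) Y = g(B (v - Π v), Y) ξ + η(Y) B (v - Π v)`, so `∇_v Y` is a section of the distribution if
`Y` is one and either `v` belongs to it or `Y` is orthogonal to `ξ`
(`IsWeakNearlySasakian.leviCivita_mem_polyDistribution`). The first case gives integrability and
totally geodesic leaves; the second, with the Killing field `ξ`, gives the Riemannian property.

Finally, `h` vanishes on `ker h² = [ξ] ⊕ D₀`, that is, `φ = -B` there, and the curvature identity for
`B` turns into the Sasakian identity for `φ`. It passes to a leaf by the Gauss formula
(`mfderiv_leviCivita`), which follows from the Koszul formulas of both metrics.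
-/

namespace WNS

noncomputable section

set_option linter.unusedSectionVars false

/-! ### Smooth fields, frames and duality -/

section Fields
variable {E : Type*} [NormedAddCommGroup E] [NormedSpace ℝ E] [FiniteDimensional ℝ E]
  {M : Type*} [TopologicalSpace M] [ChartedSpace E M] [IsManifold 𝓘(ℝ, E) ∞ M]
  {X Y Z : VField E M} {x : M}

lemma SmoothNear.contMDiffAt (h : SmoothNear X x) : CMDiffAt ∞ (T% X) x := h.self_of_nhds

lemma SmoothNear.mdifferentiableAt (h : SmoothNear X x) : MDiffAt (T% X) x :=
  h.contMDiffAt.mdifferentiableAt (by simp)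

lemma smoothNear_of_contMDiff (h : CMDiff ∞ (T% X)) (x : M) : SmoothNear X x :=
  .of_forall fun y => h y

/-- A vector field that is smooth near `x` is made global by a bump function. -/
lemma SmoothNear.exists_contMDiff [T2Space M] (h : SmoothNear Y x) :
    ∃ Z : VField E M, CMDiff ∞ (T% Z) ∧ Z =ᶠ[𝓝 x] Y := by
  obtain ⟨u, hu, huo, hxu⟩ := eventually_nhds_iff.1 h
  obtain ⟨f, -, hf⟩ := (SmoothBumpFunction.nhds_basis_tsupport (I := 𝓘(ℝ, E)) x).mem_iff.1
    (huo.mem_nhds hxu)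
  refine ⟨(f : M → ℝ) • Y, ContMDiffOn.smul_section_of_tsupport (u := u)
    f.contMDiff.contMDiffOn huo hf fun y hy => (hu y hy).contMDiffWithinAt, ?_⟩
  filter_upwards [f.eventuallyEq_one] with y hy
  rw [Pi.smul_apply', hy, Pi.one_apply, one_smul]

/-- Every tangent space has a basis that extends to globally smooth vector fields, and these form
a basis on a neighbourhood. -/
lemma exists_smooth_frame [T2Space M] (x : M) :
    ∃ s : Fin (finrank ℝ E) → VField E M, (∀ i, CMDiff ∞ (T% (s i))) ∧
      ∀ᶠ y in 𝓝 x, ∃ b : Basis (Fin (finrank ℝ E)) ℝ (TangentSpace 𝓘(ℝ, E) y),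
        ∀ i, b i = s i y := by
  let e := trivializationAt E (TangentSpace 𝓘(ℝ, E)) x
  have hx : x ∈ e.baseSet := mem_baseSet_trivializationAt E (TangentSpace 𝓘(ℝ, E)) x
  let b := finBasis ℝ E
  have h (i) : SmoothNear (e.localFrame b i) x := by
    filter_upwards [e.open_baseSet.mem_nhds hx] with y hy
    exact contMDiffAt_localFrame_of_mem ∞ e b i hy
  choose s hs hse using fun i => (h i).exists_contMDiff
  refine ⟨s, hs, ?_⟩
  filter_upwards [e.open_baseSet.mem_nhds hx, eventually_all.2 hse] with y hy hsy
  exact ⟨e.basisAt b hy, fun i => by rw [hsy i, Trivialization.localFrame_apply_of_mem_baseSet]⟩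

lemma exists_contMDiff_apply_eq [T2Space M] (v : TangentSpace 𝓘(ℝ, E) x) :
    ∃ Z : VField E M, CMDiff ∞ (T% Z) ∧ Z x = v := by
  obtain ⟨s, hs, hb⟩ := exists_smooth_frame (E := E) x
  obtain ⟨b, hb⟩ := hb.self_of_nhds
  refine ⟨fun y => ∑ i, b.repr v i • s i y, ContMDiff.sum_section fun i _ => ?_, ?_⟩
  · exact (hs i).const_smul_section (a := b.repr v i)
  · simp_rw [← hb]
    exact b.sum_repr v

lemma exists_contMDiff_fun [T2Space M] {u : M → ℝ} (h : ∀ᶠ y in 𝓝 x, CMDiffAt ∞ u y) :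
    ∃ w : M → ℝ, CMDiff ∞ w ∧ w =ᶠ[𝓝 x] u := by
  obtain ⟨U, hu, huo, hxu⟩ := eventually_nhds_iff.1 h
  obtain ⟨f, -, hf⟩ := (SmoothBumpFunction.nhds_basis_tsupport (I := 𝓘(ℝ, E)) x).mem_iff.1
    (huo.mem_nhds hxu)
  refine ⟨fun y => f y • u y, contMDiff_of_tsupport fun y hy => ?_, ?_⟩
  · exact f.contMDiffAt.smul (hu y (hf (tsupport_smul_subset_left _ _ hy)))
  · filter_upwards [f.eventuallyEq_one] with y hy
    simp [hy]

/-- A section of a bundle of linear maps out of the tangent bundle is smooth if it takes smooth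
vector fields to smooth sections. -/
lemma contMDiffAt_hom_of_apply [T2Space M] {F : Type*} [NormedAddCommGroup F] [NormedSpace ℝ F]
    {V : M → Type*} [TopologicalSpace (TotalSpace F V)] [∀ y, AddCommGroup (V y)]
    [∀ y, Module ℝ (V y)] [∀ y, TopologicalSpace (V y)] [FiberBundle F V] [VectorBundle ℝ F V]
    [∀ y, IsTopologicalAddGroup (V y)] [∀ y, ContinuousSMul ℝ (V y)]
    [ContMDiffVectorBundle ∞ F V 𝓘(ℝ, E)]
    (A : Π y : M, TangentSpace 𝓘(ℝ, E) y →L[ℝ] V y)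
    (h : ∀ Z : VField E M, CMDiff ∞ (T% Z) →
      CMDiffAt ∞ (fun y => TotalSpace.mk' F y (A y (Z y))) x) :
    CMDiffAt ∞ (fun y => TotalSpace.mk' (E →L[ℝ] F)
      (E := fun y : M => TangentSpace 𝓘(ℝ, E) y →L[ℝ] V y) y (A y)) x := by
  rw [contMDiffAt_hom_bundle]
  refine ⟨contMDiffAt_id, ?_⟩
  let e := trivializationAt E (TangentSpace 𝓘(ℝ, E)) x
  have hx : x ∈ e.baseSet := mem_baseSet_trivializationAt E (TangentSpace 𝓘(ℝ, E)) x
  let e' := trivializationAt F V x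
  have hx' : x ∈ e'.baseSet := mem_baseSet_trivializationAt F V x
  let b := finBasis ℝ E
  have key (L : E →L[ℝ] F) : L = ∑ i, ContinuousLinearMap.smulRightL ℝ E F
      (LinearMap.toContinuousLinearMap (b.coord i)) (L (b i)) := by
    ext v
    conv_lhs => rw [← b.sum_repr v]
    simp only [map_sum, map_smul, ContinuousLinearMap.smulRightL_apply_apply,
      _root_.sum_apply, ContinuousLinearMap.smulRight_apply,
      LinearMap.coe_toContinuousLinearMap', Basis.coord_apply]
  have hlf (i) : SmoothNear (e.localFrame b i) x := by
    filter_upwards [e.open_baseSet.mem_nhds hx] with y hy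
    exact contMDiffAt_localFrame_of_mem ∞ e b i hy
  choose s hs hse using fun i => (hlf i).exists_contMDiff
  have hc (i) : CMDiffAt ∞ (fun y => (e' ⟨y, A y (s i y)⟩).2) x := by
    have := h (s i) (hs i)
    rw [contMDiffAt_totalSpace] at this
    exact this.2
  have : CMDiffAt ∞ (fun y => ∑ i, ContinuousLinearMap.smulRightL ℝ E F
      (LinearMap.toContinuousLinearMap (b.coord i)) ((e' ⟨y, A y (s i y)⟩).2)) x := by
    refine contMDiffAt_finsetSum fun i _ => ?_
    exact (ContinuousLinearMap.contMDiff (ContinuousLinearMap.smulRightL ℝ E F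
      (LinearMap.toContinuousLinearMap (b.coord i)))).contMDiffAt.comp x (hc i)
  refine this.congr_of_eventuallyEq ?_
  filter_upwards [e.open_baseSet.mem_nhds hx, e'.open_baseSet.mem_nhds hx', eventually_all.2 hse]
    with y hy hy' hsy
  rw [key (ContinuousLinearMap.inCoordinates _ _ _ _ _ _ _ _ _)]
  refine Finset.sum_congr rfl fun i _ => ?_
  congr 1
  rw [ContinuousLinearMap.inCoordinates_eq hy hy', hsy i,
    Trivialization.localFrame_apply_of_mem_baseSet _ _ hy]
  simp [Trivialization.basisAt, e, e', b]

lemma smoothEndo_of_apply [T2Space M] (A : EndoField E M)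
    (h : ∀ Z : VField E M, CMDiff ∞ (T% Z) → CMDiff ∞ (T% fun y => A y (Z y))) : SmoothEndo A :=
  fun _ => contMDiffAt_hom_of_apply (F := E) A fun Z hZ => h Z hZ _

lemma smoothOneForm_of_apply [T2Space M] (η : OneForm E M)
    (h : ∀ Z : VField E M, CMDiff ∞ (T% Z) → CMDiff ∞ fun y => η y (Z y)) : SmoothOneForm η :=
  fun x => contMDiffAt_hom_of_apply (F := ℝ) (V := Bundle.Trivial M ℝ) η fun Z hZ => by
    rw [contMDiffAt_totalSpace]
    exact ⟨contMDiffAt_id, h Z hZ x⟩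

lemma contMDiff_bilin_of_apply [T2Space M]
    (a : Π y : M, TangentSpace 𝓘(ℝ, E) y →L[ℝ] TangentSpace 𝓘(ℝ, E) y →L[ℝ] ℝ)
    (h : ∀ X Y : VField E M, CMDiff ∞ (T% X) → CMDiff ∞ (T% Y) →
      CMDiff ∞ fun y => a y (X y) (Y y)) :
    ContMDiff 𝓘(ℝ, E) (𝓘(ℝ, E).prod 𝓘(ℝ, E →L[ℝ] E →L[ℝ] ℝ)) ∞
      (fun y ↦ TotalSpace.mk' (E →L[ℝ] E →L[ℝ] ℝ)
        (E := fun y : M => TangentSpace 𝓘(ℝ, E) y →L[ℝ] TangentSpace 𝓘(ℝ, E) y →L[ℝ] ℝ) y (a y)) :=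
  fun x => contMDiffAt_hom_of_apply (F := E →L[ℝ] ℝ)
    (V := fun y : M => TangentSpace 𝓘(ℝ, E) y →L[ℝ] ℝ) a fun Z hZ =>
      smoothOneForm_of_apply (fun y => a y (Z y)) (fun Y hY => h Z Y hZ hY) x

lemma SmoothEndo.contMDiffAt_apply {A : EndoField E M} (hA : SmoothEndo A)
    (hX : CMDiffAt ∞ (T% X) x) : CMDiffAt ∞ (T% fun y => A y (X y)) x :=
  ContMDiffAt.clm_bundle_apply (F₁ := E) (F₂ := E) (hA x) hX

lemma SmoothEndo.smoothNear {A : EndoField E M} (hA : SmoothEndo A)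
    (hX : SmoothNear X x) : SmoothNear (fun y => A y (X y)) x :=
  hX.mono fun _ hy => hA.contMDiffAt_apply hy

lemma SmoothOneForm.contMDiffAt_apply {η : OneForm E M} (hη : SmoothOneForm η)
    (hX : CMDiffAt ∞ (T% X) x) : CMDiffAt ∞ (fun y => η y (X y)) x := by
  have := ContMDiffAt.clm_bundle_apply (F₁ := E) (F₂ := ℝ) (E₂ := Bundle.Trivial M ℝ) (hη x) hX
  rw [contMDiffAt_totalSpace] at this
  exact this.2

variable (g : RiemMetric E M)

lemma contMDiffAt_gfun (hX : CMDiffAt ∞ (T% X) x) (hY : CMDiffAt ∞ (T% Y) x) :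
    CMDiffAt ∞ (gfun g X Y) x := by
  have := ContMDiffAt.clm_bundle_apply₂ (F₁ := E) (F₂ := E) (F₃ := ℝ)
    (E₃ := Bundle.Trivial M ℝ) (g.contMDiff x) hX hY
  rw [contMDiffAt_totalSpace] at this
  exact this.2

lemma inner_sum_left {ι : Type*} (t : Finset ι) (c : ι → ℝ) (v : ι → TangentSpace 𝓘(ℝ, E) x)
    (w : TangentSpace 𝓘(ℝ, E) x) :
    g.inner x (∑ i ∈ t, c i • v i) w = ∑ i ∈ t, c i * g.inner x (v i) w := by
  simp only [map_sum, map_smul, _root_.sum_apply, _root_.smul_apply, smul_eq_mul]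

lemma inner_sum_right {ι : Type*} (t : Finset ι) (c : ι → ℝ) (v : ι → TangentSpace 𝓘(ℝ, E) x)
    (w : TangentSpace 𝓘(ℝ, E) x) :
    g.inner x w (∑ i ∈ t, c i • v i) = ∑ i ∈ t, c i * g.inner x w (v i) := by
  simp only [map_sum, map_smul, smul_eq_mul]

lemma eq_of_inner_basis {ι : Type*} [Fintype ι] (b : Basis ι ℝ (TangentSpace 𝓘(ℝ, E) x))
    {v w : TangentSpace 𝓘(ℝ, E) x} (h : ∀ i, g.inner x v (b i) = g.inner x w (b i)) : v = w := by
  refine tangent_ext g fun u => ?_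
  rw [← b.sum_repr u, inner_sum_right, inner_sum_right]
  simp only [h]

lemma contMDiffAt_det {ι : Type*} [Fintype ι] [DecidableEq ι] {A : M → Matrix ι ι ℝ}
    (h : ∀ i j, CMDiffAt ∞ (fun y => A y i j) x) : CMDiffAt ∞ (fun y => (A y).det) x := by
  simp_rw [Matrix.det_apply']
  refine contMDiffAt_finsetSum fun σ _ => ContMDiffAt.mul contMDiffAt_const ?_
  exact contMDiffAt_finsetProd fun i _ => h _ _

/-- A vector field is smooth if its scalar products with smooth vector fields are: Cramer's rule for
the Gram matrix of a smooth frame expresses its coordinates by them. -/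
lemma contMDiffAt_of_gfun [T2Space M] {V : VField E M}
    (h : ∀ Z : VField E M, CMDiff ∞ (T% Z) → CMDiffAt ∞ (gfun g V Z) x) :
    CMDiffAt ∞ (T% V) x := by
  classical
  obtain ⟨s, hs, hb⟩ := exists_smooth_frame (E := E) x
  let G (y : M) : Matrix (Fin (finrank ℝ E)) (Fin (finrank ℝ E)) ℝ :=
    .of fun i j => g.inner y (s i y) (s j y)
  let β (y : M) (j : Fin (finrank ℝ E)) : ℝ := g.inner y (V y) (s j y)
  have hdet : ∀ᶠ y in 𝓝 x, (G y).det ≠ 0 := by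
    filter_upwards [hb] with y ⟨b, hb⟩ h0
    obtain ⟨c, hc, hGc⟩ := Matrix.exists_mulVec_eq_zero_iff.2 h0
    have : ∑ i, c i • b i = 0 := by
      refine eq_of_inner_basis g b fun j => ?_
      have hj := congrFun hGc j
      simp only [Matrix.mulVec, dotProduct, G, Matrix.of_apply, Pi.zero_apply] at hj
      rw [inner_sum_left, map_zero, _root_.zero_apply, ← hj]
      refine Finset.sum_congr rfl fun i _ => ?_
      rw [hb, hb, g.symm, mul_comm]
    exact hc (funext fun i => by
      have := Fintype.linearIndependent_iff.1 b.linearIndependent c this i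
      simpa using this)
  let c (i : Fin (finrank ℝ E)) (y : M) : ℝ := (G y).det⁻¹ * (G y).cramer (β y) i
  have hc (i) : CMDiffAt ∞ (c i) x := by
    have h1 (i j) : CMDiffAt ∞ (fun y => G y i j) x := contMDiffAt_gfun g (hs i x) (hs j x)
    have h2 : CMDiffAt ∞ (fun y => (G y).det) x := contMDiffAt_det h1
    refine ContMDiffAt.mul (h2.inv₀ hdet.self_of_nhds) ?_
    simp_rw [Matrix.cramer_apply]
    refine contMDiffAt_det fun i' j' => ?_
    simp only [Matrix.updateCol_apply]
    split_ifs
    · exact h (s i') (hs i')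
    · exact h1 i' j'
  have : CMDiffAt ∞ (T% fun y => ∑ i, (c i • s i) y) x :=
    ContMDiffAt.sum_section fun i _ => (hc i).smul_section (hs i x)
  refine this.congr_of_eventuallyEq ?_
  filter_upwards [hb, hdet] with y ⟨b, hb⟩ hd
  suffices V y = ∑ i, c i y • s i y by simp [this]
  refine eq_of_inner_basis g b fun j => ?_
  have := congrFun (Matrix.mulVec_cramer (G y) (β y)) j
  simp only [Matrix.mulVec, dotProduct, Pi.smul_apply, smul_eq_mul] at this
  rw [inner_sum_left, hb]
  change β y j = _
  rw [← inv_mul_cancel_left₀ hd (β y j), ← this, Finset.mul_sum]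
  refine Finset.sum_congr rfl fun i _ => ?_
  simp only [c, G, Matrix.of_apply, g.symm y (s i y)]
  ring

end Fields

/-! ### Derivatives of functions, Lie brackets and covariant derivatives -/

section Calculus
variable {E : Type*} [NormedAddCommGroup E] [NormedSpace ℝ E] [FiniteDimensional ℝ E]
  {M : Type*} [TopologicalSpace M] [ChartedSpace E M] [IsManifold 𝓘(ℝ, E) ∞ M]
  {X Y Z : VField E M} {x : M} {u : M → ℝ}

lemma contMDiff_mvfderiv_apply (hu : CMDiff ∞ u) (hX : CMDiff ∞ (T% X)) :
    CMDiff ∞ fun y => d% u y (X y) := by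
  have h := (hu.contMDiff_tangentMap (m := ∞) (by simp)).comp hX
  exact contMDiff_snd_tangentBundle_modelSpace ℝ 𝓘(ℝ, ℝ) |>.comp h

lemma mvfderiv_congr {w : M → ℝ} (h : u =ᶠ[𝓝 x] w) : d% u x = d% w x := by
  simp only [mvfderiv, h.mfderiv_eq]
  rw [h.self_of_nhds]

lemma fderiv_comp_extChartAt_symm {z : E} (hz : z ∈ (extChartAt 𝓘(ℝ, E) x).target)
    (hu : MDiffAt u ((extChartAt 𝓘(ℝ, E) x).symm z))
    (v : TangentSpace 𝓘(ℝ, E) ((extChartAt 𝓘(ℝ, E) x).symm z)) :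
    fderiv ℝ (u ∘ (extChartAt 𝓘(ℝ, E) x).symm) z
      ((mfderiv% (extChartAt 𝓘(ℝ, E) x).symm z).inverse v) =
      d% u ((extChartAt 𝓘(ℝ, E) x).symm z) v := by
  have h1 : MDiffAt (extChartAt 𝓘(ℝ, E) x).symm z := by
    have := mdifferentiableWithinAt_extChartAt_symm (I := 𝓘(ℝ, E)) hz
    rwa [modelWithCornersSelf_coe, range_id, mdifferentiableWithinAt_univ] at this
  have h2 : (mfderiv% (extChartAt 𝓘(ℝ, E) x).symm z).IsInvertible := by
    have := isInvertible_mfderivWithin_extChartAt_symm (I := 𝓘(ℝ, E)) hz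
    rwa [modelWithCornersSelf_coe, range_id, mfderivWithin_univ] at this
  obtain ⟨w, rfl⟩ : ∃ w, (mfderiv% (extChartAt 𝓘(ℝ, E) x).symm z) w = v :=
    ⟨_, h2.self_apply_inverse v⟩
  rw [h2.inverse_apply_self, ← mfderiv_eq_fderiv]
  exact mvfderiv_comp_apply z hu h1 w

/-- The derivative along a Lie bracket is the commutator of the derivatives. -/
lemma mvfderiv_mlieBracket (hu : CMDiff ∞ u) (hX : CMDiff ∞ (T% X)) (hY : CMDiff ∞ (T% Y)) :
    d% u x (mlieBracket 𝓘(ℝ, E) X Y x) =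
      d% (fun y => d% u y (Y y)) x (X x) - d% (fun y => d% u y (X y)) x (Y x) := by
  set ψ := (extChartAt 𝓘(ℝ, E) x).symm with hψ
  have hd {w : M → ℝ} (hw : CMDiff ∞ w) (y : M) : MDiffAt w y :=
    (hw y).mdifferentiableAt (by simp)
  have hself {w : M → ℝ} (hw : CMDiff ∞ w) (v : E) :
      fderiv ℝ (w ∘ ψ) (extChartAt 𝓘(ℝ, E) x x) v = d% w x v := by
    simp only [mvfderiv, mfderiv, hd hw x]
    simp [writtenInExtChartAt, hψ]
    rfl
  have hz : (extChartAt 𝓘(ℝ, E) x).target ∈ 𝓝 (extChartAt 𝓘(ℝ, E) x x) :=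
    extChartAt_target_mem_nhds x
  let P (U : VField E M) : E → E := mpullback 𝓘(ℝ, E) 𝓘(ℝ, E) ψ U
  have hinv {L : E →L[ℝ] E} (hL : L = ContinuousLinearMap.id ℝ E) (v : E) : L.inverse v = v := by
    rw [hL, ContinuousLinearMap.inverse_id]
    rfl
  have hP (U : VField E M) : P U (extChartAt 𝓘(ℝ, E) x x) = U x := by
    have h1 : mfderiv% ψ (extChartAt 𝓘(ℝ, E) x x) = ContinuousLinearMap.id ℝ E := by
      have := mfderivWithin_range_extChartAt_symm (I := 𝓘(ℝ, E)) (x := x)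
      rwa [modelWithCornersSelf_coe, range_id, mfderivWithin_univ] at this
    refine (hinv h1 _).trans ?_
    have : ψ (extChartAt 𝓘(ℝ, E) x x) = x := extChartAt_to_inv x
    rw [this]
  have hPd {U : VField E M} (hU : CMDiff ∞ (T% U)) :
      DifferentiableAt ℝ (P U) (extChartAt 𝓘(ℝ, E) x x) := by
    have h1 : CMDiffAt[univ] 1 (T% U) x := ((hU x).of_le (by simp)).contMDiffWithinAt
    have h2 := contMDiffWithinAt_mpullbackWithin_extChartAt_symm (n := ∞) h1 uniqueMDiffOn_univ
      (mem_univ x) (by norm_cast)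
    rw [contMDiffWithinAt_vectorSpace_iff_contDiffWithinAt, preimage_univ, inter_univ,
      modelWithCornersSelf_coe, range_id, mpullbackWithin_univ] at h2
    exact (h2.contDiffAt hz).differentiableAt (by simp)
  have hfd {w : M → ℝ} (hw : CMDiff ∞ w) {U : VField E M} :
      (fun z => fderiv ℝ (w ∘ ψ) z (P U z)) =ᶠ[𝓝 (extChartAt 𝓘(ℝ, E) x x)]
        (fun y => d% w y (U y)) ∘ ψ := by
    filter_upwards [hz] with z hz
    exact fderiv_comp_extChartAt_symm hz (hd hw _) _
  have hbr : mlieBracket 𝓘(ℝ, E) X Y x =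
      lieBracket ℝ (P X) (P Y) (extChartAt 𝓘(ℝ, E) x x) := by
    rw [mlieBracket, mlieBracketWithin_apply]
    refine (hinv mfderiv_extChartAt_self _).trans ?_
    rw [modelWithCornersSelf_coe, range_id, mpullbackWithin_univ, mpullbackWithin_univ,
      preimage_univ, inter_univ]
    exact congrFun (lieBracketWithin_univ (V := P X) (W := P Y)) _
  have huψ : ContDiffAt ℝ 2 (u ∘ ψ) (extChartAt 𝓘(ℝ, E) x x) := by
    have h1 : ContMDiffAt 𝓘(ℝ, E) 𝓘(ℝ, E) ∞ ψ (extChartAt 𝓘(ℝ, E) x x) :=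
      (contMDiffOn_extChartAt_symm x).contMDiffAt hz
    exact ((hu _).comp _ h1).contDiffAt.of_le (by norm_cast)
  rw [hbr, ← hself hu, fderiv_apply_lieBracket huψ (by simp) (hPd hY) (hPd hX),
    (hfd hu).fderiv_eq, (hfd hu).fderiv_eq, hself (contMDiff_mvfderiv_apply hu hY),
    hself (contMDiff_mvfderiv_apply hu hX), hP, hP]

end Calculus

section Connection
variable {E : Type*} [NormedAddCommGroup E] [NormedSpace ℝ E] [FiniteDimensional ℝ E]
  {M : Type*} [TopologicalSpace M] [ChartedSpace E M] [IsManifold 𝓘(ℝ, E) ∞ M]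
  {X Y Z : VField E M} {x : M} (g : RiemMetric E M)

lemma leviCivita_congr (hX : MDiffAt (T% X) x) (hXY : Y =ᶠ[𝓝 x] X) :
    leviCivita g Y x = leviCivita g X x := by
  have hY : MDiffAt (T% Y) x :=
    hX.congr_of_eventuallyEq (hXY.mono fun z hz => by simp [hz])
  exact (leviCivita g).isCovariantDerivativeOnUniv.congr_of_eventuallyEq hY hX univ_mem hXY

/-- By the Koszul formula, `g(∇_X Y, Z)` is smooth for all smooth vector fields `Z`. -/
lemma contMDiff_leviCivita [T2Space M] (hX : CMDiff ∞ (T% X)) (hY : CMDiff ∞ (T% Y)) :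
    CMDiff ∞ (T% fun y => leviCivita g Y y (X y)) := by
  intro x
  refine contMDiffAt_of_gfun g fun Z hZ => ?_
  have hg {U V : VField E M} (hU : CMDiff ∞ (T% U)) (hV : CMDiff ∞ (T% V)) :
      CMDiff ∞ (gfun g U V) := fun y => contMDiffAt_gfun g (hU y) (hV y)
  have hb {U V : VField E M} (hU : CMDiff ∞ (T% U)) (hV : CMDiff ∞ (T% V)) :
      CMDiff ∞ (T% (mlieBracket 𝓘(ℝ, E) U V)) := by
    have : IsManifold 𝓘(ℝ, E) (minSmoothness ℝ 2) M := by
      rw [minSmoothness_of_isRCLikeNormedField]; infer_instance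
    have : IsManifold 𝓘(ℝ, E) (((⊤ : ℕ∞) : ℕ∞ω) + 1) M := inferInstanceAs (IsManifold _ ∞ M)
    exact ContDiff.mlieBracket_vectorField (m := ⊤) (n := ⊤) hU hV (by simp)
  have h : CMDiff ∞ (koszul g X Y Z) := by
    unfold koszul
    refine contMDiff_const.mul ?_
    refine ((((contMDiff_mvfderiv_apply (hg hY hZ) hX).add
      (contMDiff_mvfderiv_apply (hg hX hZ) hY)).sub
      (contMDiff_mvfderiv_apply (hg hX hY) hZ)).add (hg (hb hX hY) hZ)).sub
      (hg (hb hX hZ) hY) |>.sub (hg (hb hY hZ) hX)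
  refine (h x).congr_of_eventuallyEq (.of_forall fun y => ?_)
  have hd {U : VField E M} (hU : CMDiff ∞ (T% U)) : MDiffAt (T% U) y :=
    (hU y).mdifferentiableAt (by simp)
  exact inner_nablaAt g (hd hX) (hd hY) (hd hZ)

lemma smoothEndo_leviCivita [T2Space M] (hX : CMDiff ∞ (T% X)) :
    SmoothEndo (fun y => leviCivita g X y) :=
  smoothEndo_of_apply _ fun _ hZ => contMDiff_leviCivita g hZ hX

end Connection

/-! ### The curvature identity in an algebraic model -/

/-- The algebra of a torsion-free metric connection: `R` plays the role of the smooth functions and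
`V` that of the smooth vector fields; `der X a` is the derivative of `a` along `X`, and
`nab X Y` is `∇_X Y`. The Lie bracket does not appear, being `∇_X Y - ∇_Y X`. -/
structure MetricConnection (R V : Type*) [CommRing R] [AddCommGroup V] [Module R V] where
  met : V →ₗ[R] V →ₗ[R] R
  der : V → R → R
  nab : V → V → V
  met_symm : ∀ X Y, met X Y = met Y X
  met_nondeg : ∀ X, (∀ Z, met X Z = 0) → X = 0
  der_add : ∀ X a b, der X (a + b) = der X a + der X b
  nab_add_left : ∀ X Y Z, nab (X + Y) Z = nab X Z + nab Y Z
  nab_smul_left : ∀ (a : R) X Y, nab (a • X) Y = a • nab X Y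
  nab_add : ∀ X Y Z, nab X (Y + Z) = nab X Y + nab X Z
  nab_smul : ∀ X (a : R) Y, nab X (a • Y) = der X a • Y + a • nab X Y
  der_met : ∀ X Y Z, der X (met Y Z) = met (nab X Y) Z + met Y (nab X Z)
  der_comm : ∀ X Y a, der (nab X Y - nab Y X) a = der X (der Y a) - der Y (der X a)
  jacobi : ∀ X Y Z,
    nab X (nab Y Z - nab Z Y) - nab (nab Y Z - nab Z Y) X +
      (nab Y (nab Z X - nab X Z) - nab (nab Z X - nab X Z) Y) +
      (nab Z (nab X Y - nab Y X) - nab (nab X Y - nab Y X) Z) = 0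

namespace MetricConnection
variable {R V : Type*} [CommRing R] [Algebra ℝ R] [AddCommGroup V] [Module R V]
  (C : MetricConnection R V)

lemma eq_zero_of_ofNat_mul {n : ℕ} [n.AtLeastTwo] {a : R} (h : (OfNat.ofNat n : R) * a = 0) :
    a = 0 := by
  have h1 : algebraMap ℝ R (OfNat.ofNat n) * a = 0 := by rwa [map_ofNat]
  have h2 : algebraMap ℝ R ((OfNat.ofNat n)⁻¹) * (algebraMap ℝ R (OfNat.ofNat n) * a) = 0 := by
    rw [h1, mul_zero]
  rwa [← mul_assoc, ← map_mul, inv_mul_cancel₀ (NeZero.ne _), map_one, one_mul] at h2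

lemma met_ext {X Y : V} (h : ∀ Z, C.met X Z = C.met Y Z) : X = Y :=
  sub_eq_zero.1 <| C.met_nondeg _ fun Z => by simp [h]

lemma nab_zero (X : V) : C.nab X 0 = 0 := by simpa using C.nab_add X 0 0

lemma nab_neg (X Y : V) : C.nab X (-Y) = -C.nab X Y := by
  have := C.nab_add X Y (-Y)
  rw [add_neg_cancel, nab_zero] at this
  exact (neg_eq_of_add_eq_zero_right this.symm).symm

lemma nab_sub (X Y Z : V) : C.nab X (Y - Z) = C.nab X Y - C.nab X Z := by
  rw [sub_eq_add_neg, nab_add, nab_neg, ← sub_eq_add_neg]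

lemma nab_sub_left (X Y Z : V) : C.nab (X - Y) Z = C.nab X Z - C.nab Y Z := by
  have := C.nab_add_left (X - Y) Y Z
  rw [sub_add_cancel] at this
  rw [this, add_sub_cancel_right]

lemma nab_zero_left (X : V) : C.nab 0 X = 0 := by simpa using C.nab_smul_left 0 0 X

lemma nab_neg_left (X Y : V) : C.nab (-X) Y = -C.nab X Y := by
  rw [← zero_sub, nab_sub_left, nab_zero_left, zero_sub]

/-- The curvature `R_{X,Y} Z`. -/
def curv (X Y Z : V) : V :=
  C.nab X (C.nab Y Z) - C.nab Y (C.nab X Z) - C.nab (C.nab X Y - C.nab Y X) Z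

lemma curv_swap (X Y Z : V) : C.curv X Y Z = -C.curv Y X Z := by
  simp only [curv, nab_sub_left]
  abel

lemma bianchi (X Y Z : V) : C.curv X Y Z + C.curv Y Z X + C.curv Z X Y = 0 := by
  rw [← C.jacobi X Y Z]
  simp only [curv, nab_sub]
  abel

lemma met_curv (X Y Z W : V) : C.met (C.curv X Y Z) W = -C.met Z (C.curv X Y W) := by
  have h := C.der_comm X Y (C.met Z W)
  simp only [C.der_met, C.der_add] at h
  simp only [curv, map_sub, LinearMap.sub_apply]
  linear_combination -h

lemma met_curv_pair (X Y Z W : V) : C.met (C.curv X Y Z) W = C.met (C.curv Z W X) Y := by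
  have b (X Y Z W) : C.met (C.curv X Y Z) W + C.met (C.curv Y Z X) W + C.met (C.curv Z X Y) W
      = 0 := by
    rw [← LinearMap.add_apply, ← LinearMap.add_apply, ← map_add, ← map_add, C.bianchi, map_zero,
      LinearMap.zero_apply]
  have s (X Y Z W) : C.met (C.curv X Y Z) W = -C.met (C.curv Y X Z) W := by
    rw [C.curv_swap, map_neg, LinearMap.neg_apply]
  have t (X Y Z W) : C.met (C.curv X Y Z) W = -C.met (C.curv X Y W) Z := by
    rw [C.met_curv, C.met_symm]
  refine sub_eq_zero.1 (eq_zero_of_ofNat_mul (n := 2) ?_)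
  linear_combination b Y Z X W + b Z X W Y + b X W Y Z + b W Y Z X - t Y Z X W - t Z X Y W
    - t X W Z Y - t W Y X Z - s W Z X Y - s Y X W Z + t X Y W Z - t Z W Y X

/-- `∇² ξ`, i.e. `(∇_X B) Y` for the endomorphism `B = ∇ ξ`. -/
def hess (ξ X Y : V) : V := C.nab X (C.nab Y ξ) - C.nab (C.nab X Y) ξ

lemma met_hess_skew {ξ : V} (hξ : ∀ X Y, C.met (C.nab X ξ) Y = -C.met X (C.nab Y ξ)) (X Y Z : V) :
    C.met (C.hess ξ X Y) Z = -C.met (C.hess ξ X Z) Y := by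
  have h0 (a : R) : C.der X 0 = 0 := by simpa using C.der_add X 0 0
  have h : C.der X (C.met (C.nab Y ξ) Z + C.met Y (C.nab Z ξ)) = 0 := by
    rw [hξ, neg_add_cancel, h0 0]
  simp only [C.der_add, C.der_met] at h
  simp only [hess, map_sub, LinearMap.sub_apply, C.met_symm _ Y] at h ⊢
  linear_combination h - hξ Y (C.nab X Z) - hξ (C.nab X Y) Z

lemma met_hess_cyclic {ξ : V} (hξ : ∀ X Y, C.met (C.nab X ξ) Y = -C.met X (C.nab Y ξ))
    (X Y Z : V) :
    C.met (C.hess ξ X Y) Z + C.met (C.hess ξ Y Z) X + C.met (C.hess ξ Z X) Y = 0 := by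
  have s := C.met_hess_skew hξ
  have c (X Y) : C.hess ξ X Y - C.hess ξ Y X = C.curv X Y ξ := by
    simp only [hess, curv, nab_sub_left]; abel
  have c' (X Y Z) : C.met (C.hess ξ X Y) Z - C.met (C.hess ξ Y X) Z = -C.met (C.curv X Y Z) ξ := by
    rw [← LinearMap.sub_apply, ← map_sub, c, C.met_curv, C.met_symm]
  have b : C.met (C.curv X Y Z) ξ + C.met (C.curv Y Z X) ξ + C.met (C.curv Z X Y) ξ = 0 := by
    rw [← LinearMap.add_apply, ← LinearMap.add_apply, ← map_add, ← map_add, C.bianchi, map_zero,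
      LinearMap.zero_apply]
  refine eq_zero_of_ofNat_mul (n := 2) ?_
  linear_combination c' X Y Z + c' Y Z X + c' Z X Y - b + s Y X Z + s Z Y X + s X Z Y

/-- For a Killing field `ξ`, `∇²_{X,Y} ξ = R_{X,ξ} Y`. -/
lemma hess_eq_curv {ξ : V} (hξ : ∀ X Y, C.met (C.nab X ξ) Y = -C.met X (C.nab Y ξ)) (X Y : V) :
    C.hess ξ X Y = C.curv X ξ Y := by
  refine C.met_ext fun Z => ?_
  have s := C.met_hess_skew hξ
  have c : C.hess ξ Y Z - C.hess ξ Z Y = C.curv Y Z ξ := by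
    simp only [hess, curv, nab_sub_left]; abel
  have c' : C.met (C.hess ξ Y Z) X - C.met (C.hess ξ Z Y) X = C.met (C.curv Y Z ξ) X := by
    rw [← LinearMap.sub_apply, ← map_sub, c]
  have p := C.met_curv_pair Y Z ξ X
  have q : C.met (C.curv ξ X Y) Z = -C.met (C.curv X ξ Y) Z := by
    rw [C.curv_swap, map_neg, LinearMap.neg_apply]
  have k := C.met_hess_cyclic hξ X Y Z
  linear_combination k - c' - p - q - s Z X Y

/-- A nearly Sasakian structure, in algebraic form, together with the two facts that `ξ` is a
Killing field and `φ B + B φ = 2 (id - η ⊗ ξ)` for `B = ∇ ξ`. -/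
structure IsNearlySasakian (φ : V →ₗ[R] V) (ξ : V) : Prop where
  unit : C.met ξ ξ = 1
  φ_sq : ∀ X, φ (φ X) = -X + C.met ξ X • ξ
  φ_ξ : φ ξ = 0
  nearly : ∀ Y, C.nab Y (φ Y) - φ (C.nab Y Y) = C.met Y Y • ξ - C.met ξ Y • Y
  killing : ∀ X Y, C.met (C.nab X ξ) Y = -C.met X (C.nab Y ξ)
  anti : ∀ X, φ (C.nab X ξ) + C.nab (φ X) ξ = (2 : R) • (X - C.met ξ X • ξ)

namespace IsNearlySasakian

variable {C} {φ : V →ₗ[R] V} {ξ : V} (h : C.IsNearlySasakian φ ξ)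
include h

lemma polarized (X Y : V) :
    C.nab X (φ Y) - φ (C.nab X Y) + (C.nab Y (φ X) - φ (C.nab Y X)) =
      (2 * C.met X Y) • ξ - C.met ξ X • Y - C.met ξ Y • X := by
  have h1 := h.nearly (X + Y)
  simp only [map_add, C.nab_add, C.nab_add_left, LinearMap.add_apply, C.met_symm Y X] at h1
  linear_combination (norm := module) h1 - h.nearly X - h.nearly Y

lemma met_nab_ξ (X : V) : C.met ξ (C.nab X ξ) = 0 := by
  have h0 : C.der X 1 = 0 := by
    have h1 := C.nab_smul X 1 ξ
    rw [one_smul, one_smul, right_eq_add] at h1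
    have h2 : C.met (C.der X 1 • ξ) ξ = 0 := by rw [h1, map_zero, LinearMap.zero_apply]
    simpa [h.unit] using h2
  have h2 := C.der_met X ξ ξ
  rw [h.unit, h0, C.met_symm] at h2
  exact eq_zero_of_ofNat_mul (n := 2) (by linear_combination -h2)

lemma nab_ξ_ξ : C.nab ξ ξ = 0 :=
  C.met_nondeg _ fun Z => by rw [h.killing, h.met_nab_ξ, neg_zero]

lemma nab_ξ_φ (Y : V) :
    C.nab ξ (φ Y) = φ (C.nab ξ Y) + φ (C.nab Y ξ) + C.met ξ Y • ξ - Y := by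
  have := h.polarized ξ Y
  rw [h.φ_ξ, C.nab_zero, h.unit] at this
  linear_combination (norm := module) this

lemma met_nab_self (W : V) : C.met (C.nab W ξ) W = 0 := by
  have := h.killing W W
  rw [C.met_symm W] at this
  exact eq_zero_of_ofNat_mul (n := 2) (by linear_combination this)

/-- The second covariant derivative `(∇²_{ξ,W} φ) W` vanishes, as `ξ` is parallel along itself. -/
lemma nab_ξ_nearly (W : V) :
    C.nab ξ (C.nab W (φ W) - φ (C.nab W W)) - (C.nab (C.nab ξ W) (φ W) - φ (C.nab (C.nab ξ W) W))
      - (C.nab W (φ (C.nab ξ W)) - φ (C.nab W (C.nab ξ W))) = 0 := by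
  have h1 := h.polarized (C.nab ξ W) W
  rw [h.nearly, C.nab_sub, C.nab_smul, C.nab_smul, C.der_met, C.der_met, h.nab_ξ_ξ, map_zero,
    LinearMap.zero_apply, C.met_symm W]
  linear_combination (norm := module) -h1

lemma nab_smul_ξ (W Y : V) : C.nab W (C.met ξ Y • ξ) =
    (C.met (C.nab W ξ) Y + C.met ξ (C.nab W Y)) • ξ + C.met ξ Y • C.nab W ξ := by
  rw [C.nab_smul, C.der_met]

/-- The endomorphism `∇_W B` vanishes on `φ W`. -/
lemma hess_φ_self (W : V) : C.hess ξ W (φ W) = 0 := by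
  -- the Ricci identity for `φ` and the pair `(W, ξ)`
  have ricci : C.hess ξ W (φ W) - φ (C.hess ξ W W) =
      C.nab W (C.nab ξ (φ W) - φ (C.nab ξ W))
        - (C.nab (C.nab W ξ) (φ W) - φ (C.nab (C.nab W ξ) W))
        - (C.nab ξ (φ (C.nab W W)) - φ (C.nab ξ (C.nab W W))) := by
    have h1 := h.nab_ξ_nearly W
    rw [C.hess_eq_curv h.killing, C.hess_eq_curv h.killing]
    simp only [curv, C.nab_sub, C.nab_sub_left, map_sub] at h1 ⊢
    linear_combination (norm := module) -h1
  have h2 : C.nab W (C.nab ξ (φ W) - φ (C.nab ξ W)) =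
      C.nab W (φ (C.nab W ξ)) + C.nab W (C.met ξ W • ξ) - C.nab W W := by
    rw [h.nab_ξ_φ, ← C.nab_add, ← C.nab_sub]
    congr 1
    abel
  have h3 := h.nab_ξ_φ (C.nab W W)
  have h4 := h.polarized W (C.nab W ξ)
  rw [h.met_nab_ξ, C.met_symm, h.met_nab_self] at h4
  -- the derivative along `W` of `φ B + B φ = 2 (id - η ⊗ ξ)`
  have h5 : C.nab W (φ (C.nab W ξ) + C.nab (φ W) ξ) = C.nab W ((2 : R) • (W - C.met ξ W • ξ)) := by
    rw [h.anti]
  have h6 := h.anti (C.nab W W)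
  have h7 : C.nab W ((2 : R) • (W - C.met ξ W • ξ)) =
      (2 : R) • (C.nab W W - C.nab W (C.met ξ W • ξ)) := by
    rw [two_smul, C.nab_add, C.nab_sub, two_smul]
  have h8 : C.nab (C.nab W (φ W) - φ (C.nab W W)) ξ = -(C.met ξ W • C.nab W ξ) := by
    rw [h.nearly, C.nab_sub_left, C.nab_smul_left, C.nab_smul_left, h.nab_ξ_ξ, smul_zero, zero_sub]
  rw [C.nab_sub_left] at h8
  rw [h7, C.nab_add] at h5
  have h9 := h.nab_smul_ξ W W
  rw [h.met_nab_self] at h9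
  have key : (3 : R) • C.hess ξ W (φ W) = 0 := by
    rw [h2, h3, h9] at ricci
    rw [h9] at h5
    simp only [hess, map_sub] at ricci ⊢
    linear_combination (norm := module) ricci + (2 : R) • h5 - (2 : R) • h6 - (2 : R) • h8 - h4
  refine C.met_nondeg _ fun Z => eq_zero_of_ofNat_mul (n := 3) ?_
  have : C.met ((3 : R) • C.hess ξ W (φ W)) Z = 0 := by rw [key, map_zero, LinearMap.zero_apply]
  simpa using this

lemma hess_φ_swap (W U : V) : C.hess ξ W (φ U) = -C.hess ξ U (φ W) := by
  have h1 := h.hess_φ_self (W + U)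
  have h2 := h.hess_φ_self W
  have h3 := h.hess_φ_self U
  simp only [hess, map_add, C.nab_add, C.nab_add_left] at h1 h2 h3 ⊢
  linear_combination (norm := module) h1 - h2 - h3

lemma hess_ξ (W : V) : C.hess ξ W ξ = -C.nab (C.nab W ξ) ξ := by
  rw [hess, h.nab_ξ_ξ, C.nab_zero, zero_sub]

omit h in
lemma hess_neg_add (W Y : V) (a : R) :
    C.hess ξ W (-Y + a • ξ) = -C.hess ξ W Y + a • C.hess ξ W ξ := by
  simp only [hess, C.nab_add, C.nab_add_left, C.nab_smul, C.nab_smul_left, C.nab_neg, C.nab_neg_left]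
  module

/-- The 3-form `(W, U, Z) ↦ g((∇_W B) φ U, φ Z)` vanishes: it is totally skew, and `φ` acts on it
as a derivation by zero because `B` is closed as a 2-form; but this action is invertible on forms
of odd degree. -/
lemma met_hess_φ_φ (W U Z : V) : C.met (C.hess ξ W (φ U)) (φ Z) = 0 := by
  let k (W U Z : V) : R := C.met (C.hess ξ W (φ U)) (φ Z)
  have k12 (W U Z) : k W U Z = -k U W Z := by
    simp only [k]; rw [h.hess_φ_swap, map_neg, LinearMap.neg_apply]
  have k23 (W U Z) : k W U Z = -k W Z U := C.met_hess_skew h.killing _ _ _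
  have kξ (U Z) : k ξ U Z = 0 := by
    rw [k12]
    simp [k, h.φ_ξ, hess, C.nab_zero, C.nab_zero_left]
  have kφ (W U Z) : k (φ (φ W)) U Z = -k W U Z := by
    have h1 : C.hess ξ (-W + C.met ξ W • ξ) (φ U) =
        -C.hess ξ W (φ U) + C.met ξ W • C.hess ξ ξ (φ U) := by
      simp only [hess, C.nab_add_left, C.nab_smul_left, C.nab_neg_left]
      module
    have h2 := kξ U Z
    simp only [k] at h2 ⊢
    rw [h.φ_sq W, h1]
    simp [h2]
  have kd (W U Z) : k (φ W) U Z + k W (φ U) Z + k W U (φ Z) = 0 := by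
    have := C.met_hess_cyclic h.killing (φ W) (φ U) (φ Z)
    change k (φ W) U Z + k (φ U) Z W + k (φ Z) W U = 0 at this
    linear_combination this + k12 W (φ U) Z - k23 (φ U) W Z + k23 W U (φ Z) - k12 W (φ Z) U
  have kφ2 (W U Z) : k W (φ (φ U)) Z = -k W U Z := by rw [k12, kφ, k12 U W Z, neg_neg]
  have kφ3 (W U Z) : k W U (φ (φ Z)) = -k W U Z := by rw [k23, kφ2, k23 W Z U, neg_neg]
  have k4 (W U Z) : 2 * k (φ W) (φ U) Z = k W U Z := by
    linear_combination kd (φ W) U Z + kd W (φ U) Z - kd W U (φ Z)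
      - kφ W U Z - kφ2 W U Z + kφ3 W U Z
  have h5 := k4 (φ W) (φ U) Z
  rw [kφ, kφ2] at h5
  exact eq_zero_of_ofNat_mul (n := 3) (by linear_combination 2 * h5 + k4 W U Z)

/-- The curvature identity `(∇_W B) Y = g(B² W, Y) ξ - η(Y) B² W`. -/
theorem hess_eq (W Y : V) : C.hess ξ W Y =
    C.met (C.nab (C.nab W ξ) ξ) Y • ξ - C.met ξ Y • C.nab (C.nab W ξ) ξ := by
  have hY (Y : V) : Y = -φ (φ Y) + C.met ξ Y • ξ := by rw [h.φ_sq]; abel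
  have hBB (Y : V) : C.met (C.nab (C.nab W ξ) ξ) (φ (φ Y)) = -C.met (C.nab (C.nab W ξ) ξ) Y := by
    rw [h.φ_sq, map_add, map_neg, map_smul, C.met_symm _ ξ, h.met_nab_ξ, smul_zero, add_zero]
  have hξ (Y : V) : C.met (C.hess ξ W Y) ξ = C.met (C.nab (C.nab W ξ) ξ) Y := by
    rw [C.met_hess_skew h.killing, h.hess_ξ, map_neg, LinearMap.neg_apply, neg_neg]
  refine C.met_ext fun Z => ?_
  have h1 : C.met (C.hess ξ W (φ (φ Y))) Z =
      -C.met ξ Z * C.met (C.nab (C.nab W ξ) ξ) Y := by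
    conv_lhs => rw [hY Z]
    rw [map_add, map_neg, h.met_hess_φ_φ, map_smul, hξ, hBB, smul_eq_mul]
    ring
  have h2 : C.met (C.hess ξ W Y) Z = C.met (C.hess ξ W (-φ (φ Y) + C.met ξ Y • ξ)) Z := by
    rw [← hY]
  rw [h2, hess_neg_add, h.hess_ξ]
  simp only [map_add, map_neg, map_sub, map_smul, LinearMap.add_apply, LinearMap.neg_apply,
    LinearMap.sub_apply, LinearMap.smul_apply, smul_eq_mul, h1]
  ring

end IsNearlySasakian

end MetricConnection

/-! ### The Levi-Civita connection on smooth vector fields -/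

section Algebra
variable {E : Type*} [NormedAddCommGroup E] [NormedSpace ℝ E] [FiniteDimensional ℝ E]
  {M : Type*} [TopologicalSpace M] [ChartedSpace E M] [IsManifold 𝓘(ℝ, E) ∞ M]
  {X X' Y Y' Z : VField E M} {x : M} (g : RiemMetric E M)

lemma leviCivita_add (hX : MDiffAt (T% X) x) (hY : MDiffAt (T% Y) x) :
    leviCivita g (fun y => X y + Y y) x = leviCivita g X x + leviCivita g Y x :=
  (leviCivita g).isCovariantDerivativeOnUniv.add hX hY

lemma leviCivita_smul {f : M → ℝ} (hf : MDiffAt f x) (hX : MDiffAt (T% X) x)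
    (v : TangentSpace 𝓘(ℝ, E) x) :
    leviCivita g (fun y => f y • X y) x v = d% f x v • X x + f x • leviCivita g X x v := by
  have := (leviCivita g).isCovariantDerivativeOnUniv.leibniz hX hf (mem_univ x)
  have := congrArg (fun L => L v) this
  rw [add_comm]
  exact this

lemma leviCivita_const_smul (c : ℝ) (hX : MDiffAt (T% X) x) (v : TangentSpace 𝓘(ℝ, E) x) :
    leviCivita g (fun y => c • X y) x v = c • leviCivita g X x v := by
  rw [leviCivita_smul g mdifferentiableAt_const hX, mvfderiv_const]
  simp

lemma leviCivita_zero : leviCivita g (fun y => (0 : TangentSpace 𝓘(ℝ, E) y)) x = 0 :=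
  (leviCivita g).isCovariantDerivativeOnUniv.zero

lemma leviCivita_neg (hX : MDiffAt (T% X) x) (v : TangentSpace 𝓘(ℝ, E) x) :
    leviCivita g (fun y => -X y) x v = -leviCivita g X x v := by
  have := leviCivita_const_smul g (-1) hX v
  simpa using this

lemma leviCivita_sub (hX : MDiffAt (T% X) x) (hY : MDiffAt (T% Y) x)
    (v : TangentSpace 𝓘(ℝ, E) x) :
    leviCivita g (fun y => X y - Y y) x v = leviCivita g X x v - leviCivita g Y x v := by
  have h : MDiffAt (T% fun y => -Y y) x := mdifferentiableAt_neg_section hY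
  have := congrArg (fun L => L v) (leviCivita_add g hX h)
  simp only [_root_.add_apply, leviCivita_neg g hY, ← sub_eq_add_neg] at this
  exact this

variable (E M) in
/-- The ring of smooth functions. -/
abbrev SmoothFun := C^∞⟮𝓘(ℝ, E), M; 𝓘(ℝ, ℝ), ℝ⟯

variable (E M) in
/-- The module of smooth vector fields. -/
abbrev SmoothField := Cₛ^∞⟮𝓘(ℝ, E); E, fun x : M => TangentSpace 𝓘(ℝ, E) x⟯

instance : SMul (SmoothFun E M) (SmoothField E M) where
  smul f X := ⟨fun y => f y • X y, ContMDiff.smul_section f.contMDiff X.contMDiff⟩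

lemma smoothField_smul_apply (f : SmoothFun E M) (X : SmoothField E M) (y : M) :
    (f • X) y = f y • X y := rfl

lemma smoothField_add_apply (X Y : SmoothField E M) (y : M) : (X + Y) y = X y + Y y := rfl

lemma smoothField_zero_apply (y : M) : (0 : SmoothField E M) y = 0 := rfl

/-- The module structure over the ring of smooth functions, not only over the real numbers. -/
instance : Module (SmoothFun E M) (SmoothField E M) where
  one_smul X := by ext y; exact one_smul ℝ (X y)
  mul_smul f f' X := by ext y; exact mul_smul (f y) (f' y) (X y)
  smul_zero f := by ext y; exact smul_zero (f y)
  smul_add f X Y := by ext y; exact smul_add (f y) (X y) (Y y)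
  add_smul f f' X := by ext y; exact add_smul (f y) (f' y) (X y)
  zero_smul X := by ext y; exact zero_smul ℝ (X y)

lemma SmoothField.mdiff (X : SmoothField E M) (x : M) : MDiffAt (T% fun y => X y) x :=
  X.mdifferentiableAt

/-- Smooth tensor fields act on the module of smooth vector fields. -/
def endoMap (A : EndoField E M) (hA : SmoothEndo A) :
    SmoothField E M →ₗ[SmoothFun E M] SmoothField E M where
  toFun X := ⟨fun y => A y (X y), fun y => hA.contMDiffAt_apply (X.contMDiff y)⟩
  map_add' X Y := by ext y; exact map_add (A y) (X y) (Y y)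
  map_smul' f X := by ext y; exact map_smul (A y) (f y) (X y)

lemma contMDiff_gfun (X Y : SmoothField E M) : CMDiff ∞ (gfun g (fun y => X y) fun y => Y y) :=
  fun y => contMDiffAt_gfun g (X.contMDiff y) (Y.contMDiff y)

/-- The Levi-Civita connection on the module of smooth vector fields. The Hausdorff property provides
the bump functions that make the metric nondegenerate on global vector fields. -/
def riemConnection [T2Space M] : MetricConnection (SmoothFun E M) (SmoothField E M) where
  met := LinearMap.mk₂ (SmoothFun E M)
    (fun X Y => ⟨gfun g (fun y => X y) fun y => Y y, contMDiff_gfun g X Y⟩)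
    (fun X X' Y => by ext y; simp [gfun, smoothField_add_apply]; rfl)
    (fun f X Y => by ext y; simp [gfun, smoothField_smul_apply]; rfl)
    (fun X Y Y' => by ext y; simp [gfun, smoothField_add_apply]; rfl)
    (fun f X Y => by ext y; simp [gfun, smoothField_smul_apply]; rfl)
  der X f := ⟨fun y => d% f y (X y), contMDiff_mvfderiv_apply f.contMDiff X.contMDiff⟩
  nab X Y := ⟨fun y => leviCivita g (fun z => Y z) y (X y),
    contMDiff_leviCivita g X.contMDiff Y.contMDiff⟩
  met_symm X Y := by ext y; exact g.symm y _ _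
  met_nondeg X h := by
    ext y
    refine tangent_ext g fun u => ?_
    obtain ⟨Z, hZ, rfl⟩ := exists_contMDiff_apply_eq (E := E) u
    have := congrArg (fun f : SmoothFun E M => f y) (h ⟨Z, hZ⟩)
    rw [smoothField_zero_apply, map_zero, _root_.zero_apply]
    exact this
  der_add X a b := by
    ext y
    have := mvfderiv_add (a.mdifferentiableAt (x := y)) (b.mdifferentiableAt (x := y))
    exact congrArg (fun L => L (X y)) this
  nab_add_left X Y Z := by
    ext y
    exact map_add (leviCivita g (fun z => Z z) y) (X y) (Y y)
  nab_smul_left f X Y := by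
    ext y
    exact map_smul (leviCivita g (fun z => Y z) y) (f y) (X y)
  nab_add X Y Z := by
    ext y
    exact congrArg (fun L => L (X y)) (leviCivita_add g (Y.mdiff y) (Z.mdiff y))
  nab_smul X f Y := by
    ext y
    exact leviCivita_smul g (f.mdifferentiableAt (x := y)) (Y.mdiff y) (X y)
  der_met X Y Z := by
    ext y
    exact leviCivita_metric g (Y.mdiff y) (Z.mdiff y) (X y)
  der_comm X Y f := by
    ext y
    have := mvfderiv_mlieBracket (x := y) f.contMDiff X.contMDiff Y.contMDiff
    rw [← leviCivita_torsion g (X.mdiff y) (Y.mdiff y)] at this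
    exact this
  jacobi X Y Z := by
    let nab (X Y : SmoothField E M) : SmoothField E M := ⟨fun y => leviCivita g (fun z => Y z) y (X y),
      contMDiff_leviCivita g X.contMDiff Y.contMDiff⟩
    have hbr (X Y : SmoothField E M) : (fun y => (nab X Y - nab Y X) y) =
        mlieBracket 𝓘(ℝ, E) (fun z => X z) fun z => Y z :=
      funext fun y => leviCivita_torsion g (X.mdiff y) (Y.mdiff y)
    have hm : IsManifold 𝓘(ℝ, E) (minSmoothness ℝ 3) M := by
      rw [minSmoothness_of_isRCLikeNormedField]; infer_instance
    have hsm (X : SmoothField E M) (y : M) :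
        CMDiffAt (minSmoothness ℝ 2) (T% fun y => X y) y := by
      rw [minSmoothness_of_isRCLikeNormedField]
      exact (X.contMDiff y).of_le (by norm_cast)
    have key (X Y Z : SmoothField E M) (y : M) : (nab X (nab Y Z - nab Z Y) -
        nab (nab Y Z - nab Z Y) X) y = mlieBracket 𝓘(ℝ, E) (fun z => X z)
          (mlieBracket 𝓘(ℝ, E) (fun z => Y z) fun z => Z z) y := by
      rw [congrFun (hbr _ _) y, hbr]
    ext y
    change (nab X (nab Y Z - nab Z Y) - nab (nab Y Z - nab Z Y) X) y +
      (nab Y (nab Z X - nab X Z) - nab (nab Z X - nab X Z) Y) y +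
      (nab Z (nab X Y - nab Y X) - nab (nab X Y - nab Y X) Z) y = 0
    have h1 := leibniz_identity_mlieBracket_apply (hsm X y) (hsm Y y) (hsm Z y)
    rw [key, key, key, h1, mlieBracket_swap_apply (V := mlieBracket 𝓘(ℝ, E) (fun z => X z) _),
      mlieBracket_swap (V := fun z => Z z) (W := fun z => X z)]
    have h2 : mlieBracket 𝓘(ℝ, E) (fun z => Y z)
        (-mlieBracket 𝓘(ℝ, E) (fun z => X z) fun z => Z z) y =
        -mlieBracket 𝓘(ℝ, E) (fun z => Y z) (mlieBracket 𝓘(ℝ, E) (fun z => X z) fun z => Z z) y := by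
      have h3 : MDiffAt (T% (mlieBracket 𝓘(ℝ, E) (fun z => X z) fun z => Z z)) y := by
        rw [← hbr]
        exact (nab X Z - nab Z X).mdiff y
      have := mlieBracket_const_smul_right (I := 𝓘(ℝ, E)) (c := (-1 : ℝ)) (V := fun z => Y z) h3
      simpa only [neg_smul, one_smul] using this
    rw [h2]
    abel

end Algebra

/-! ### Weak nearly Sasakian structures -/

section Weak
variable {E : Type*} [NormedAddCommGroup E] [NormedSpace ℝ E] [FiniteDimensional ℝ E]
  {M : Type*} [TopologicalSpace M] [ChartedSpace E M] [IsManifold 𝓘(ℝ, E) ∞ M]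
  {X X' Y Y' Z : VField E M} {x : M} {g : RiemMetric E M}

lemma SmoothEndo.mdifferentiableAt_apply {A : EndoField E M} (hA : SmoothEndo A)
    (hX : SmoothNear X x) : MDiffAt (T% fun y => A y (X y)) x :=
  (hA.smoothNear hX).mdifferentiableAt

lemma covDerivEndo_add {A : EndoField E M} (hA : SmoothEndo A) (hX : SmoothNear X x)
    (hY : SmoothNear Y x) (v : TangentSpace 𝓘(ℝ, E) x) :
    covDerivEndo g A (fun y => X y + Y y) x v =
      covDerivEndo g A X x v + covDerivEndo g A Y x v := by
  have h := leviCivita_add g (hA.mdifferentiableAt_apply hX) (hA.mdifferentiableAt_apply hY)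
  have h' := leviCivita_add g hX.mdifferentiableAt hY.mdifferentiableAt
  simp only [covDerivEndo, map_add, h, h', _root_.add_apply]
  abel

lemma covDerivEndo_smul {A : EndoField E M} (hA : SmoothEndo A) {f : M → ℝ} (hf : MDiffAt f x)
    (hX : SmoothNear X x) (v : TangentSpace 𝓘(ℝ, E) x) :
    covDerivEndo g A (fun y => f y • X y) x v = f x • covDerivEndo g A X x v := by
  have h := leviCivita_smul g hf (hA.mdifferentiableAt_apply hX) v
  have h' := leviCivita_smul g hf hX.mdifferentiableAt v
  simp only [covDerivEndo, map_smul, h, h', map_add]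
  module

lemma covDerivEndo_congr {A : EndoField E M} (hA : SmoothEndo A) (hX : SmoothNear X x)
    (h : Y =ᶠ[𝓝 x] X) (v : TangentSpace 𝓘(ℝ, E) x) :
    covDerivEndo g A Y x v = covDerivEndo g A X x v := by
  have h1 : (fun y => A y (Y y)) =ᶠ[𝓝 x] fun y => A y (X y) := by
    filter_upwards [h] with y hy
    rw [hy]
  simp only [covDerivEndo, leviCivita_congr g hX.mdifferentiableAt h,
    leviCivita_congr g (hA.mdifferentiableAt_apply hX) h1]

lemma covDerivEndo_add_right (A : EndoField E M) (Y : VField E M)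
    (v w : TangentSpace 𝓘(ℝ, E) x) :
    covDerivEndo g A Y x (v + w) = covDerivEndo g A Y x v + covDerivEndo g A Y x w := by
  simp only [covDerivEndo, map_add]
  abel

/-- The covariant derivative of a symmetric (`ε = 1`) or skew (`ε = -1`) endomorphism field is
symmetric or skew. -/
lemma inner_covDerivEndo {A : EndoField E M} (hA : SmoothEndo A) {ε : ℝ}
    (hε : ∀ y v w, g.inner y (A y v) w = ε * g.inner y v (A y w))
    (hX : SmoothNear X x) (hY : SmoothNear Y x) (v : TangentSpace 𝓘(ℝ, E) x) :
    g.inner x (covDerivEndo g A X x v) (Y x) = ε * g.inner x (X x) (covDerivEndo g A Y x v) := by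
  have h1 := leviCivita_metric g (hA.mdifferentiableAt_apply hX) hY.mdifferentiableAt v
  have h2 := leviCivita_metric g hX.mdifferentiableAt (hA.mdifferentiableAt_apply hY) v
  have h3 : (fun y => g.inner y (A y (X y)) (Y y)) =
      (fun _ => ε) * gfun g X (fun y => A y (Y y)) := funext fun y => hε y _ _
  change d% (gfun g X (fun y => A y (Y y))) x v = _ at h2
  rw [h3, mvfderiv_mul mdifferentiableAt_const
    (mdiffAt_gfun g hX.mdifferentiableAt (hA.mdifferentiableAt_apply hY)), mvfderiv_const] at h1
  simp only [_root_.smul_apply, smul_zero, add_zero, h2, smul_eq_mul, hε] at h1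
  simp only [covDerivEndo, map_sub, _root_.sub_apply, hε]
  linear_combination -h1

end Weak

namespace IsWeakAlmostContactMetric
variable {E : Type*} [NormedAddCommGroup E] [NormedSpace ℝ E] [FiniteDimensional ℝ E]
  {M : Type*} [TopologicalSpace M] [ChartedSpace E M] [IsManifold 𝓘(ℝ, E) ∞ M]
  {g : RiemMetric E M} {φ Q : EndoField E M} {ξ : VField E M} {η : OneForm E M}
  (h : IsWeakAlmostContactMetric g φ Q ξ η) (x : M) (v w : TangentSpace 𝓘(ℝ, E) x)
include h

lemma φ_ξ : φ x (ξ x) = 0 := by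
  have h1 : φ x (φ x (ξ x)) = 0 := by rw [h.φ_sq, h.Q_ξ, h.η_ξ, one_smul, neg_add_cancel]
  have h2 : Q x (φ x (ξ x)) = Q x (η x (φ x (ξ x)) • ξ x) := by
    have := h.φ_sq x (φ x (ξ x))
    rw [h1, map_zero] at this
    rw [map_smul, h.Q_ξ]
    exact (neg_add_eq_zero.1 this.symm)
  have h3 := (h.Q_nonsingular x).1 h2
  obtain ⟨c, hc⟩ : ∃ c : ℝ, φ x (ξ x) = c • ξ x := ⟨_, h3⟩
  rw [hc, map_smul, hc, smul_smul] at h1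
  have h4 := congrArg (η x) h1
  rw [map_smul, h.η_ξ, map_zero, smul_eq_mul, mul_one, mul_self_eq_zero] at h4
  rw [hc, h4, zero_smul]

lemma η_eq : η x v = g.inner x (ξ x) v := by
  have := h.compatible x v (ξ x)
  rw [h.φ_ξ, map_zero, h.Q_ξ, h.η_ξ, mul_one] at this
  rw [g.symm]
  linarith

lemma inner_ξ_ξ : g.inner x (ξ x) (ξ x) = 1 := by rw [← h.η_eq, h.η_ξ]

lemma ξ_ne_zero : ξ x ≠ 0 := fun h0 => by
  have := h.η_ξ x
  rw [h0, map_zero] at this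
  exact zero_ne_one this

lemma η_φ : η x (φ x v) = 0 := by
  have h1 := h.ker_invariant x (v - η x v • ξ x) (by simp [h.η_ξ])
  rwa [map_sub, map_smul, h.φ_ξ, smul_zero, sub_zero] at h1

lemma inner_Q : g.inner x (Q x v) w = g.inner x v (Q x w) := by
  have h1 := h.compatible x v w
  have h2 := h.compatible x w v
  rw [g.symm x (φ x w)] at h2
  rw [g.symm x (Q x v)]
  linarith

lemma exists_φ_φ_eq (hv : η x v = 0) : ∃ u, φ x (φ x u) = v := by
  obtain ⟨u, hu⟩ := (h.Q_nonsingular x).2 (-v)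
  refine ⟨u, ?_⟩
  have : η x u = 0 := by
    rw [h.η_eq, ← h.Q_ξ, h.inner_Q, hu, ← h.η_eq, map_neg, hv, neg_zero]
  rw [h.φ_sq, hu, this, zero_smul, add_zero, neg_neg]

lemma inner_φ : g.inner x (φ x v) w = -g.inner x v (φ x w) := by
  obtain ⟨u, hu⟩ := h.exists_φ_φ_eq x (w - η x w • ξ x) (by simp [h.η_ξ])
  have h1 : g.inner x (φ x v) (φ x (φ x u)) = -g.inner x v (φ x (φ x (φ x u))) := by
    rw [h.compatible, h.φ_sq x (φ x u), h.η_φ, zero_smul, add_zero, map_neg, mul_zero, sub_zero,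
      neg_neg]
  rw [hu, map_sub, map_sub, map_smul, map_smul, h.φ_ξ, g.symm x _ (ξ x), ← h.η_eq, h.η_φ] at h1
  simpa using h1

lemma eq_smul_ξ_of_φ_eq_zero (hv : φ x v = 0) : v = η x v • ξ x := by
  refine (h.Q_nonsingular x).1 ?_
  have := h.φ_sq x v
  rw [hv, map_zero] at this
  rw [map_smul, h.Q_ξ]
  exact (neg_add_eq_zero.1 this.symm)

lemma Q_φ : Q x (φ x v) = φ x (Q x v) := by
  have h1 := h.φ_sq x (φ x v)
  have h2 := congrArg (φ x) (h.φ_sq x v)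
  rw [h1, h.η_φ, map_add, map_smul, h.φ_ξ, map_neg, zero_smul, smul_zero, add_zero, add_zero] at h2
  exact neg_injective h2

/-- `g(ξ, ∇_v ξ) = 0`, as `ξ` has length one. -/
lemma inner_ξ_leviCivita : g.inner x (ξ x) (leviCivita g ξ x v) = 0 := by
  have hξ : MDiffAt (T% ξ) x := (h.smooth_ξ x).mdifferentiableAt (by simp)
  have h1 := leviCivita_metric g hξ hξ v
  have h2 : (fun y => g.inner y (ξ y) (ξ y)) = fun _ => (1 : ℝ) := funext h.inner_ξ_ξ
  rw [h2, mvfderiv_const, g.symm x (leviCivita g ξ x v)] at h1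
  simp only [_root_.zero_apply] at h1
  linarith

lemma smoothEndo_smallTensor [T2Space M] : SmoothEndo (smallTensor Q) :=
  smoothEndo_of_apply _ fun _ hZ => fun y =>
    (h.smooth_Q.contMDiffAt_apply (hZ y)).sub_section (hZ y)

end IsWeakAlmostContactMetric

namespace IsWeakNearlySasakian
variable {E : Type*} [NormedAddCommGroup E] [NormedSpace ℝ E] [FiniteDimensional ℝ E]
  {M : Type*} [TopologicalSpace M] [ChartedSpace E M] [IsManifold 𝓘(ℝ, E) ∞ M] [T2Space M]
  {X Y Z : VField E M}
  {g : RiemMetric E M} {φ Q : EndoField E M} {ξ : VField E M} {η : OneForm E M}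
  (h : IsWeakNearlySasakian g φ Q ξ η) {x : M} (v w : TangentSpace 𝓘(ℝ, E) x)
include h

lemma smoothNear_ξ : SmoothNear ξ x := smoothNear_of_contMDiff h.smooth_ξ x

lemma polarized (hX : SmoothNear X x) (hY : SmoothNear Y x) :
    covDerivEndo g φ Y x (X x) + covDerivEndo g φ X x (Y x) =
      (2 * g.inner x (X x) (Y x)) • ξ x - η x (X x) • Y x - η x (Y x) • X x := by
  have hXY : SmoothNear (fun y => X y + Y y) x := by
    filter_upwards [hX, hY] with y h1 h2
    exact h1.add_section h2
  have h1 := h.nearly x _ hXY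
  rw [covDerivEndo_add h.smooth_φ hX hY, covDerivEndo_add_right, covDerivEndo_add_right,
    h.nearly x X hX, h.nearly x Y hY] at h1
  simp only [map_add, _root_.add_apply, g.symm x (Y x) (X x)] at h1
  linear_combination (norm := module) h1

lemma covDerivEndo_φ_ξ : covDerivEndo g φ ξ x v = -φ x (leviCivita g ξ x v) := by
  have : (fun y => φ y (ξ y)) = fun _ => 0 := funext h.φ_ξ
  rw [covDerivEndo, this, leviCivita_zero, _root_.zero_apply, zero_sub]

lemma leviCivita_ξ_ξ : leviCivita g ξ x (ξ x) = 0 := by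
  have h1 := h.nearly x ξ h.smoothNear_ξ
  rw [h.covDerivEndo_φ_ξ, h.inner_ξ_ξ, h.η_ξ, sub_self, neg_eq_zero] at h1
  rw [h.eq_smul_ξ_of_φ_eq_zero x _ h1, h.η_eq, h.inner_ξ_leviCivita, zero_smul]

/-- `∇_ξ φ = φ B + η ⊗ ξ - id`, where `B = ∇ ξ`. -/
lemma covDerivEndo_φ_along_ξ (hY : SmoothNear Y x) :
    covDerivEndo g φ Y x (ξ x) = φ x (leviCivita g ξ x (Y x)) + η x (Y x) • ξ x - Y x := by
  have := h.polarized h.smoothNear_ξ hY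
  rw [h.covDerivEndo_φ_ξ, h.η_ξ, ← h.η_eq] at this
  linear_combination (norm := module) this

variable (hQ : ∀ (x : M) (X Y : VField E M), SmoothNear X x → SmoothNear Y x → η x (Y x) = 0 →
  covDerivEndo g (smallTensor Q) Y x (X x) = 0)
include hQ

lemma covDerivEndo_smallTensor (hY : SmoothNear Y x) :
    covDerivEndo g (smallTensor Q) Y x v = -(η x (Y x) • smallTensor Q x (leviCivita g ξ x v)) := by
  have hA := h.smoothEndo_smallTensor
  obtain ⟨X, hX, rfl⟩ := exists_contMDiff_apply_eq (E := E) v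
  have h1 : covDerivEndo g (smallTensor Q) ξ x (X x) =
      -smallTensor Q x (leviCivita g ξ x (X x)) := by
    have : (fun y => smallTensor Q y (ξ y)) = fun _ => 0 := funext fun y => by
      simp [smallTensor, h.Q_ξ]
    rw [covDerivEndo, this, leviCivita_zero, _root_.zero_apply, zero_sub]
  let c : ℝ := -η x (Y x)
  have hcξ : SmoothNear (fun y => c • ξ y) x := by
    filter_upwards [h.smoothNear_ξ] with y hy
    exact hy.const_smul_section (a := c)
  have h2 := hQ x X (fun y => Y y + c • ξ y) (smoothNear_of_contMDiff hX x)
    (by filter_upwards [hY, hcξ] with y h1 h2 using h1.add_section h2) (by simp [c, h.η_ξ])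
  rw [covDerivEndo_add hA hY hcξ, covDerivEndo_smul hA mdifferentiableAt_const h.smoothNear_ξ,
    h1] at h2
  simp only [c] at h2
  linear_combination (norm := module) h2

/-- `Q̃ B = 0`: the tensor `∇_v Q̃` is symmetric and maps `ξ` to `-Q̃ B v` and `Z` to a multiple of
`Q̃ B v`, which is orthogonal to `ξ`. -/
lemma smallTensor_leviCivita_ξ : smallTensor Q x (leviCivita g ξ x v) = 0 := by
  have hA := h.smoothEndo_smallTensor
  have hs : ∀ (y : M) v w, g.inner y (smallTensor Q y v) w =
      1 * g.inner y v (smallTensor Q y w) := fun y v w => by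
    simp [smallTensor, h.inner_Q]
  refine tangent_ext g fun w => ?_
  obtain ⟨Z, hZ, rfl⟩ := exists_contMDiff_apply_eq (E := E) w
  have hZ' := smoothNear_of_contMDiff hZ x
  have h1 := inner_covDerivEndo hA hs h.smoothNear_ξ hZ' v
  rw [h.covDerivEndo_smallTensor v hQ h.smoothNear_ξ, h.covDerivEndo_smallTensor v hQ hZ',
    h.η_ξ, one_smul] at h1
  simp only [map_neg, map_smul, _root_.neg_apply, smul_eq_mul] at h1
  have h2 : smallTensor Q x (ξ x) = 0 := by simp [smallTensor, h.Q_ξ]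
  have h3 := hs x (leviCivita g ξ x v) (ξ x)
  rw [h2, map_zero, mul_zero, g.symm] at h3
  rw [hs, h3, mul_zero, neg_zero, mul_zero] at h1
  rw [hs, map_zero, _root_.zero_apply]
  simpa using h1

/-- The derivative of `φ² = -Q + η ⊗ ξ` along `ξ`: the right-hand side is parallel along `ξ`, the
tensor `∇_ξ φ` is known by `covDerivEndo_φ_along_ξ`, and `φ` is injective modulo `ξ`. -/
lemma anti : φ x (leviCivita g ξ x v) + leviCivita g ξ x (φ x v) = (2 : ℝ) • (v - η x v • ξ x) := by
  obtain ⟨Y, hY, rfl⟩ := exists_contMDiff_apply_eq (E := E) v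
  have hY' := smoothNear_of_contMDiff hY x
  have hφY := h.smooth_φ.smoothNear hY'
  have hA := h.smoothEndo_smallTensor
  have hQY := hA.smoothNear hY'
  have hη : SmoothNear (fun y => η y (Y y) • ξ y) x := by
    filter_upwards [hY'] with y hy
    exact (h.smooth_η.contMDiffAt_apply hy).smul_section (h.smooth_ξ y)
  have h1 : (fun y => φ y (φ y (Y y))) =
      fun y => η y (Y y) • ξ y - (smallTensor Q y (Y y) + Y y) := funext fun y => by
    rw [h.φ_sq]; simp [smallTensor]; abel
  have h2 := h.covDerivEndo_φ_along_ξ hφY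
  have h3 := congrArg (φ x) (h.covDerivEndo_φ_along_ξ hY')
  have h4 : leviCivita g (fun y => η y (Y y) • ξ y) x (ξ x) =
      η x (leviCivita g Y x (ξ x)) • ξ x := by
    have hf : (fun y => η y (Y y)) = gfun g ξ Y := funext fun y => h.η_eq y _
    have := leviCivita_metric g h.smoothNear_ξ.mdifferentiableAt hY'.mdifferentiableAt (ξ x)
    have hd : MDiffAt (fun y => η y (Y y)) x := by
      rw [hf]
      exact mdiffAt_gfun g h.smoothNear_ξ.mdifferentiableAt hY'.mdifferentiableAt
    rw [leviCivita_smul g hd h.smoothNear_ξ.mdifferentiableAt, h.leviCivita_ξ_ξ, hf, smul_zero,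
      add_zero, h.η_eq]
    congr 1
    unfold gfun
    rw [this, h.leviCivita_ξ_ξ, map_zero, _root_.zero_apply, zero_add]
  have h5 := h.covDerivEndo_smallTensor (ξ x) hQ hY'
  rw [h.leviCivita_ξ_ξ, map_zero, smul_zero, neg_zero] at h5
  have h6 : MDiffAt (T% fun y => smallTensor Q y (Y y) + Y y) x :=
    mdifferentiableAt_add_section hQY.mdifferentiableAt hY'.mdifferentiableAt
  have h7 := h.φ_sq x (leviCivita g Y x (ξ x))
  simp only [covDerivEndo, h1, leviCivita_sub g hη.mdifferentiableAt h6, h4,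
    leviCivita_add g hQY.mdifferentiableAt hY'.mdifferentiableAt, _root_.add_apply, map_sub,
    map_add, map_smul, h.φ_ξ, h.η_φ] at h2 h3 h5
  rw [h7] at h3
  have h8 : smallTensor Q x (leviCivita g Y x (ξ x)) =
    Q x (leviCivita g Y x (ξ x)) - leviCivita g Y x (ξ x) := by simp [smallTensor]
  have h9 : φ x (φ x (leviCivita g ξ x (Y x)) + leviCivita g ξ x (φ x (Y x)) - (2 : ℝ) • Y x)
      = 0 := by
    simp only [map_add, map_sub, map_smul]
    rw [h8] at h5
    linear_combination (norm := module) -h2 - h3 - h5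
  have h10 := h.eq_smul_ξ_of_φ_eq_zero x _ h9
  rw [map_sub, map_add, h.η_φ, h.η_eq x (leviCivita g ξ x _), h.inner_ξ_leviCivita,
    map_smul] at h10
  simp only [smul_eq_mul] at h10
  linear_combination (norm := module) h10

/-- `ξ` is a Killing vector field. -/
lemma killing : g.inner x (leviCivita g ξ x v) w = -g.inner x v (leviCivita g ξ x w) := by
  -- the skewness of `∇_ξ φ = φ B + η ⊗ ξ - id` reads `φ B - Bᵀ φ = 2 (id - η ⊗ ξ)`, and comparison
  -- with `φ B + B φ = 2 (id - η ⊗ ξ)` yields `B φ = -Bᵀ φ`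
  have h1 (u w : TangentSpace 𝓘(ℝ, E) x) :
      g.inner x (leviCivita g ξ x (φ x u)) w = -g.inner x (φ x u) (leviCivita g ξ x w) := by
    obtain ⟨Y, hY, rfl⟩ := exists_contMDiff_apply_eq (E := E) u
    obtain ⟨Z, hZ, rfl⟩ := exists_contMDiff_apply_eq (E := E) w
    have hY' := smoothNear_of_contMDiff hY x
    have hZ' := smoothNear_of_contMDiff hZ x
    have h2 := inner_covDerivEndo h.smooth_φ (ε := -1)
      (fun y v w => by rw [h.inner_φ]; ring) hY' hZ' (ξ x)
    rw [h.covDerivEndo_φ_along_ξ hY', h.covDerivEndo_φ_along_ξ hZ'] at h2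
    have h3 := congrArg (fun u => g.inner x u (Z x)) (h.anti (Y x) hQ)
    have h4 := h.inner_φ x (Y x) (leviCivita g ξ x (Z x))
    simp only [map_add, map_sub, map_smul, _root_.add_apply, _root_.sub_apply, _root_.smul_apply,
      smul_eq_mul, g.symm x (Y x) (ξ x), ← h.η_eq] at h2 h3
    linarith
  obtain ⟨u, hu⟩ := h.exists_φ_φ_eq x (v - η x v • ξ x) (by simp [h.η_ξ])
  have h2 := h1 (φ x u) w
  rw [hu] at h2
  simp only [map_sub, map_smul, _root_.sub_apply, _root_.smul_apply, h.leviCivita_ξ_ξ,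
    h.inner_ξ_leviCivita] at h2
  simpa using h2

/-- The assumption on `∇Q̃` forces `Q` to be the identity: apply `Q̃` to
`φ B + B φ = 2 (id - η ⊗ ξ)`. -/
theorem Q_eq : Q x v = v := by
  have h1 := congrArg (smallTensor Q x) (h.anti v hQ)
  have h2 (u : TangentSpace 𝓘(ℝ, E) x) : smallTensor Q x (φ x u) = φ x (smallTensor Q x u) := by
    simp [smallTensor, h.Q_φ]
  have h3 : smallTensor Q x (ξ x) = 0 := by simp [smallTensor, h.Q_ξ]
  rw [map_add, h2, h.smallTensor_leviCivita_ξ _ hQ, h.smallTensor_leviCivita_ξ _ hQ, map_zero,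
    add_zero, map_smul, map_sub, map_smul, h3, smul_zero, sub_zero] at h1
  have h4 : smallTensor Q x v = 0 := by
    rcases smul_eq_zero.1 h1.symm with h | h
    · norm_num at h
    · exact h
  have h5 : smallTensor Q x v = Q x v - v := by simp [smallTensor]
  rw [h5] at h4
  exact sub_eq_zero.1 h4

lemma φ_φ : φ x (φ x v) = -v + η x v • ξ x := by rw [h.φ_sq, h.Q_eq _ hQ]

/-- The curvature identity `(∇_v B) Y = g(B² v, Y) ξ - η(Y) B² v` for `B = ∇ ξ`. -/
theorem covDerivEndo_leviCivita_ξ (hY : SmoothNear Y x) :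
    covDerivEndo g (fun y => leviCivita g ξ y) Y x v =
      g.inner x (leviCivita g ξ x (leviCivita g ξ x v)) (Y x) • ξ x
        - η x (Y x) • leviCivita g ξ x (leviCivita g ξ x v) := by
  let ξ' : SmoothField E M := ⟨ξ, h.smooth_ξ⟩
  have hs : (riemConnection g).IsNearlySasakian (endoMap φ h.smooth_φ) ξ' :=
    { unit := by ext y; exact h.inner_ξ_ξ y
      φ_sq := fun X => by
        ext y
        refine (h.φ_φ (X y) hQ).trans ?_
        rw [h.η_eq]
        rfl
      φ_ξ := by ext y; exact h.φ_ξ y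
      nearly := fun Y => by
        ext y
        refine (h.nearly y (fun z => Y z) (smoothNear_of_contMDiff Y.contMDiff y)).trans ?_
        rw [h.η_eq]
        rfl
      killing := fun X Y => by ext y; exact h.killing (X y) (Y y) hQ
      anti := fun X => by
        ext y
        refine (h.anti (X y) hQ).trans ?_
        rw [h.η_eq]
        have h2 : (2 : SmoothFun E M) y = 2 := by
          rw [← one_add_one_eq_two, ← one_add_one_eq_two]; rfl
        rw [← h2]
        rfl }
  obtain ⟨Y', hY', hYY'⟩ := hY.exists_contMDiff
  obtain ⟨X, hX, rfl⟩ := exists_contMDiff_apply_eq (E := E) v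
  rw [← covDerivEndo_congr (smoothEndo_leviCivita g h.smooth_ξ) hY hYY', ← hYY'.self_of_nhds,
    h.η_eq]
  exact congrArg (fun X : SmoothField E M => X x) (hs.hess_eq ⟨X, hX⟩ ⟨Y', hY'⟩)

end IsWeakNearlySasakian

/-! ### Polynomials in `h²` -/

section Poly
variable {E : Type*} [NormedAddCommGroup E] [NormedSpace ℝ E] [FiniteDimensional ℝ E]
  {M : Type*} [TopologicalSpace M] [ChartedSpace E M] [IsManifold 𝓘(ℝ, E) ∞ M]

instance finiteDimensional_tangentSpace (x : M) : FiniteDimensional ℝ (TangentSpace 𝓘(ℝ, E) x) :=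
  inferInstanceAs (FiniteDimensional ℝ E)

instance t2Space_tangentSpace (x : M) : T2Space (TangentSpace 𝓘(ℝ, E) x) :=
  inferInstanceAs (T2Space E)

/-- The tensor field `m(h²)` for a real polynomial `m`. -/
def polyTensor (g : RiemMetric E M) (φ : EndoField E M) (ξ : VField E M) (m : Polynomial ℝ) :
    EndoField E M :=
  fun x => LinearMap.toContinuousLinearMap (Polynomial.aeval (hSq g φ ξ x) m)

variable {g : RiemMetric E M} {φ Q : EndoField E M} {ξ : VField E M} {η : OneForm E M}
  {x : M} {X Y : VField E M}

lemma polyTensor_apply (m : Polynomial ℝ) (v : TangentSpace 𝓘(ℝ, E) x) :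
    polyTensor g φ ξ m x v = Polynomial.aeval (hSq g φ ξ x) m v := rfl

lemma polyTensor_add (m m' : Polynomial ℝ) (v : TangentSpace 𝓘(ℝ, E) x) :
    polyTensor g φ ξ (m + m') x v = polyTensor g φ ξ m x v + polyTensor g φ ξ m' x v := by
  simp only [polyTensor_apply, map_add, LinearMap.add_apply]

lemma polyTensor_mul (m m' : Polynomial ℝ) (v : TangentSpace 𝓘(ℝ, E) x) :
    polyTensor g φ ξ (m * m') x v = polyTensor g φ ξ m x (polyTensor g φ ξ m' x v) := by
  simp only [polyTensor_apply, map_mul, Module.End.mul_apply]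

lemma polyTensor_C (c : ℝ) (v : TangentSpace 𝓘(ℝ, E) x) :
    polyTensor g φ ξ (.C c) x v = c • v := by
  simp only [polyTensor_apply, Polynomial.aeval_C, Module.algebraMap_end_apply]

lemma polyTensor_X (v : TangentSpace 𝓘(ℝ, E) x) : polyTensor g φ ξ .X x v = hSq g φ ξ x v := by
  rw [polyTensor_apply, Polynomial.aeval_X]

lemma polyTensor_comm (m m' : Polynomial ℝ) (v : TangentSpace 𝓘(ℝ, E) x) :
    polyTensor g φ ξ m x (polyTensor g φ ξ m' x v) =
      polyTensor g φ ξ m' x (polyTensor g φ ξ m x v) := by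
  rw [← polyTensor_mul, mul_comm, polyTensor_mul]

lemma polyTensor_comm_of_comm {A : TangentSpace 𝓘(ℝ, E) x →L[ℝ] TangentSpace 𝓘(ℝ, E) x}
    (hA : ∀ v, hSq g φ ξ x (A v) = A (hSq g φ ξ x v)) (m : Polynomial ℝ)
    (v : TangentSpace 𝓘(ℝ, E) x) :
    polyTensor g φ ξ m x (A v) = A (polyTensor g φ ξ m x v) := by
  induction m using Polynomial.induction_on generalizing v with
  | C c => rw [polyTensor_C, polyTensor_C, map_smul]
  | add p q hp hq => rw [polyTensor_add, hp, hq, polyTensor_add, map_add]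
  | monomial n c ih =>
    rw [pow_succ, ← mul_assoc, polyTensor_mul, polyTensor_X, hA, ih, ← polyTensor_X,
      ← polyTensor_mul]

end Poly

namespace IsWeakNearlySasakian
variable {E : Type*} [NormedAddCommGroup E] [NormedSpace ℝ E] [FiniteDimensional ℝ E]
  {M : Type*} [TopologicalSpace M] [ChartedSpace E M] [IsManifold 𝓘(ℝ, E) ∞ M] [T2Space M]
  {X Y Z : VField E M}
  {g : RiemMetric E M} {φ Q : EndoField E M} {ξ : VField E M} {η : OneForm E M}
  (h : IsWeakNearlySasakian g φ Q ξ η) {x : M} (v w : TangentSpace 𝓘(ℝ, E) x)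
include h

lemma η_leviCivita_ξ : η x (leviCivita g ξ x v) = 0 := by
  rw [h.η_eq, h.inner_ξ_leviCivita]

variable (hQ : ∀ (x : M) (X Y : VField E M), SmoothNear X x → SmoothNear Y x → η x (Y x) = 0 →
  covDerivEndo g (smallTensor Q) Y x (X x) = 0)
include hQ

lemma hSq_apply : hSq g φ ξ x v = leviCivita g ξ x (leviCivita g ξ x v) + v - η x v • ξ x := by
  have h1 : hSq g φ ξ x v = leviCivita g ξ x (leviCivita g ξ x v) + leviCivita g ξ x (φ x v)
      + (φ x (leviCivita g ξ x v) + φ x (φ x v)) := by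
    change leviCivita g ξ x (leviCivita g ξ x v + φ x v) + φ x (leviCivita g ξ x v + φ x v) = _
    rw [map_add, map_add]
  rw [h1, h.φ_φ _ hQ]
  linear_combination (norm := module) h.anti v hQ

lemma hSq_ξ : hSq g φ ξ x (ξ x) = 0 := by
  rw [h.hSq_apply _ hQ, h.leviCivita_ξ_ξ, map_zero, h.η_ξ, one_smul, zero_add, sub_self]

lemma hSq_leviCivita_ξ : hSq g φ ξ x (leviCivita g ξ x v) = leviCivita g ξ x (hSq g φ ξ x v) := by
  rw [h.hSq_apply _ hQ, h.hSq_apply _ hQ, map_sub, map_add, map_smul, h.leviCivita_ξ_ξ,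
    h.η_leviCivita_ξ, zero_smul, smul_zero]

lemma hSq_φ : hSq g φ ξ x (φ x v) = φ x (hSq g φ ξ x v) := by
  rw [h.hSq_apply _ hQ, h.hSq_apply _ hQ, map_sub, map_add, map_smul, h.φ_ξ,
    h.η_φ, zero_smul, smul_zero]
  have h1 := congrArg (leviCivita g ξ x) (h.anti v hQ)
  have h2 := h.anti (leviCivita g ξ x v) hQ
  rw [h.η_leviCivita_ξ] at h2
  simp only [map_add, map_sub, map_smul, h.leviCivita_ξ_ξ] at h1
  linear_combination (norm := module) h1 - h2

lemma inner_hTensor : g.inner x (hTensor g φ ξ x v) w = -g.inner x v (hTensor g φ ξ x w) := by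
  change g.inner x (leviCivita g ξ x v + φ x v) w = -g.inner x v (leviCivita g ξ x w + φ x w)
  rw [map_add, map_add, _root_.add_apply, h.killing _ _ hQ, h.inner_φ]
  ring

lemma inner_hSq : g.inner x (hSq g φ ξ x v) w = g.inner x v (hSq g φ ξ x w) := by
  have h1 := h.inner_hTensor (hTensor g φ ξ x v) w hQ
  have h2 := h.inner_hTensor v (hTensor g φ ξ x w) hQ
  rw [h2, neg_neg] at h1
  exact h1

/-- As `h` is skew, `g(h² v, v) = -|h v|²`. -/
lemma hTensor_eq_zero (hv : hSq g φ ξ x v = 0) : hTensor g φ ξ x v = 0 := by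
  by_contra hne
  have h1 := g.pos x _ hne
  have h2 : g.inner x (hTensor g φ ξ x v) (hTensor g φ ξ x v) =
      -g.inner x v (hSq g φ ξ x v) := h.inner_hTensor _ _ hQ
  rw [h2, hv, map_zero, neg_zero] at h1
  exact lt_irrefl _ h1

lemma inner_polyTensor (m : Polynomial ℝ) :
    g.inner x (polyTensor g φ ξ m x v) w = g.inner x v (polyTensor g φ ξ m x w) := by
  induction m using Polynomial.induction_on generalizing v w with
  | C c => simp only [polyTensor_C, map_smul, _root_.smul_apply]
  | add p q hp hq => simp only [polyTensor_add, map_add, _root_.add_apply, hp, hq]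
  | monomial n c ih =>
    rw [pow_succ, ← mul_assoc, polyTensor_mul, ih, polyTensor_X, h.inner_hSq _ _ hQ,
      ← polyTensor_X, polyTensor_comm, ← polyTensor_mul]

lemma polyTensor_ξ (m : Polynomial ℝ) : polyTensor g φ ξ m x (ξ x) = m.eval 0 • ξ x :=
  Module.End.aeval_apply_of_hasEigenvector
    ⟨Module.End.mem_eigenspace_iff.2 (by rw [h.hSq_ξ hQ, zero_smul]), h.ξ_ne_zero x⟩

lemma η_polyTensor (m : Polynomial ℝ) : η x (polyTensor g φ ξ m x v) = m.eval 0 * η x v := by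
  rw [h.η_eq, ← h.inner_polyTensor _ _ hQ, h.polyTensor_ξ hQ, map_smul, _root_.smul_apply,
    smul_eq_mul, h.η_eq]

lemma polyTensor_leviCivita_ξ (m : Polynomial ℝ) :
    polyTensor g φ ξ m x (leviCivita g ξ x v) = leviCivita g ξ x (polyTensor g φ ξ m x v) :=
  polyTensor_comm_of_comm (fun v => h.hSq_leviCivita_ξ v hQ) m v

omit hQ in
lemma smoothNear_η_smul_ξ (hY : SmoothNear Y x) : SmoothNear (fun y => η y (Y y) • ξ y) x := by
  filter_upwards [hY] with y hy
  exact (h.smooth_η.contMDiffAt_apply hy).smul_section (h.smooth_ξ y)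

lemma contMDiffAt_polyTensor_apply (m : Polynomial ℝ) (hY : CMDiffAt ∞ (T% Y) x) :
    CMDiffAt ∞ (T% fun y => polyTensor g φ ξ m y (Y y)) x := by
  induction m using Polynomial.induction_on generalizing Y with
  | C c =>
    simp only [polyTensor_C]
    exact hY.const_smul_section (a := c)
  | add p q hp hq =>
    simp only [polyTensor_add]
    exact (hp hY).add_section (hq hY)
  | monomial n c ih =>
    simp only [pow_succ, ← mul_assoc, polyTensor_mul _ .X]
    refine ih ?_
    have hB := smoothEndo_leviCivita g h.smooth_ξ
    simp only [polyTensor_X, h.hSq_apply _ hQ]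
    exact ((hB.contMDiffAt_apply (hB.contMDiffAt_apply hY)).add_section hY).sub_section
      ((h.smooth_η.contMDiffAt_apply hY).smul_section (h.smooth_ξ x))

lemma smoothEndo_polyTensor (m : Polynomial ℝ) : SmoothEndo (polyTensor g φ ξ m) :=
  smoothEndo_of_apply _ fun _ hZ y => h.contMDiffAt_polyTensor_apply hQ m (hZ y)

omit hQ in
lemma leviCivita_η_smul_ξ (hY : SmoothNear Y x) :
    leviCivita g (fun y => η y (Y y) • ξ y) x v =
      (g.inner x (leviCivita g ξ x v) (Y x) + η x (leviCivita g Y x v)) • ξ x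
        + η x (Y x) • leviCivita g ξ x v := by
  have hf : (fun y => η y (Y y)) = gfun g ξ Y := funext fun y => h.η_eq y _
  have h1 := leviCivita_metric g h.smoothNear_ξ.mdifferentiableAt hY.mdifferentiableAt v
  have hd : MDiffAt (fun y => η y (Y y)) x := by
    rw [hf]
    exact mdiffAt_gfun g h.smoothNear_ξ.mdifferentiableAt hY.mdifferentiableAt
  rw [leviCivita_smul g hd h.smoothNear_ξ.mdifferentiableAt, hf, h.η_eq x (leviCivita g Y x v)]
  congr 2

lemma covDerivEndo_hSq (hY : SmoothNear Y x) :
    covDerivEndo g (polyTensor g φ ξ .X) Y x v =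
      -(g.inner x (leviCivita g ξ x (hSq g φ ξ x v)) (Y x) • ξ x
        + η x (Y x) • leviCivita g ξ x (hSq g φ ξ x v)) := by
  have hB := smoothEndo_leviCivita g h.smooth_ξ
  have hBY := hB.smoothNear hY
  have hBBY := hB.smoothNear hBY
  have hη := h.smoothNear_η_smul_ξ hY
  have h1 := h.covDerivEndo_leviCivita_ξ v hQ hBY
  have h2 := congrArg (leviCivita g ξ x) (h.covDerivEndo_leviCivita_ξ v hQ hY)
  have h6 : MDiffAt (T% fun y => leviCivita g ξ y (leviCivita g ξ y (Y y)) + Y y) x :=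
    mdifferentiableAt_add_section hBBY.mdifferentiableAt hY.mdifferentiableAt
  have h3 : covDerivEndo g (polyTensor g φ ξ .X) Y x v =
      leviCivita g (fun y => leviCivita g ξ y (leviCivita g ξ y (Y y))) x v + leviCivita g Y x v -
      leviCivita g (fun y => η y (Y y) • ξ y) x v - hSq g φ ξ x (leviCivita g Y x v) := by
    simp only [covDerivEndo, polyTensor_X, h.hSq_apply _ hQ]
    rw [leviCivita_sub g h6 hη.mdifferentiableAt,
      leviCivita_add g hBBY.mdifferentiableAt hY.mdifferentiableAt, _root_.add_apply]
  rw [h3, h.leviCivita_η_smul_ξ v hY, h.hSq_apply _ hQ, h.hSq_apply _ hQ]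
  rw [h.η_leviCivita_ξ] at h1
  have h4 := h.killing (leviCivita g ξ x (leviCivita g ξ x v)) (Y x) hQ
  simp only [covDerivEndo, map_sub, map_add, map_smul, h.leviCivita_ξ_ξ, _root_.add_apply,
    _root_.sub_apply, smul_zero, map_zero, _root_.zero_apply] at h1 h2 ⊢
  rw [h4]
  linear_combination (norm := module) h1 + h2

/-- `(∇_v m(h²)) Y = -g(B w, Y) ξ - η(Y) B w` with `w = m(h²) v - m(0) v` and `B = ∇ ξ`. -/
theorem covDerivEndo_polyTensor (m : Polynomial ℝ) (hY : SmoothNear Y x) :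
    covDerivEndo g (polyTensor g φ ξ m) Y x v =
      -(g.inner x (leviCivita g ξ x (polyTensor g φ ξ m x v - m.eval 0 • v)) (Y x) • ξ x
        + η x (Y x) • leviCivita g ξ x (polyTensor g φ ξ m x v - m.eval 0 • v)) := by
  induction m using Polynomial.induction_on with
  | C c =>
    simp only [covDerivEndo, polyTensor_C, leviCivita_const_smul g c hY.mdifferentiableAt,
      Polynomial.eval_C, sub_self, map_zero, _root_.zero_apply, zero_smul, smul_zero, add_zero,
      neg_zero]
  | add p q hp hq =>
    have h1 : covDerivEndo g (polyTensor g φ ξ (p + q)) Y x v =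
        covDerivEndo g (polyTensor g φ ξ p) Y x v + covDerivEndo g (polyTensor g φ ξ q) Y x v := by
      simp only [covDerivEndo, polyTensor_add]
      rw [leviCivita_add g ((h.smoothEndo_polyTensor hQ p).mdifferentiableAt_apply hY)
        ((h.smoothEndo_polyTensor hQ q).mdifferentiableAt_apply hY), _root_.add_apply]
      abel
    rw [h1, hp, hq]
    simp only [polyTensor_add, map_add, map_sub, map_smul, _root_.add_apply, _root_.sub_apply,
      _root_.smul_apply, Polynomial.eval_add]
    module
  | monomial n c ih =>
    rw [pow_succ, ← mul_assoc, mul_comm _ Polynomial.X]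
    generalize Polynomial.C c * Polynomial.X ^ n = p at ih ⊢
    have hp := h.smoothEndo_polyTensor hQ p
    have h1 : covDerivEndo g (polyTensor g φ ξ (.X * p)) Y x v =
        covDerivEndo g (polyTensor g φ ξ .X) (fun y => polyTensor g φ ξ p y (Y y)) x v +
          hSq g φ ξ x (covDerivEndo g (polyTensor g φ ξ p) Y x v) := by
      simp only [covDerivEndo, polyTensor_mul .X, map_sub, ← polyTensor_X]
      abel
    have h2 : polyTensor g φ ξ p x (hSq g φ ξ x v) = hSq g φ ξ x (polyTensor g φ ξ p x v) := by
      rw [← polyTensor_X, polyTensor_comm, polyTensor_X]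
    rw [h1, ih, h.covDerivEndo_hSq v hQ (hp.smoothNear hY), polyTensor_mul, polyTensor_X,
      Polynomial.eval_mul, Polynomial.eval_X, zero_mul, zero_smul, sub_zero,
      h.η_polyTensor _ hQ, ← h.inner_polyTensor _ _ hQ, h.polyTensor_leviCivita_ξ _ hQ, h2]
    simp only [map_neg, map_add, map_sub, map_smul, h.hSq_ξ hQ, h.hSq_leviCivita_ξ _ hQ]
    module

end IsWeakNearlySasakian

/-! ### Traces and the spectrum of `h²` -/

section Trace
variable {E : Type*} [NormedAddCommGroup E] [NormedSpace ℝ E] [FiniteDimensional ℝ E]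
  {M : Type*} [TopologicalSpace M] [ChartedSpace E M] [IsManifold 𝓘(ℝ, E) ∞ M]
  {g : RiemMetric E M} {x : M}

/-- A `g`-symmetric endomorphism of `T_x M` is diagonalizable. -/
lemma iSup_eigenspace_eq_top {A : Module.End ℝ (TangentSpace 𝓘(ℝ, E) x)}
    (hA : ∀ v w, g.inner x (A v) w = g.inner x v (A w)) : ⨆ μ, A.eigenspace μ = ⊤ := by
  let c := g.toRiemannianMetric.toCore x
  let := c.toNormedAddCommGroup
  let : InnerProductSpace ℝ (TangentSpace 𝓘(ℝ, E) x) := InnerProductSpace.ofCore c.toCore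
  have hs : A.IsSymmetric := hA
  exact Submodule.orthogonal_eq_bot_iff.1 hs.orthogonalComplement_iSup_eigenspaces_eq_bot

/-- `tr A² = ‖A‖²` for a `g`-symmetric endomorphism `A`. -/
lemma eq_zero_of_trace_mul_self {A : Module.End ℝ (TangentSpace 𝓘(ℝ, E) x)}
    (hA : ∀ v w, g.inner x (A v) w = g.inner x v (A w))
    (h : LinearMap.trace ℝ (TangentSpace 𝓘(ℝ, E) x) (A * A) = 0) : A = 0 := by
  let c := g.toRiemannianMetric.toCore x
  let := c.toNormedAddCommGroup
  let : InnerProductSpace ℝ (TangentSpace 𝓘(ℝ, E) x) := InnerProductSpace.ofCore c.toCore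
  have hs : A.IsSymmetric := hA
  let b := stdOrthonormalBasis ℝ (TangentSpace 𝓘(ℝ, E) x)
  rw [LinearMap.trace_eq_sum_inner _ b] at h
  have h1 (i) : inner ℝ (b i) ((A * A) (b i)) = ‖A (b i)‖ ^ 2 := by
    rw [← real_inner_self_eq_norm_sq, hs (b i) (A (b i))]
    rfl
  simp_rw [h1] at h
  rw [Finset.sum_eq_zero_iff_of_nonneg fun i _ => sq_nonneg _] at h
  refine b.toBasis.ext fun i => ?_
  have := h i (Finset.mem_univ i)
  rw [sq_eq_zero_iff, norm_eq_zero] at this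
  simpa using this

variable (g) in
lemma leviCivita_sum {ι : Type*} (t : Finset ι) {V : ι → VField E M}
    (hV : ∀ i, SmoothNear (V i) x) (v : TangentSpace 𝓘(ℝ, E) x) :
    leviCivita g (fun y => ∑ i ∈ t, V i y) x v = ∑ i ∈ t, leviCivita g (V i) x v := by
  classical
  induction t using Finset.induction_on with
  | empty => simp [leviCivita_zero]
  | insert a s ha ih =>
    have h1 : MDiffAt (T% fun y => ∑ i ∈ s, V i y) x :=
      MDifferentiableAt.sum_section fun i _ => (hV i).mdifferentiableAt
    simp only [Finset.sum_insert ha]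
    rw [leviCivita_add g (hV a).mdifferentiableAt h1, _root_.add_apply, ih]

lemma mvfderiv_sum {ι : Type*} (t : Finset ι) {u : ι → M → ℝ} (hu : ∀ i, MDiffAt (u i) x)
    (v : TangentSpace 𝓘(ℝ, E) x) :
    MDiffAt (fun y => ∑ i ∈ t, u i y) x ∧
      d% (fun y => ∑ i ∈ t, u i y) x v = ∑ i ∈ t, d% (u i) x v := by
  classical
  induction t using Finset.induction_on with
  | empty =>
    have h0 : (fun y : M => ∑ i ∈ (∅ : Finset ι), u i y) = fun _ => 0 := by simp
    rw [h0, mvfderiv_const]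
    exact ⟨mdifferentiableAt_const, by simp⟩
  | insert a s ha ih =>
    simp only [Finset.sum_insert ha]
    refine ⟨(hu a).add ih.1, ?_⟩
    rw [mvfderiv_fun_add (hu a) ih.1, _root_.add_apply, ih.2]

/-- The derivative of the trace of a `(1,1)`-tensor field `A` along `v` is the trace of
`∇_v A`. -/
lemma mvfderiv_trace {A : EndoField E M} (hA : SmoothEndo A) (v : TangentSpace 𝓘(ℝ, E) x)
    (T : Module.End ℝ (TangentSpace 𝓘(ℝ, E) x))
    (hT : ∀ Y : VField E M, SmoothNear Y x → covDerivEndo g A Y x v = T (Y x)) :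
    MDiffAt (fun y => LinearMap.trace ℝ (TangentSpace 𝓘(ℝ, E) y) (A y).toLinearMap) x ∧
    d% (fun y => LinearMap.trace ℝ (TangentSpace 𝓘(ℝ, E) y) (A y).toLinearMap) x v =
      LinearMap.trace ℝ (TangentSpace 𝓘(ℝ, E) x) T := by
  classical
  let e := trivializationAt E (TangentSpace 𝓘(ℝ, E)) x
  have hx : x ∈ e.baseSet := mem_baseSet_trivializationAt E (TangentSpace 𝓘(ℝ, E)) x
  let b := finBasis ℝ E
  let s := e.localFrame b
  let c (i) (y : M) : TangentSpace 𝓘(ℝ, E) y →ₗ[ℝ] ℝ := e.localFrameCoeff 𝓘(ℝ, E) b i y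
  have hs (i) : SmoothNear (s i) x := by
    filter_upwards [e.open_baseSet.mem_nhds hx] with y hy
    exact contMDiffAt_localFrame_of_mem ∞ e b i hy
  have hc (i) {Y : VField E M} (hY : CMDiffAt ∞ (T% Y) x) : CMDiffAt ∞ (fun y => c i y (Y y)) x :=
    contMDiffAt_localFrameCoeff b hx hY i
  have hcr (y : M) (hy : y ∈ e.baseSet) (i) (w : TangentSpace 𝓘(ℝ, E) y) :
      c i y w = (e.basisAt b hy).repr w i := by
    have h2 := e.localFrameCoeff_apply_of_mem_baseSet (I := 𝓘(ℝ, E)) b hy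
      (fun z => if h : z = y then h ▸ w else 0) i
    simpa only [dite_true] using h2
  have hsb (y : M) (hy : y ∈ e.baseSet) (i) : s i y = e.basisAt b hy i :=
    e.localFrame_apply_of_mem_baseSet b hy
  have htr : ∀ y ∈ e.baseSet, ∀ L : Module.End ℝ (TangentSpace 𝓘(ℝ, E) y),
      LinearMap.trace ℝ (TangentSpace 𝓘(ℝ, E) y) L = ∑ i, c i y (L (s i y)) := by
    intro y hy L
    rw [LinearMap.trace_eq_matrix_trace ℝ (e.basisAt b hy), Matrix.trace]
    refine Finset.sum_congr rfl fun i _ => ?_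
    rw [Matrix.diag_apply, LinearMap.toMatrix_apply, hcr y hy, hsb y hy]
  have htr' : (fun y => LinearMap.trace ℝ (TangentSpace 𝓘(ℝ, E) y) (A y).toLinearMap) =ᶠ[𝓝 x]
      fun y => ∑ i, c i y (A y (s i y)) := by
    filter_upwards [e.open_baseSet.mem_nhds hx] with y hy using htr y hy _
  have ha (i j) : CMDiffAt ∞ (fun y => c i y (A y (s j y))) x :=
    hc i (hA.contMDiffAt_apply (hs j).contMDiffAt)
  have ha' (i j) : MDiffAt (fun y => c i y (A y (s j y))) x :=
    (ha i j).mdifferentiableAt (by simp)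
  have hsum := mvfderiv_sum Finset.univ (fun i => ha' i i) v
  refine ⟨hsum.1.congr_of_eventuallyEq htr', ?_⟩
  rw [mvfderiv_congr htr', hsum.2]
  -- the connection form along `v` in the frame; its contributions `tr (A W)` and `tr (W A)` cancel
  let W : Module.End ℝ (TangentSpace 𝓘(ℝ, E) x) :=
    (e.basisAt b hx).constr ℝ fun i => leviCivita g (s i) x v
  have hW (i) : W (s i x) = leviCivita g (s i) x v := by
    rw [hsb x hx]; exact (e.basisAt b hx).constr_basis ℝ _ i
  have hexp (y : M) (hy : y ∈ e.baseSet) (w : TangentSpace 𝓘(ℝ, E) y) :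
      w = ∑ i, c i y w • s i y := by
    simp_rw [hcr y hy, hsb y hy]
    exact ((e.basisAt b hy).sum_repr w).symm
  have key (j) : d% (fun y => c j y (A y (s j y))) x v =
      c j x (T (s j x)) + c j x ((A x).toLinearMap (W (s j x))) -
        c j x (W ((A x).toLinearMap (s j x))) := by
    have h1 : SmoothNear (fun y => A y (s j y)) x := hA.smoothNear (hs j)
    have hbd : ∀ᶠ y in 𝓝 x, y ∈ e.baseSet := e.open_baseSet.mem_nhds hx
    have h2 : (fun y => A y (s j y)) =ᶠ[𝓝 x] fun y => ∑ i, c i y (A y (s j y)) • s i y := by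
      filter_upwards [hbd] with y hy using hexp y hy _
    have h3 (i) : SmoothNear (fun y => c i y (A y (s j y)) • s i y) x := by
      filter_upwards [hbd, hs j, hs i] with y hy h4 h5
      exact (contMDiffAt_localFrameCoeff b hy (hA.contMDiffAt_apply h4) i).smul_section h5
    have h4 := hT (s j) (hs j)
    have h5 : MDiffAt (T% fun y => ∑ i, c i y (A y (s j y)) • s i y) x :=
      MDifferentiableAt.sum_section fun i _ => (h3 i).mdifferentiableAt
    rw [covDerivEndo, leviCivita_congr g h5 h2, leviCivita_sum g _ h3] at h4
    simp only [leviCivita_smul g (ha' _ j) (hs _).mdifferentiableAt, Finset.sum_add_distrib,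
      ← hW, ← map_smul, ← map_sum] at h4
    rw [← hexp x hx] at h4
    have h6 : c j x (∑ i, d% (fun y => c i y (A y (s j y))) x v • s i x) =
        d% (fun y => c j y (A y (s j y))) x v := by
      rw [hcr x hx]
      simp_rw [hsb x hx]
      exact congrFun ((e.basisAt b hx).repr_sum_self _) j
    have h7 := congrArg (c j x) h4
    rw [map_sub, map_add, h6] at h7
    linear_combination h7
  simp_rw [key, Finset.sum_sub_distrib, Finset.sum_add_distrib]
  have h1 := htr x hx (W * (A x).toLinearMap)
  have h2 := htr x hx ((A x).toLinearMap * W)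
  rw [LinearMap.trace_mul_comm] at h1
  simp only [Module.End.mul_apply] at h1 h2
  rw [← h1, ← h2, htr x hx T]
  ring

lemma isLocallyConstant_of_mvfderiv_eq_zero {u : M → ℝ} (hu : ∀ x, MDiffAt u x)
    (h : ∀ x v, d% u x v = 0) : IsLocallyConstant u := by
  refine (IsLocallyConstant.iff_eventually_eq u).2 fun x => ?_
  let ψ := extChartAt 𝓘(ℝ, E) x
  have ho : IsOpen ψ.target := isOpen_extChartAt_target x
  have hd : ∀ z ∈ ψ.target, MDiffAt (u ∘ ψ.symm) z := fun z hz => by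
    have := mdifferentiableWithinAt_extChartAt_symm (I := 𝓘(ℝ, E)) hz
    rw [modelWithCornersSelf_coe, range_id, mdifferentiableWithinAt_univ] at this
    exact (hu _).comp z this
  have hz : ∀ z ∈ ψ.target, fderiv ℝ (u ∘ ψ.symm) z = 0 := fun z hz => by
    have h2 : (mfderiv% ψ.symm z).IsInvertible := by
      have := isInvertible_mfderivWithin_extChartAt_symm (I := 𝓘(ℝ, E)) hz
      rwa [modelWithCornersSelf_coe, range_id, mfderivWithin_univ] at this
    ext w
    have h3 := fderiv_comp_extChartAt_symm hz (hu _) (mfderiv% ψ.symm z w)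
    rw [h] at h3
    refine Eq.trans ?_ h3
    congr 1
    exact (h2.inverse_apply_eq.2 rfl).symm
  have h1 := ho.isOpen_inter_preimage_of_fderiv_eq_zero
    (fun z hz => ((hd z hz).differentiableAt).differentiableWithinAt) hz {u x}
  have hl : ψ.symm (ψ x) = x := extChartAt_to_inv x
  have h2 := (continuousAt_extChartAt (I := 𝓘(ℝ, E)) x).preimage_mem_nhds
    (h1.mem_nhds ⟨mem_extChartAt_target x, congrArg u hl⟩)
  filter_upwards [h2, extChartAt_source_mem_nhds (I := 𝓘(ℝ, E)) x] with y hy hy'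
  have h3 : u (ψ.symm (ψ y)) = u x := hy.2
  rwa [ψ.left_inv hy'] at h3

lemma polyTensor_of_mem_eigenspace {φ : EndoField E M} {ξ : VField E M} {μ : ℝ}
    {v : TangentSpace 𝓘(ℝ, E) x} (hv : v ∈ (hSq g φ ξ x).eigenspace μ) (m : Polynomial ℝ) :
    polyTensor g φ ξ m x v = m.eval μ • v := by
  rcases eq_or_ne v 0 with rfl | hv0
  · rw [map_zero, smul_zero]
  · exact Module.End.aeval_apply_of_hasEigenvector ⟨hv, hv0⟩

/-- The finite set `{0, -l₁², …, -l_r²}`. -/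
def specSet {r : ℕ} (l : Fin r → ℝ) : Finset ℝ :=
  insert 0 (Finset.univ.image fun i => -(l i) ^ 2)

lemma coe_specSet {r : ℕ} (l : Fin r → ℝ) :
    (specSet l : Set ℝ) = insert 0 (range fun i => -(l i) ^ 2) := by
  simp [specSet]

/-- The polynomial that is `1` at `μ` and `0` at the other points of `specSet l`. -/
def specPoly {r : ℕ} (l : Fin r → ℝ) (μ : ℝ) : Polynomial ℝ := Lagrange.basis (specSet l) id μ

lemma eval_specPoly_self {r : ℕ} (l : Fin r → ℝ) {μ : ℝ} (hμ : μ ∈ specSet l) :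
    (specPoly l μ).eval μ = 1 :=
  Lagrange.eval_basis_self (v := id) (injOn_id _) hμ

lemma eval_specPoly_of_ne {r : ℕ} (l : Fin r → ℝ) {μ ν : ℝ} (h : μ ≠ ν) (hν : ν ∈ specSet l) :
    (specPoly l μ).eval ν = 0 :=
  Lagrange.eval_basis_of_ne (v := id) h hν

lemma eval_sum_specPoly {r : ℕ} {l : Fin r → ℝ} (hl : ∀ i, 0 < l i)
    (hl' : Function.Injective l) (j : Fin r) :
    (∑ i, specPoly l (-(l i) ^ 2)).eval (-(l j) ^ 2) = 1 := by
  have hj : -(l j) ^ 2 ∈ specSet l := by simp [specSet]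
  rw [Polynomial.eval_finsetSum, Finset.sum_eq_single j, eval_specPoly_self l hj]
  · intro i _ hij
    refine eval_specPoly_of_ne l (fun h1 => hij (hl' ?_)) hj
    exact (sq_eq_sq₀ (hl i).le (hl j).le).1 (neg_injective h1)
  · simp

lemma eval_sum_specPoly_zero {r : ℕ} {l : Fin r → ℝ} (hl : ∀ i, 0 < l i) :
    (∑ i, specPoly l (-(l i) ^ 2)).eval 0 = 0 := by
  rw [Polynomial.eval_finsetSum]
  exact Finset.sum_eq_zero fun i _ => eval_specPoly_of_ne l
    (neg_ne_zero.2 (pow_pos (hl i) 2).ne') (Finset.mem_insert_self _ _)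

end Trace

namespace IsWeakNearlySasakian
variable {E : Type*} [NormedAddCommGroup E] [NormedSpace ℝ E] [FiniteDimensional ℝ E]
  {M : Type*} [TopologicalSpace M] [ChartedSpace E M] [IsManifold 𝓘(ℝ, E) ∞ M] [T2Space M]
  {g : RiemMetric E M} {φ Q : EndoField E M} {ξ : VField E M} {η : OneForm E M}
  (h : IsWeakNearlySasakian g φ Q ξ η)
  (hQ : ∀ (x : M) (X Y : VField E M), SmoothNear X x → SmoothNear Y x → η x (Y x) = 0 →
    covDerivEndo g (smallTensor Q) Y x (X x) = 0)
include h hQ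

/-- The trace of `m(h²)` is locally constant, for its derivative along `v` is the trace of
`-(g(w, ·) ξ + η ⊗ w)` for a vector `w` orthogonal to `ξ`. -/
lemma isLocallyConstant_trace (m : Polynomial ℝ) : IsLocallyConstant fun y : M =>
    LinearMap.trace ℝ (TangentSpace 𝓘(ℝ, E) y) (Polynomial.aeval (hSq g φ ξ y) m) := by
  let w (x : M) (v : TangentSpace 𝓘(ℝ, E) x) : TangentSpace 𝓘(ℝ, E) x :=
    leviCivita g ξ x (polyTensor g φ ξ m x v - m.eval 0 • v)
  have key (x : M) (v : TangentSpace 𝓘(ℝ, E) x) :=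
    mvfderiv_trace (h.smoothEndo_polyTensor hQ m) v
      (-((g.inner x (w x v)).toLinearMap.smulRight (ξ x) + (η x).toLinearMap.smulRight (w x v)))
      fun Y hY => h.covDerivEndo_polyTensor v hQ m hY
  have hlc : IsLocallyConstant fun y =>
      LinearMap.trace ℝ (TangentSpace 𝓘(ℝ, E) y) (polyTensor g φ ξ m y).toLinearMap := by
    refine isLocallyConstant_of_mvfderiv_eq_zero (fun x => (key x 0).1) fun x v => ?_
    rw [(key x v).2, map_neg, map_add, LinearMap.trace_smulRight, LinearMap.trace_smulRight]
    have h1 : g.inner x (w x v) (ξ x) = 0 := by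
      rw [g.symm, h.inner_ξ_leviCivita]
    have h2 : η x (w x v) = 0 := h.η_leviCivita_ξ _
    change -(g.inner x (w x v) (ξ x) + η x (w x v)) = 0
    rw [h1, h2, add_zero, neg_zero]
  exact hlc

lemma trace_polyTensor_eq (m : Polynomial ℝ) {x y : M} (hxy : y ∈ connectedComponent x) :
    LinearMap.trace ℝ (TangentSpace 𝓘(ℝ, E) x) (Polynomial.aeval (hSq g φ ξ x) m) =
      LinearMap.trace ℝ (TangentSpace 𝓘(ℝ, E) y) (Polynomial.aeval (hSq g φ ξ y) m) :=
  (h.isLocallyConstant_trace hQ m).apply_eq_of_isPreconnected isPreconnected_connectedComponent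
    mem_connectedComponent hxy

variable {r p : ℕ} {l : Fin r → ℝ} (hspec : ∀ x : M, ∃ y ∈ connectedComponent x,
  HasSpectralForm g φ ξ l p y)
include hspec

/-- A polynomial in `h²` vanishes if the polynomial does so on the prescribed spectrum: this holds at
the points with the prescribed spectrum, where `h²` is diagonalizable, and `tr f(h²)²` is constant on
the connected components. -/
lemma aeval_hSq_eq_zero {f : Polynomial ℝ} (hf : ∀ μ ∈ specSet l, f.eval μ = 0) (x : M) :
    Polynomial.aeval (hSq g φ ξ x) f = 0 := by
  obtain ⟨y, hxy, hy⟩ := hspec x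
  have h1 : Polynomial.aeval (hSq g φ ξ y) f = 0 := by
    have h2 : ⨆ μ, (hSq g φ ξ y).eigenspace μ ≤ LinearMap.ker (Polynomial.aeval (hSq g φ ξ y) f) := by
      refine iSup_le fun μ v hv => ?_
      rcases eq_or_ne v 0 with rfl | hv0
      · exact zero_mem _
      have hev : (hSq g φ ξ y).HasEigenvector μ v := ⟨hv, hv0⟩
      have hμ : μ ∈ specSet l := by
        rw [← Finset.mem_coe, coe_specSet, ← hy.1]
        exact (Module.End.hasEigenvalue_of_hasEigenvector hev).mem_spectrum
      rw [LinearMap.mem_ker, Module.End.aeval_apply_of_hasEigenvector hev, hf μ hμ, zero_smul]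
    rw [iSup_eigenspace_eq_top fun v w => h.inner_hSq v w hQ, top_le_iff] at h2
    exact LinearMap.ker_eq_top.1 h2
  refine eq_zero_of_trace_mul_self (fun v w => h.inner_polyTensor v w hQ f) ?_
  rw [← map_mul, h.trace_polyTensor_eq hQ _ hxy, map_mul, h1, zero_mul, map_zero]

lemma polyTensor_specPoly_mem_eigenspace (μ : ℝ) {x : M} (v : TangentSpace 𝓘(ℝ, E) x) :
    polyTensor g φ ξ (specPoly l μ) x v ∈ (hSq g φ ξ x).eigenspace μ := by
  have h1 := h.aeval_hSq_eq_zero hQ hspec (f := (.X - .C μ) * specPoly l μ) (fun ν hν => by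
    rcases eq_or_ne μ ν with rfl | hne
    · simp
    · simp [eval_specPoly_of_ne l hne hν]) x
  have h2 := congrArg (fun A => A v) h1
  simp only [map_mul, map_sub, Polynomial.aeval_X, Polynomial.aeval_C, Module.End.mul_apply,
    LinearMap.sub_apply, Module.algebraMap_end_apply, LinearMap.zero_apply] at h2
  exact Module.End.mem_eigenspace_iff.2 (sub_eq_zero.1 h2)

lemma finrank_eigenspace_eq_trace {μ : ℝ} (hμ : μ ∈ specSet l) (x : M) :
    (finrank ℝ ((hSq g φ ξ x).eigenspace μ) : ℝ) = LinearMap.trace ℝ (TangentSpace 𝓘(ℝ, E) x)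
      (Polynomial.aeval (hSq g φ ξ x) (specPoly l μ)) := by
  refine (LinearMap.IsProj.trace (p := (hSq g φ ξ x).eigenspace μ)
    ⟨fun v => h.polyTensor_specPoly_mem_eigenspace hQ hspec μ v, fun v hv => ?_⟩).symm
  exact (polyTensor_of_mem_eigenspace hv _).trans (by rw [eval_specPoly_self l hμ, one_smul])

/-- The spectrum of `h²` and the multiplicity of `0` do not depend on the point. -/
theorem hasSpectralForm (x : M) : HasSpectralForm g φ ξ l p x := by
  obtain ⟨y, hxy, hy⟩ := hspec x
  have hrank {μ : ℝ} (hμ : μ ∈ specSet l) : finrank ℝ ((hSq g φ ξ x).eigenspace μ) =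
      finrank ℝ ((hSq g φ ξ y).eigenspace μ) := by
    have h1 := h.finrank_eigenspace_eq_trace hQ hspec hμ x
    rw [h.trace_polyTensor_eq hQ _ hxy, ← h.finrank_eigenspace_eq_trace hQ hspec hμ y] at h1
    exact_mod_cast h1
  refine ⟨?_, (hrank (Finset.mem_insert_self _ _)).trans hy.2⟩
  rw [← coe_specSet]
  ext μ
  rw [← Module.End.hasEigenvalue_iff_mem_spectrum, Finset.mem_coe]
  constructor
  · intro hμ
    obtain ⟨v, hv⟩ := hμ.exists_hasEigenvector
    have h1 := h.aeval_hSq_eq_zero hQ hspec (f := Lagrange.nodal (specSet l) id)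
      (fun ν hν => Lagrange.eval_nodal_at_node (v := id) hν) x
    have h2 := Module.End.aeval_apply_of_hasEigenvector (p := Lagrange.nodal (specSet l) id) hv
    rw [h1, LinearMap.zero_apply, eq_comm, smul_eq_zero_iff_left hv.2, Lagrange.eval_nodal,
      Finset.prod_eq_zero_iff] at h2
    obtain ⟨ν, hν, h3⟩ := h2
    rwa [sub_eq_zero.1 h3]
  · intro hμ
    have h1 : (hSq g φ ξ y).HasEigenvalue μ := by
      rw [Module.End.hasEigenvalue_iff_mem_spectrum, hy.1, ← coe_specSet]
      exact hμ
    rw [Module.End.hasEigenvalue_iff] at h1 ⊢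
    rwa [ne_eq, ← Submodule.finrank_eq_zero, hrank hμ, Submodule.finrank_eq_zero]

end IsWeakNearlySasakian

/-! ### Distributions cut out by polynomials in `h²` -/

section Distributions
variable {E : Type*} [NormedAddCommGroup E] [NormedSpace ℝ E] [FiniteDimensional ℝ E]
  {M : Type*} [TopologicalSpace M] [ChartedSpace E M] [IsManifold 𝓘(ℝ, E) ∞ M]

/-- The tensor field `e(h²) P + η ⊗ ξ`, where `P = id - η ⊗ ξ`, for a real polynomial `e`. As
`h² ξ = 0`, it equals `e(h²) + (1 - e(0)) η ⊗ ξ`. -/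
def projTensor (g : RiemMetric E M) (φ : EndoField E M) (ξ : VField E M) (η : OneForm E M)
    (e : Polynomial ℝ) : EndoField E M :=
  fun x => polyTensor g φ ξ e x + (1 - e.eval 0) • (η x).smulRight (ξ x)

/-- The distribution of the fixed vectors of `projTensor g φ ξ η e`. -/
def polyDistribution (g : RiemMetric E M) (φ : EndoField E M) (ξ : VField E M) (η : OneForm E M)
    (e : Polynomial ℝ) : Distribution E M :=
  fun x => LinearMap.eqLocus (projTensor g φ ξ η e x).toLinearMap LinearMap.id

variable {g : RiemMetric E M} {φ : EndoField E M} {ξ : VField E M} {η : OneForm E M} {x : M}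
  {X Y : VField E M}

lemma projTensor_apply (e : Polynomial ℝ) (v : TangentSpace 𝓘(ℝ, E) x) :
    projTensor g φ ξ η e x v = polyTensor g φ ξ e x v + ((1 - e.eval 0) * η x v) • ξ x := by
  simp [projTensor, mul_smul]

lemma mem_polyDistribution {e : Polynomial ℝ} {v : TangentSpace 𝓘(ℝ, E) x} :
    v ∈ polyDistribution g φ ξ η e x ↔ projTensor g φ ξ η e x v = v := Iff.rfl

end Distributions

namespace IsWeakNearlySasakian
variable {E : Type*} [NormedAddCommGroup E] [NormedSpace ℝ E] [FiniteDimensional ℝ E]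
  {M : Type*} [TopologicalSpace M] [ChartedSpace E M] [IsManifold 𝓘(ℝ, E) ∞ M] [T2Space M]
  {g : RiemMetric E M} {φ Q : EndoField E M} {ξ : VField E M} {η : OneForm E M}
  (h : IsWeakNearlySasakian g φ Q ξ η)
  (hQ : ∀ (x : M) (X Y : VField E M), SmoothNear X x → SmoothNear Y x → η x (Y x) = 0 →
    covDerivEndo g (smallTensor Q) Y x (X x) = 0)
  {x : M} {X Y : VField E M} (e : Polynomial ℝ)
include h hQ

lemma η_projTensor (v : TangentSpace 𝓘(ℝ, E) x) : η x (projTensor g φ ξ η e x v) = η x v := by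
  rw [projTensor_apply, map_add, map_smul, h.η_ξ, h.η_polyTensor _ hQ, smul_eq_mul]
  ring

lemma projTensor_ξ : projTensor g φ ξ η e x (ξ x) = ξ x := by
  rw [projTensor_apply, h.polyTensor_ξ hQ, h.η_ξ]
  module

lemma smoothEndo_projTensor : SmoothEndo (projTensor g φ ξ η e) :=
  smoothEndo_of_apply _ fun Z hZ y => by
    simp only [projTensor_apply, mul_smul]
    exact (h.contMDiffAt_polyTensor_apply hQ e (hZ y)).add_section
      (((h.smooth_η.contMDiffAt_apply (hZ y)).smul_section (h.smooth_ξ y)).const_smul_section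
        (a := 1 - e.eval 0))

/-- `(∇_v Π) Y = g(B w, Y) ξ + η(Y) B w` with `w = v - Π v` and `B = ∇ ξ`. -/
lemma covDerivEndo_projTensor (v : TangentSpace 𝓘(ℝ, E) x) (hY : SmoothNear Y x) :
    covDerivEndo g (projTensor g φ ξ η e) Y x v =
      g.inner x (leviCivita g ξ x (v - projTensor g φ ξ η e x v)) (Y x) • ξ x
        + η x (Y x) • leviCivita g ξ x (v - projTensor g φ ξ η e x v) := by
  have hη := h.smoothNear_η_smul_ξ hY
  have hη' : SmoothNear (fun y => (1 - e.eval 0) • (η y (Y y) • ξ y)) x :=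
    hη.mono fun y hy => hy.const_smul_section (a := 1 - e.eval 0)
  have h1 : covDerivEndo g (projTensor g φ ξ η e) Y x v =
      covDerivEndo g (polyTensor g φ ξ e) Y x v +
        (1 - e.eval 0) • (leviCivita g (fun y => η y (Y y) • ξ y) x v -
          η x (leviCivita g Y x v) • ξ x) := by
    simp only [covDerivEndo, projTensor_apply, mul_smul]
    rw [leviCivita_add g ((h.smoothEndo_polyTensor hQ e).mdifferentiableAt_apply hY)
      hη'.mdifferentiableAt, _root_.add_apply, leviCivita_const_smul g _ hη.mdifferentiableAt]
    module
  rw [h1, h.covDerivEndo_polyTensor v hQ e hY, h.leviCivita_η_smul_ξ v hY, projTensor_apply]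
  simp only [map_sub, map_add, map_smul, h.leviCivita_ξ_ξ, _root_.sub_apply,
    _root_.smul_apply, smul_eq_mul, smul_zero, add_zero]
  module

/-- The covariant derivative of a section of `polyDistribution g φ ξ η e` along `v` is tangent to
this distribution if `v` is, or if the section is orthogonal to `ξ` at the given point. -/
lemma leviCivita_mem_polyDistribution {v : TangentSpace 𝓘(ℝ, E) x} (hY : SmoothNear Y x)
    (hYD : TangentNear (polyDistribution g φ ξ η e) Y x)
    (hv : v ∈ polyDistribution g φ ξ η e x ∨ η x (Y x) = 0) :
    leviCivita g Y x v ∈ polyDistribution g φ ξ η e x := by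
  have h1 := h.covDerivEndo_projTensor hQ e v hY
  have h2 : (fun y => projTensor g φ ξ η e y (Y y)) =ᶠ[𝓝 x] Y := hYD
  rw [covDerivEndo, leviCivita_congr g hY.mdifferentiableAt h2] at h1
  rw [mem_polyDistribution]
  rcases hv with hv | hv
  · rw [mem_polyDistribution] at hv
    rw [hv, sub_self, map_zero, map_zero, _root_.zero_apply, zero_smul, smul_zero, add_zero] at h1
    exact (sub_eq_zero.1 h1).symm
  · rw [hv, zero_smul, add_zero] at h1
    have h3 := congrArg (η x) h1
    rw [map_sub, h.η_projTensor hQ, sub_self, map_smul, h.η_ξ, smul_eq_mul, mul_one] at h3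
    rw [← h3, zero_smul] at h1
    exact (sub_eq_zero.1 h1).symm

variable {e} (he : ∀ (x : M) v, polyTensor g φ ξ e x (polyTensor g φ ξ e x v) =
  polyTensor g φ ξ e x v)
include he

lemma projTensor_projTensor (v : TangentSpace 𝓘(ℝ, E) x) :
    projTensor g φ ξ η e x (projTensor g φ ξ η e x v) = projTensor g φ ξ η e x v := by
  have h1 := congrArg (η x) (he x (ξ x))
  rw [h.η_polyTensor _ hQ, h.η_polyTensor _ hQ, h.η_ξ, mul_one] at h1
  have h2 : (1 - e.eval 0) * e.eval 0 = 0 := by linear_combination -h1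
  rw [projTensor_apply, h.η_projTensor hQ, projTensor_apply, map_add, map_smul, he,
    h.polyTensor_ξ hQ]
  linear_combination (norm := module) (η x v * h2) • ξ x

lemma isSmoothDistribution_polyDistribution :
    IsSmoothDistribution (polyDistribution g φ ξ η e) := by
  constructor
  · have h1 (x : M) : (finrank ℝ (polyDistribution g φ ξ η e x) : ℝ) =
        LinearMap.trace ℝ (TangentSpace 𝓘(ℝ, E) x) (Polynomial.aeval (hSq g φ ξ x) e) +
          (1 - e.eval 0) := by
      have hp : LinearMap.IsProj (polyDistribution g φ ξ η e x)
          (projTensor g φ ξ η e x).toLinearMap :=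
        ⟨fun v => h.projTensor_projTensor hQ he v, fun v hv => hv⟩
      have h2 : (projTensor g φ ξ η e x).toLinearMap = Polynomial.aeval (hSq g φ ξ x) e +
          (1 - e.eval 0) • (η x).toLinearMap.smulRight (ξ x) := rfl
      rw [← hp.trace, h2, map_add, map_smul, LinearMap.trace_smulRight]
      simp [h.η_ξ]
    refine (IsLocallyConstant.iff_eventually_eq _).2 fun x => ?_
    filter_upwards [((IsLocallyConstant.iff_eventually_eq _).1
      (h.isLocallyConstant_trace hQ e)) x] with y hy
    have h2 := h1 y
    rw [hy, ← h1 x] at h2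
    exact_mod_cast h2
  · intro x v hv
    obtain ⟨V, hV, rfl⟩ := exists_contMDiff_apply_eq (E := E) v
    exact ⟨fun y => projTensor g φ ξ η e y (V y),
      (h.smoothEndo_projTensor hQ e).smoothNear (smoothNear_of_contMDiff hV x),
      .of_forall fun y => h.projTensor_projTensor hQ he (V y), hv⟩

lemma isIntegrable_polyDistribution : IsIntegrable (polyDistribution g φ ξ η e) := by
  refine ⟨h.isSmoothDistribution_polyDistribution hQ he, fun x X Y hX hY hXD hYD => ?_⟩
  rw [← leviCivita_torsion g hX.mdifferentiableAt hY.mdifferentiableAt]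
  exact sub_mem (h.leviCivita_mem_polyDistribution hQ e hY hYD (.inl hXD.self_of_nhds))
    (h.leviCivita_mem_polyDistribution hQ e hX hXD (.inl hYD.self_of_nhds))

/-- Write a section `X` of the distribution as `η(X) ξ` plus a horizontal section. The latter has
covariant derivatives tangent to the distribution, and `ξ` is Killing. -/
lemma isRiemannianFoliation_polyDistribution :
    IsRiemannianFoliation g (polyDistribution g φ ξ η e) := by
  refine ⟨h.isIntegrable_polyDistribution hQ he, fun x X Z Z' hX hZ hZ' hXD hZD hZD' => ?_⟩
  have hη := h.smoothNear_η_smul_ξ hX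
  let X₁ : VField E M := fun y => X y - η y (X y) • ξ y
  have hX₁ : SmoothNear X₁ x := by
    filter_upwards [hX, hη] with y h1 h2 using h1.sub_section h2
  have hξD (y : M) : ξ y ∈ polyDistribution g φ ξ η e y := h.projTensor_ξ hQ e
  have hX₁D : TangentNear (polyDistribution g φ ξ η e) X₁ x := by
    filter_upwards [hXD] with y hy using sub_mem hy (Submodule.smul_mem _ _ (hξD y))
  have h1 (v : TangentSpace 𝓘(ℝ, E) x) : leviCivita g X x v = leviCivita g X₁ x v +
      ((g.inner x (leviCivita g ξ x v) (X x) + η x (leviCivita g X x v)) • ξ x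
        + η x (X x) • leviCivita g ξ x v) := by
    rw [← h.leviCivita_η_smul_ξ v hX, leviCivita_sub g hX.mdifferentiableAt hη.mdifferentiableAt,
      sub_add_cancel]
  have h2 (v : TangentSpace 𝓘(ℝ, E) x) :
      leviCivita g X₁ x v ∈ polyDistribution g φ ξ η e x :=
    h.leviCivita_mem_polyDistribution hQ e hX₁ hX₁D (.inr (by simp [X₁, h.η_ξ]))
  have hZx := hZD.self_of_nhds
  have hZx' := hZD'.self_of_nhds
  have h3 := leviCivita_metric g hZ.mdifferentiableAt hZ'.mdifferentiableAt (X x)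
  have h4 := h.killing (Z x) (Z' x) hQ
  rw [lieDerivMetric, h3, ← leviCivita_torsion g hX.mdifferentiableAt hZ.mdifferentiableAt,
    ← leviCivita_torsion g hX.mdifferentiableAt hZ'.mdifferentiableAt]
  have h5 : g.inner x (leviCivita g X₁ x (Z x)) (Z' x) = 0 := by rw [g.symm, hZx' _ (h2 _)]
  have h6 : g.inner x (ξ x) (Z' x) = 0 := by rw [g.symm, hZx' _ (hξD x)]
  rw [h1 (Z x), h1 (Z' x)]
  simp only [map_sub, map_add, map_smul, _root_.sub_apply, _root_.add_apply, _root_.smul_apply,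
    smul_eq_mul, hZx _ (h2 _), hZx _ (hξD x), h5, h6, h4]
  ring

omit he

/-- A criterion for `[ξ] ⊕ W` to be the distribution `polyDistribution g φ ξ η e`. -/
lemma span_sup_eq_polyDistribution {W : Submodule ℝ (TangentSpace 𝓘(ℝ, E) x)}
    (hW : ∀ w ∈ W, polyTensor g φ ξ e x w = w ∧ η x w = 0)
    (hW' : ∀ v, polyTensor g φ ξ e x (v - η x v • ξ x) ∈ W) :
    Submodule.span ℝ {ξ x} ⊔ W = polyDistribution g φ ξ η e x := by
  apply le_antisymm
  · refine sup_le ?_ fun w hw => ?_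
    · rw [Submodule.span_singleton_le_iff_mem]
      exact h.projTensor_ξ hQ e
    · rw [mem_polyDistribution, projTensor_apply, (hW w hw).1, (hW w hw).2, mul_zero, zero_smul,
        add_zero]
  · intro v hv
    rw [mem_polyDistribution, projTensor_apply] at hv
    have h1 : v = η x v • ξ x + polyTensor g φ ξ e x (v - η x v • ξ x) := by
      rw [map_sub, map_smul, h.polyTensor_ξ hQ]
      linear_combination (norm := module) -hv
    rw [h1]
    exact add_mem (Submodule.mem_sup_left
      (Submodule.smul_mem _ _ (Submodule.mem_span_singleton_self _))) (Submodule.mem_sup_right (hW' v))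

lemma η_eq_zero_of_mem_eigenspace {μ : ℝ} (hμ : μ ≠ 0) {v : TangentSpace 𝓘(ℝ, E) x}
    (hv : v ∈ (hSq g φ ξ x).eigenspace μ) : η x v = 0 := by
  have h1 := h.η_polyTensor v hQ .X
  rw [polyTensor_of_mem_eigenspace hv, Polynomial.eval_X, Polynomial.eval_X, map_smul, zero_mul,
    smul_eq_mul] at h1
  exact (mul_eq_zero.1 h1).resolve_left hμ

variable {r p : ℕ} {l : Fin r → ℝ} (hspec : ∀ x : M, ∃ y ∈ connectedComponent x,
  HasSpectralForm g φ ξ l p y)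
include hspec

lemma polyTensor_polyTensor_of_eval {e : Polynomial ℝ}
    (he : ∀ μ ∈ specSet l, e.eval μ * e.eval μ = e.eval μ) (x : M) (v : TangentSpace 𝓘(ℝ, E) x) :
    polyTensor g φ ξ e x (polyTensor g φ ξ e x v) = polyTensor g φ ξ e x v := by
  have h1 := congrArg (fun A => A v) (h.aeval_hSq_eq_zero hQ hspec (f := e * e - e)
    (fun μ hμ => by rw [Polynomial.eval_sub, Polynomial.eval_mul, he μ hμ, sub_self]) x)
  simp only [map_sub, map_mul] at h1
  exact sub_eq_zero.1 h1

lemma spanXi_sup_D0_eq : spanXi ξ ⊔ D0 g φ ξ = polyDistribution g φ ξ η (specPoly l 0) := by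
  have h0 : (0 : ℝ) ∈ specSet l := Finset.mem_insert_self _ _
  funext x
  refine h.span_sup_eq_polyDistribution hQ (fun w hw => ⟨?_, ?_⟩) fun v => ⟨?_, ?_⟩
  · rw [polyTensor_of_mem_eigenspace hw.1, eval_specPoly_self l h0, one_smul]
  · rw [h.η_eq]
    exact hw.2
  · exact h.polyTensor_specPoly_mem_eigenspace hQ hspec 0 _
  · change g.inner x (ξ x) _ = 0
    rw [← h.η_eq, h.η_polyTensor _ hQ, map_sub, map_smul, h.η_ξ]
    simp

variable (hl : ∀ i, 0 < l i)
include hl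

lemma spanXi_sup_Dev_eq (i : Fin r) : spanXi ξ ⊔ Dev g φ ξ (l i) =
    polyDistribution g φ ξ η (specPoly l (-(l i) ^ 2)) := by
  have hi : -(l i) ^ 2 ∈ specSet l := by simp [specSet]
  funext x
  refine h.span_sup_eq_polyDistribution hQ (fun w hw => ⟨?_, ?_⟩) fun v => ?_
  · rw [polyTensor_of_mem_eigenspace hw, eval_specPoly_self l hi, one_smul]
  · exact h.η_eq_zero_of_mem_eigenspace hQ (neg_ne_zero.2 (pow_pos (hl i) 2).ne') hw
  · exact h.polyTensor_specPoly_mem_eigenspace hQ hspec _ _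

variable (hl' : Function.Injective l)
include hl'

lemma spanXi_sup_iSup_Dev_eq : spanXi ξ ⊔ ⨆ i, Dev g φ ξ (l i) =
    polyDistribution g φ ξ η (∑ i, specPoly l (-(l i) ^ 2)) := by
  funext x
  have h1 : (⨆ i, Dev g φ ξ (l i)) x = ⨆ i, Dev g φ ξ (l i) x := iSup_apply
  rw [Pi.sup_apply, h1]
  refine h.span_sup_eq_polyDistribution hQ (fun w hw => ?_) fun v => ?_
  · have h2 : ⨆ i, Dev g φ ξ (l i) x ≤ LinearMap.eqLocus
        (polyTensor g φ ξ (∑ i, specPoly l (-(l i) ^ 2)) x).toLinearMap LinearMap.id ⊓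
          LinearMap.ker (η x).toLinearMap := iSup_le fun i w hw =>
      ⟨(polyTensor_of_mem_eigenspace hw _).trans (by rw [eval_sum_specPoly hl hl', one_smul]; rfl),
        h.η_eq_zero_of_mem_eigenspace hQ (neg_ne_zero.2 (pow_pos (hl i) 2).ne') hw⟩
    exact h2 hw
  · rw [polyTensor_apply, map_sum, LinearMap.sum_apply]
    exact sum_mem fun i _ => Submodule.mem_iSup_of_mem i
      (h.polyTensor_specPoly_mem_eigenspace hQ hspec _ _)

end IsWeakNearlySasakian

/-! ### Totally geodesic leaves -/

section Leaves
variable {E : Type*} [NormedAddCommGroup E] [NormedSpace ℝ E] [FiniteDimensional ℝ E]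
  {M : Type*} [TopologicalSpace M] [ChartedSpace E M] [IsManifold 𝓘(ℝ, E) ∞ M]
  {F : Type*} [NormedAddCommGroup F] [NormedSpace ℝ F] [FiniteDimensional ℝ F]
  {N : Type*} [TopologicalSpace N] [ChartedSpace F N] [IsManifold 𝓘(ℝ, F) ∞ N]
  (g : RiemMetric E M) {f : N → M} {m : N} {U : VField E M}

/-- A vector field that vanishes along `f` has vanishing covariant derivatives in the directions
tangent to `f`. -/
lemma leviCivita_mfderiv_eq_zero [T2Space M] (hf : MDifferentiableAt 𝓘(ℝ, F) 𝓘(ℝ, E) f m)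
    (hU : SmoothNear U (f m)) (hUf : ∀ᶠ k in 𝓝 m, U (f k) = 0) (w : TangentSpace 𝓘(ℝ, F) m) :
    leviCivita g U (f m) (mfderiv 𝓘(ℝ, F) 𝓘(ℝ, E) f m w) = 0 := by
  refine tangent_ext g fun u => ?_
  obtain ⟨Z, hZ, rfl⟩ := exists_contMDiff_apply_eq (E := E) u
  have hZ' := (smoothNear_of_contMDiff hZ (f m)).mdifferentiableAt
  have h1 := leviCivita_metric g hU.mdifferentiableAt hZ' (mfderiv 𝓘(ℝ, F) 𝓘(ℝ, E) f m w)
  have h2 := mvfderiv_comp_apply m (mdiffAt_gfun g hU.mdifferentiableAt hZ') hf w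
  have h3 : gfun g U Z ∘ f =ᶠ[𝓝 m] fun _ => 0 := by
    filter_upwards [hUf] with k hk
    simp [gfun, hk]
  rw [mvfderiv_congr h3, mvfderiv_const, _root_.zero_apply] at h2
  change d% (gfun g U Z) (f m) _ = _ at h1
  rw [← h2, hUf.self_of_nhds, map_zero, _root_.zero_apply, add_zero] at h1
  rw [← h1, map_zero, _root_.zero_apply]

end Leaves

namespace IsWeakNearlySasakian
variable {E : Type*} [NormedAddCommGroup E] [NormedSpace ℝ E] [FiniteDimensional ℝ E]
  {M : Type u} [TopologicalSpace M] [ChartedSpace E M] [IsManifold 𝓘(ℝ, E) ∞ M] [T2Space M]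
  {g : RiemMetric E M} {φ Q : EndoField E M} {ξ : VField E M} {η : OneForm E M}
  (h : IsWeakNearlySasakian g φ Q ξ η)
  (hQ : ∀ (x : M) (X Y : VField E M), SmoothNear X x → SmoothNear Y x → η x (Y x) = 0 →
    covDerivEndo g (smallTensor Q) Y x (X x) = 0)
  {e : Polynomial ℝ} (he : ∀ (x : M) v, polyTensor g φ ξ e x (polyTensor g φ ξ e x v) =
    polyTensor g φ ξ e x v)
include h hQ he

/-- A vector field tangent to the leaf along the leaf only is replaced by its projection to the
distribution, without changing its covariant derivatives along the leaf. -/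
theorem isTotallyGeodesicFoliation_polyDistribution :
    IsTotallyGeodesicFoliation g (polyDistribution g φ ξ η e) where
  integrable := h.isIntegrable_polyDistribution hQ he
  autoparallel x X Y _ hY hXD hYD :=
    h.leviCivita_mem_polyDistribution hQ e hY hYD (.inl hXD.self_of_nhds)
  leaves d N _ _ _ f hf m X Y hX hY hXD hYD := by
    have hPY := (h.smoothEndo_projTensor hQ e).smoothNear hY
    have hf' : MDifferentiableAt (𝓡 d) 𝓘(ℝ, E) f m := (hf.smooth m).mdifferentiableAt (by simp)
    have hU : SmoothNear (fun y => Y y - projTensor g φ ξ η e y (Y y)) (f m) := by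
      filter_upwards [hY, hPY] with y h1 h2 using h1.sub_section h2
    have hUf : ∀ᶠ k in 𝓝 m, Y (f k) - projTensor g φ ξ η e (f k) (Y (f k)) = 0 := by
      filter_upwards [hYD] with k hk
      rw [hf.tangent k] at hk
      exact sub_eq_zero.2 hk.symm
    have hXm := hXD.self_of_nhds
    obtain ⟨w, hw⟩ := hXm
    have h1 := leviCivita_mfderiv_eq_zero g hf' hU hUf w
    have hw' : mfderiv (𝓡 d) 𝓘(ℝ, E) f m w = X (f m) := hw
    rw [hw', leviCivita_sub g hY.mdifferentiableAt hPY.mdifferentiableAt, sub_eq_zero] at h1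
    have h2 : X (f m) ∈ polyDistribution g φ ξ η e (f m) := by
      rw [← hf.tangent m]; exact ⟨w, hw⟩
    rw [hf.tangent m, h1]
    exact h.leviCivita_mem_polyDistribution hQ e hPY
      (.of_forall fun y => h.projTensor_projTensor hQ he (Y y)) (.inl h2)

end IsWeakNearlySasakian

/-! ### Immersions: related vector fields and the induced metric -/

section Immersion
variable {E : Type*} [NormedAddCommGroup E] [NormedSpace ℝ E] [FiniteDimensional ℝ E]
  {M : Type*} [TopologicalSpace M] [ChartedSpace E M] [IsManifold 𝓘(ℝ, E) ∞ M]
  {g : RiemMetric E M} {x : M}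

/-- `∇ A` is tensorial. -/
lemma covDerivEndo_eq_of_apply_eq {A : EndoField E M} (hA : SmoothEndo A) {X Y : VField E M}
    (hX : MDiffAt (T% X) x) (hY : MDiffAt (T% Y) x) (hXY : X x = Y x)
    (v : TangentSpace 𝓘(ℝ, E) x) : covDerivEndo g A X x v = covDerivEndo g A Y x v := by
  have hAX {X : VField E M} (hX : MDiffAt (T% X) x) : MDiffAt (T% fun y => A y (X y)) x :=
    MDifferentiableAt.clm_bundle_apply (F₁ := E) (F₂ := E)
      ((hA x).mdifferentiableAt (by simp)) hX
  have ht : TensorialAt 𝓘(ℝ, E) E (fun Y => covDerivEndo g A Y x v) x :=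
    { smul := fun {u X} hu hX => by
        have h1 := leviCivita_smul g hu (hAX hX) v
        have h2 := leviCivita_smul g hu hX v
        have h3 : (fun y => A y ((u • X) y)) = fun y => u y • A y (X y) :=
          funext fun y => map_smul (A y) (u y) (X y)
        change leviCivita g _ x v - A x (leviCivita g (fun y => u y • X y) x v) =
          u x • (leviCivita g _ x v - A x (leviCivita g X x v))
        rw [h3, h1, h2, map_add, map_smul, map_smul]
        module
      add := fun {X Y} hX hY => by
        have h1 := congrArg (fun L => L v) (leviCivita_add g (hAX hX) (hAX hY))
        have h2 := congrArg (fun L => L v) (leviCivita_add g hX hY)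
        have h3 : (fun y => A y ((X + Y) y)) = fun y => A y (X y) + A y (Y y) :=
          funext fun y => map_add (A y) (X y) (Y y)
        simp only [_root_.add_apply] at h1 h2
        change leviCivita g _ x v - A x (leviCivita g (fun y => X y + Y y) x v) =
          (leviCivita g _ x v - A x (leviCivita g X x v)) +
            (leviCivita g _ x v - A x (leviCivita g Y x v))
        rw [h3, h1, h2, map_add]
        abel }
  exact ht.pointwise hX hY hXY

/-- Tangent vectors are determined by their action on smooth functions. -/
lemma eq_of_mvfderiv_eq [T2Space M] {v w : TangentSpace 𝓘(ℝ, E) x}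
    (h : ∀ u : M → ℝ, CMDiff ∞ u → d% u x v = d% u x w) : v = w := by
  refine (SeparatingDual.eq_iff_forall_dual_eq (V := E) (R := ℝ)).2 fun ℓ => ?_
  have h1 : ∀ᶠ y in 𝓝 x, CMDiffAt ∞ (ℓ ∘ extChartAt 𝓘(ℝ, E) x) y := by
    filter_upwards [extChartAt_source_mem_nhds (I := 𝓘(ℝ, E)) x] with y hy
    rw [extChartAt_source] at hy
    exact ℓ.contDiff.contMDiff.contMDiffAt.comp y (contMDiffAt_extChartAt' hy)
  obtain ⟨u, hu, hue⟩ := exists_contMDiff_fun h1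
  have h2 := h u hu
  have h3 : MDiffAt (extChartAt 𝓘(ℝ, E) x) x := mdifferentiableAt_extChartAt (mem_chart_source E x)
  have h4 (v : TangentSpace 𝓘(ℝ, E) x) : d% u x v = ℓ v := by
    rw [mvfderiv_congr hue, mvfderiv_comp_apply x ℓ.differentiableAt.mdifferentiableAt h3,
      mfderiv_extChartAt_self]
    have h5 : mfderiv 𝓘(ℝ, E) 𝓘(ℝ, ℝ) ℓ (extChartAt 𝓘(ℝ, E) x x) = ℓ := by
      rw [mfderiv_eq_fderiv, ℓ.fderiv]
    exact congrArg (fun L => L v) h5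
  rwa [h4, h4] at h2

variable {F : Type*} [NormedAddCommGroup F] [NormedSpace ℝ F] [FiniteDimensional ℝ F]
  {N : Type*} [TopologicalSpace N] [ChartedSpace F N] [IsManifold 𝓘(ℝ, F) ∞ N]
  {f : N → M} {m : N}

/-- Lie brackets of `f`-related vector fields are `f`-related. -/
lemma mfderiv_mlieBracket [T2Space M] (hf : ContMDiff 𝓘(ℝ, F) 𝓘(ℝ, E) ∞ f)
    {X Y : VField E M} (hX : CMDiff ∞ (T% X)) (hY : CMDiff ∞ (T% Y))
    {X' Y' : VField F N} (hX' : CMDiff ∞ (T% X')) (hY' : CMDiff ∞ (T% Y'))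
    (hXX' : ∀ k, mfderiv 𝓘(ℝ, F) 𝓘(ℝ, E) f k (X' k) = X (f k))
    (hYY' : ∀ k, mfderiv 𝓘(ℝ, F) 𝓘(ℝ, E) f k (Y' k) = Y (f k)) :
    mfderiv 𝓘(ℝ, F) 𝓘(ℝ, E) f m (mlieBracket 𝓘(ℝ, F) X' Y' m) =
      mlieBracket 𝓘(ℝ, E) X Y (f m) := by
  have hfd (k : N) : MDifferentiableAt 𝓘(ℝ, F) 𝓘(ℝ, E) f k := (hf k).mdifferentiableAt (by simp)
  refine eq_of_mvfderiv_eq fun u hu => ?_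
  have hd {u : M → ℝ} (hu : CMDiff ∞ u) {X : VField E M} {X' : VField F N}
      (h : ∀ k, mfderiv 𝓘(ℝ, F) 𝓘(ℝ, E) f k (X' k) = X (f k)) (k : N) :
      d% (u ∘ f) k (X' k) = d% u (f k) (X (f k)) := by
    rw [mvfderiv_comp_apply k ((hu (f k)).mdifferentiableAt (by simp)) (hfd k), h]
  rw [← mvfderiv_comp_apply m ((hu (f m)).mdifferentiableAt (by simp)) (hfd m),
    mvfderiv_mlieBracket hu hX hY, mvfderiv_mlieBracket (hu.comp hf) hX' hY',
    ← hd (contMDiff_mvfderiv_apply hu hY) hXX', ← hd (contMDiff_mvfderiv_apply hu hX) hYY']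
  congr 3
  · exact funext fun k => hd hu hYY' k
  · exact funext fun k => hd hu hXX' k

/-- A linear left inverse of the differential of an immersion. It is arbitrary off the range of the
differential, and need not depend smoothly on the point. -/
def mfderivLeftInv (f : N → M) (m : N) : TangentSpace 𝓘(ℝ, E) (f m) →L[ℝ] TangentSpace 𝓘(ℝ, F) m :=
  LinearMap.toContinuousLinearMap (mfderiv 𝓘(ℝ, F) 𝓘(ℝ, E) f m).toLinearMap.leftInverse

lemma mfderivLeftInv_apply (hi : Function.Injective (mfderiv 𝓘(ℝ, F) 𝓘(ℝ, E) f m))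
    (v : TangentSpace 𝓘(ℝ, F) m) :
    mfderivLeftInv f m (mfderiv 𝓘(ℝ, F) 𝓘(ℝ, E) f m v) = v :=
  LinearMap.leftInverse_apply_of_inj (LinearMap.ker_eq_bot.2 hi) v

lemma mfderiv_mfderivLeftInv (hi : Function.Injective (mfderiv 𝓘(ℝ, F) 𝓘(ℝ, E) f m))
    {v : TangentSpace 𝓘(ℝ, E) (f m)}
    (hv : v ∈ LinearMap.range (mfderiv 𝓘(ℝ, F) 𝓘(ℝ, E) f m).toLinearMap) :
    mfderiv 𝓘(ℝ, F) 𝓘(ℝ, E) f m (mfderivLeftInv f m v) = v := by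
  obtain ⟨w, rfl⟩ := hv
  exact congrArg _ (mfderivLeftInv_apply hi w)

/-- The scalar product of smooth vector fields along `f` is smooth. -/
lemma contMDiffAt_inner_comp (g : RiemMetric E M) {V W : Π k : N, TangentSpace 𝓘(ℝ, E) (f k)}
    (hf : ContMDiffAt 𝓘(ℝ, F) 𝓘(ℝ, E) ∞ f m)
    (hV : ContMDiffAt 𝓘(ℝ, F) 𝓘(ℝ, E).tangent ∞
      (fun k => (⟨f k, V k⟩ : TangentBundle 𝓘(ℝ, E) M)) m)
    (hW : ContMDiffAt 𝓘(ℝ, F) 𝓘(ℝ, E).tangent ∞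
      (fun k => (⟨f k, W k⟩ : TangentBundle 𝓘(ℝ, E) M)) m) :
    CMDiffAt ∞ (fun k => g.inner (f k) (V k) (W k)) m := by
  have := ContMDiffAt.clm_bundle_apply₂ (F₁ := E) (F₂ := E) (F₃ := ℝ)
    (E₃ := Bundle.Trivial M ℝ) ((g.contMDiff (f m)).comp m hf) hV hW
  rw [contMDiffAt_totalSpace] at this
  exact this.2

lemma contMDiffAt_mfderiv_apply (hf : ContMDiff 𝓘(ℝ, F) 𝓘(ℝ, E) ∞ f) {X : VField F N}
    (hX : CMDiffAt ∞ (T% X) m) : ContMDiffAt 𝓘(ℝ, F) 𝓘(ℝ, E).tangent ∞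
      (fun k => (⟨f k, mfderiv 𝓘(ℝ, F) 𝓘(ℝ, E) f k (X k)⟩ : TangentBundle 𝓘(ℝ, E) M)) m :=
  ((hf.contMDiff_tangentMap (m := ∞) (by simp)) _).comp m hX

/-- The Riemannian metric induced on an immersed submanifold. -/
def pullbackMetric [T2Space N] (g : RiemMetric E M) (hf : ContMDiff 𝓘(ℝ, F) 𝓘(ℝ, E) ∞ f)
    (hi : ∀ m, Function.Injective (mfderiv 𝓘(ℝ, F) 𝓘(ℝ, E) f m)) : RiemMetric F N where
  inner m := ContinuousLinearMap.bilinearComp (E := E) (F := E) (E' := F) (F' := F)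
    (g.inner (f m)) (mfderiv 𝓘(ℝ, F) 𝓘(ℝ, E) f m) (mfderiv 𝓘(ℝ, F) 𝓘(ℝ, E) f m)
  symm m v w := g.symm (f m) _ _
  pos m v hv := g.pos (f m) _ fun h0 => hv (hi m (h0.trans (map_zero _).symm))
  isVonNBounded m := by
    refine ((g.isVonNBounded (f m)).image (mfderivLeftInv (F := F) f m)).subset ?_
    intro v hv
    exact ⟨mfderiv 𝓘(ℝ, F) 𝓘(ℝ, E) f m v, hv, mfderivLeftInv_apply (hi m) v⟩
  contMDiff := contMDiff_bilin_of_apply _ fun X Y hX hY k =>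
    contMDiffAt_inner_comp g (hf k) (contMDiffAt_mfderiv_apply hf (hX k))
      (contMDiffAt_mfderiv_apply hf (hY k))

variable [T2Space N] (hf : ContMDiff 𝓘(ℝ, F) 𝓘(ℝ, E) ∞ f)
  (hi : ∀ m, Function.Injective (mfderiv 𝓘(ℝ, F) 𝓘(ℝ, E) f m))

lemma pullbackMetric_inner (v w : TangentSpace 𝓘(ℝ, F) m) :
    (pullbackMetric g hf hi).inner m v w = g.inner (f m) (mfderiv 𝓘(ℝ, F) 𝓘(ℝ, E) f m v)
      (mfderiv 𝓘(ℝ, F) 𝓘(ℝ, E) f m w) := rfl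

include hf hi in
/-- A smooth vector field along `f` that is tangent to `f` comes from a smooth vector field. -/
lemma contMDiffAt_mfderivLeftInv (g : RiemMetric E M) {V : Π k : N, TangentSpace 𝓘(ℝ, E) (f k)}
    (hV : ContMDiffAt 𝓘(ℝ, F) 𝓘(ℝ, E).tangent ∞
      (fun k => (⟨f k, V k⟩ : TangentBundle 𝓘(ℝ, E) M)) m)
    (hVf : ∀ k, V k ∈ LinearMap.range (mfderiv 𝓘(ℝ, F) 𝓘(ℝ, E) f k).toLinearMap) :
    CMDiffAt ∞ (T% fun k => mfderivLeftInv (F := F) f k (V k)) m := by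
  refine contMDiffAt_of_gfun (pullbackMetric g hf hi) fun Z hZ => ?_
  have h1 : gfun (pullbackMetric g hf hi) (fun k => mfderivLeftInv (F := F) f k (V k)) Z =
      fun k => g.inner (f k) (V k) (mfderiv 𝓘(ℝ, F) 𝓘(ℝ, E) f k (Z k)) := funext fun k => by
    rw [gfun, pullbackMetric_inner, mfderiv_mfderivLeftInv (hi k) (hVf k)]
  rw [h1]
  exact contMDiffAt_inner_comp g (hf m) hV (contMDiffAt_mfderiv_apply hf (hZ m))

lemma koszul_pullbackMetric [T2Space M] {X Y Z : VField E M} (hX : CMDiff ∞ (T% X))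
    (hY : CMDiff ∞ (T% Y)) (hZ : CMDiff ∞ (T% Z)) {X' Y' Z' : VField F N}
    (hX' : CMDiff ∞ (T% X')) (hY' : CMDiff ∞ (T% Y')) (hZ' : CMDiff ∞ (T% Z'))
    (hXX' : ∀ k, mfderiv 𝓘(ℝ, F) 𝓘(ℝ, E) f k (X' k) = X (f k))
    (hYY' : ∀ k, mfderiv 𝓘(ℝ, F) 𝓘(ℝ, E) f k (Y' k) = Y (f k))
    (hZZ' : ∀ k, mfderiv 𝓘(ℝ, F) 𝓘(ℝ, E) f k (Z' k) = Z (f k)) :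
    koszul (pullbackMetric g hf hi) X' Y' Z' m = koszul g X Y Z (f m) := by
  have hd {Y Z : VField E M} (hY : CMDiff ∞ (T% Y)) (hZ : CMDiff ∞ (T% Z)) {Y' Z' : VField F N}
      (hYY' : ∀ k, mfderiv 𝓘(ℝ, F) 𝓘(ℝ, E) f k (Y' k) = Y (f k))
      (hZZ' : ∀ k, mfderiv 𝓘(ℝ, F) 𝓘(ℝ, E) f k (Z' k) = Z (f k)) (v : TangentSpace 𝓘(ℝ, F) m) :
      d% (gfun (pullbackMetric g hf hi) Y' Z') m v =
        d% (gfun g Y Z) (f m) (mfderiv 𝓘(ℝ, F) 𝓘(ℝ, E) f m v) := by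
    have h1 : gfun (pullbackMetric g hf hi) Y' Z' = gfun g Y Z ∘ f := funext fun k => by
      rw [gfun, pullbackMetric_inner, hYY', hZZ']
      rfl
    rw [h1, mvfderiv_comp_apply m (mdiffAt_gfun g ((hY _).mdifferentiableAt (by simp))
      ((hZ _).mdifferentiableAt (by simp))) ((hf m).mdifferentiableAt (by simp))]
  simp only [koszul, hd hY hZ hYY' hZZ', hd hX hZ hXX' hZZ', hd hX hY hXX' hYY',
    pullbackMetric_inner, mfderiv_mlieBracket hf hX hY hX' hY' hXX' hYY',
    mfderiv_mlieBracket hf hX hZ hX' hZ' hXX' hZZ', mfderiv_mlieBracket hf hY hZ hY' hZ' hYY' hZZ',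
    hXX', hYY', hZZ']

/-- The Gauss formula for `f`-related vector fields whose covariant derivatives are tangent to `f`,
provided that all tangent vectors extend to `f`-related vector fields. -/
lemma mfderiv_leviCivita [T2Space M]
    (hrel : ∀ v : TangentSpace 𝓘(ℝ, F) m, ∃ (X : VField E M) (X' : VField F N), CMDiff ∞ (T% X) ∧
      CMDiff ∞ (T% X') ∧ (∀ k, mfderiv 𝓘(ℝ, F) 𝓘(ℝ, E) f k (X' k) = X (f k)) ∧ X' m = v)
    {Y : VField E M} {Y' : VField F N} (hY : CMDiff ∞ (T% Y)) (hY' : CMDiff ∞ (T% Y'))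
    (hYY' : ∀ k, mfderiv 𝓘(ℝ, F) 𝓘(ℝ, E) f k (Y' k) = Y (f k)) (v : TangentSpace 𝓘(ℝ, F) m)
    (hv : leviCivita g Y (f m) (mfderiv 𝓘(ℝ, F) 𝓘(ℝ, E) f m v) ∈
      LinearMap.range (mfderiv 𝓘(ℝ, F) 𝓘(ℝ, E) f m).toLinearMap) :
    mfderiv 𝓘(ℝ, F) 𝓘(ℝ, E) f m (leviCivita (pullbackMetric g hf hi) Y' m v) =
      leviCivita g Y (f m) (mfderiv 𝓘(ℝ, F) 𝓘(ℝ, E) f m v) := by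
  obtain ⟨w, hw⟩ := hv
  have hw' : mfderiv 𝓘(ℝ, F) 𝓘(ℝ, E) f m w = _ := hw
  rw [← hw']
  congr 1
  refine tangent_ext (pullbackMetric g hf hi) fun z => ?_
  obtain ⟨X, X', hX, hX', hXX', rfl⟩ := hrel v
  obtain ⟨Z, Z', hZ, hZ', hZZ', rfl⟩ := hrel z
  have hd {Y : VField E M} (hY : CMDiff ∞ (T% Y)) : MDiffAt (T% Y) (f m) :=
    (hY (f m)).mdifferentiableAt (by simp)
  have hd' {Y : VField F N} (hY : CMDiff ∞ (T% Y)) : MDiffAt (T% Y) m :=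
    (hY m).mdifferentiableAt (by simp)
  have h1 := inner_nablaAt (pullbackMetric g hf hi) (hd' hX') (hd' hY') (hd' hZ')
  have h2 := inner_nablaAt g (hd hX) (hd hY) (hd hZ)
  rw [koszul_pullbackMetric hf hi hX hY hZ hX' hY' hZ' hXX' hYY' hZZ', ← h2] at h1
  refine h1.trans ?_
  rw [pullbackMetric_inner, hw', hZZ', hXX']
  rfl

end Immersion

/-! ### The Sasakian structure of the leaves -/

namespace IsWeakNearlySasakian
variable {E : Type*} [NormedAddCommGroup E] [NormedSpace ℝ E] [FiniteDimensional ℝ E]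
  {M : Type u} [TopologicalSpace M] [ChartedSpace E M] [IsManifold 𝓘(ℝ, E) ∞ M] [T2Space M]
  {g : RiemMetric E M} {φ Q : EndoField E M} {ξ : VField E M} {η : OneForm E M}
  (h : IsWeakNearlySasakian g φ Q ξ η)
  (hQ : ∀ (x : M) (X Y : VField E M), SmoothNear X x → SmoothNear Y x → η x (Y x) = 0 →
    covDerivEndo g (smallTensor Q) Y x (X x) = 0)
include h hQ

/-- The Sasakian identity along the kernel of `h²`, where `φ = -∇ξ`. -/
lemma covDerivEndo_φ_of_hSq_eq_zero {x : M} {Y : VField E M} (hY : SmoothNear Y x)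
    (hYK : ∀ᶠ y in 𝓝 x, hSq g φ ξ y (Y y) = 0) {v : TangentSpace 𝓘(ℝ, E) x}
    (hv : hSq g φ ξ x v = 0) (hYv : hSq g φ ξ x (leviCivita g Y x v) = 0) :
    covDerivEndo g φ Y x v = g.inner x v (Y x) • ξ x - η x (Y x) • v := by
  have hφ {y : M} {w : TangentSpace 𝓘(ℝ, E) y} (hw : hSq g φ ξ y w = 0) :
      φ y w = -leviCivita g ξ y w :=
    eq_neg_of_add_eq_zero_right (h.hTensor_eq_zero w hQ hw)
  have hBY := (smoothEndo_leviCivita g h.smooth_ξ).smoothNear hY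
  have h1 : (fun y => φ y (Y y)) =ᶠ[𝓝 x] fun y => -leviCivita g ξ y (Y y) := by
    filter_upwards [hYK] with y hy using hφ hy
  have h2 := h.covDerivEndo_leviCivita_ξ v hQ hY
  have h3 : leviCivita g ξ x (leviCivita g ξ x v) = η x v • ξ x - v := by
    rw [h.hSq_apply _ hQ] at hv
    linear_combination (norm := module) hv
  have h4 : MDiffAt (T% fun y => -leviCivita g ξ y (Y y)) x :=
    mdifferentiableAt_neg_section hBY.mdifferentiableAt
  rw [covDerivEndo, leviCivita_congr g h4 h1, leviCivita_neg g hBY.mdifferentiableAt, hφ hYv]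
  rw [covDerivEndo, h3, map_sub, _root_.sub_apply, map_smul, _root_.smul_apply, smul_eq_mul,
    ← h.η_eq] at h2
  linear_combination (norm := module) -h2

variable {e : Polynomial ℝ} (he : ∀ (x : M) v, polyTensor g φ ξ e x (polyTensor g φ ξ e x v) =
    polyTensor g φ ξ e x v)
  (hK : ∀ (x : M) v, v ∈ polyDistribution g φ ξ η e x ↔ hSq g φ ξ x v = 0)
include he hK

/-- The integral manifolds of `ker h²` inherit a Sasakian structure. -/
theorem inducesSasakian {d : ℕ} {N : Type u} [TopologicalSpace N]
    [ChartedSpace (EuclideanSpace ℝ (Fin d)) N] [IsManifold (𝓡 d) ∞ N] {f : N → M}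
    (hf : IsIntegralManifold d (polyDistribution g φ ξ η e) f) :
    InducesSasakian d g φ ξ η f := by
  have hN : T2Space N := T2Space.of_injective_continuous hf.injective hf.smooth.continuous
  let df (k : N) : TangentSpace (𝓡 d) k →L[ℝ] TangentSpace 𝓘(ℝ, E) (f k) :=
    mfderiv (𝓡 d) 𝓘(ℝ, E) f k
  let L (k : N) : TangentSpace 𝓘(ℝ, E) (f k) →L[ℝ] TangentSpace (𝓡 d) k :=
    mfderivLeftInv (F := EuclideanSpace ℝ (Fin d)) f k
  have hrange (k : N) (v : TangentSpace 𝓘(ℝ, E) (f k)) :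
      v ∈ LinearMap.range (df k).toLinearMap ↔ hSq g φ ξ (f k) v = 0 := by
    rw [← hK, ← hf.tangent k]
  have hdf (k : N) (v : TangentSpace (𝓡 d) k) : hSq g φ ξ (f k) (df k v) = 0 :=
    (hrange k _).1 ⟨v, rfl⟩
  have hφ {x : M} {v : TangentSpace 𝓘(ℝ, E) x} (hv : hSq g φ ξ x v = 0) :
      hSq g φ ξ x (φ x v) = 0 := by rw [h.hSq_φ _ hQ, hv, map_zero]
  have hL (k : N) {v : TangentSpace 𝓘(ℝ, E) (f k)} (hv : hSq g φ ξ (f k) v = 0) :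
      df k (L k v) = v := mfderiv_mfderivLeftInv (hf.immersion k) ((hrange k v).2 hv)
  have hcomp {V : VField E M} (hV : CMDiff ∞ (T% V)) (k : N) :
      ContMDiffAt (𝓡 d) 𝓘(ℝ, E).tangent ∞
        (fun k => (⟨f k, V (f k)⟩ : TangentBundle 𝓘(ℝ, E) M)) k :=
    (hV (f k)).comp k (hf.smooth k)
  let g' := pullbackMetric g hf.smooth hf.immersion
  let φ' : EndoField (EuclideanSpace ℝ (Fin d)) N := fun k => L k ∘L φ (f k) ∘L df k
  let ξ' : VField (EuclideanSpace ℝ (Fin d)) N := fun k => L k (ξ (f k))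
  let η' : OneForm (EuclideanSpace ℝ (Fin d)) N := fun k => η (f k) ∘L df k
  have hφ' (k : N) (v : TangentSpace (𝓡 d) k) : df k (φ' k v) = φ (f k) (df k v) :=
    hL k (hφ (hdf k v))
  have hξ' (k : N) : df k (ξ' k) = ξ (f k) := hL k (h.hSq_ξ hQ)
  have hη' (k : N) (v : TangentSpace (𝓡 d) k) : η' k v = η (f k) (df k v) := rfl
  have hφ's : SmoothEndo φ' := smoothEndo_of_apply _ fun Z hZ k =>
    contMDiffAt_mfderivLeftInv hf.smooth hf.immersion g
      (ContMDiffAt.clm_bundle_apply (F₁ := E) (F₂ := E) ((h.smooth_φ (f k)).comp k (hf.smooth k))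
        (contMDiffAt_mfderiv_apply hf.smooth (hZ k)))
      fun k => (hrange k _).2 (hφ (hdf k _))
  have hrel (m : N) (v : TangentSpace (𝓡 d) m) : ∃ (X : VField E M) (X' : VField (EuclideanSpace ℝ (Fin d)) N),
      CMDiff ∞ (T% X) ∧ ContMDiff (𝓡 d) (𝓡 d).tangent ∞ (T% X') ∧ (∀ k, df k (X' k) = X (f k)) ∧ X' m = v ∧
        ∀ y, X y ∈ polyDistribution g φ ξ η e y := by
    obtain ⟨V, hV, hVm⟩ := exists_contMDiff_apply_eq (E := E) (df m v)
    have hX : CMDiff ∞ (T% fun y => projTensor g φ ξ η e y (V y)) := fun y =>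
      (h.smoothEndo_projTensor hQ e).contMDiffAt_apply (hV y)
    have hD (y : M) : projTensor g φ ξ η e y (V y) ∈ polyDistribution g φ ξ η e y :=
      h.projTensor_projTensor hQ he (V y)
    refine ⟨_, fun k => L k (projTensor g φ ξ η e (f k) (V (f k))), hX, fun k =>
      contMDiffAt_mfderivLeftInv hf.smooth hf.immersion g (hcomp hX k)
        fun k => (hrange k _).2 ((hK _ _).1 (hD _)), fun k => hL k ((hK _ _).1 (hD _)), ?_, hD⟩
    have h1 : projTensor g φ ξ η e (f m) (V (f m)) = V (f m) := by
      rw [hVm]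
      exact mem_polyDistribution.1 ((hK _ _).2 (hdf m v))
    change L m (projTensor g φ ξ η e (f m) (V (f m))) = v
    rw [h1, hVm]
    exact mfderivLeftInv_apply (hf.immersion m) v
  refine ⟨g', φ', ξ', η', fun _ _ _ => rfl, hφ', hξ', fun _ _ => rfl, ?_⟩
  exact
    { smooth_φ := hφ's
      smooth_Q := smoothEndo_of_apply _ fun Z hZ => hZ
      smooth_ξ := fun k => contMDiffAt_mfderivLeftInv hf.smooth hf.immersion g
        (hcomp h.smooth_ξ k) fun k => (hrange k _).2 (h.hSq_ξ hQ)
      smooth_η := smoothOneForm_of_apply _ fun Z hZ k => by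
        have h1 := contMDiffAt_inner_comp g (hf.smooth k) (hcomp h.smooth_ξ k)
          (contMDiffAt_mfderiv_apply hf.smooth (hZ k))
        simp_rw [← h.η_eq] at h1
        exact h1
      φ_sq := fun k v => by
        refine hf.immersion k ?_
        change df k _ = df k _
        rw [hφ', hφ', h.φ_φ _ hQ, map_add, map_smul, hξ', map_neg]
        rfl
      η_ξ := fun k => by rw [hη', hξ', h.η_ξ]
      Q_ξ := fun _ => rfl
      Q_nonsingular := fun _ => Function.bijective_id
      ker_invariant := fun k v _ => by rw [hη', hφ', h.η_φ]
      compatible := fun k v w => by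
        change g.inner (f k) (df k (φ' k v)) (df k (φ' k w)) = g.inner (f k) (df k v) (df k w) - _
        rw [hφ', hφ', h.compatible, h.Q_eq _ hQ]
        rfl
      sasaki := fun m X₀ Y₀ _ hY₀ => by
        obtain ⟨Y, Y', hY, hY', hYY', hYm, hYD⟩ := hrel m (Y₀ m)
        have hYn := smoothNear_of_contMDiff hY (f m)
        have hφY : CMDiff ∞ (T% fun y => φ y (Y y)) := fun y => h.smooth_φ.contMDiffAt_apply (hY y)
        have hφYD (y : M) : φ y (Y y) ∈ polyDistribution g φ ξ η e y :=
          (hK _ _).2 (hφ ((hK _ _).1 (hYD y)))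
        set v := X₀ m
        have hv : df m v ∈ polyDistribution g φ ξ η e (f m) := (hK _ _).2 (hdf m v)
        have hn {Z : VField E M} (hZ : CMDiff ∞ (T% Z))
            (hZD : ∀ y, Z y ∈ polyDistribution g φ ξ η e y) :
            hSq g φ ξ (f m) (leviCivita g Z (f m) (df m v)) = 0 :=
          (hK _ _).1 (h.leviCivita_mem_polyDistribution hQ e (smoothNear_of_contMDiff hZ _)
            (.of_forall hZD) (.inl hv))
        have hrel' (v : TangentSpace (𝓡 d) m) : ∃ (X : VField E M) (X' : VField (EuclideanSpace ℝ (Fin d)) N),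
            CMDiff ∞ (T% X) ∧ ContMDiff (𝓡 d) (𝓡 d).tangent ∞ (T% X') ∧ (∀ k, df k (X' k) = X (f k)) ∧ X' m = v := by
          obtain ⟨X, X', h1, h2, h3, h4, -⟩ := hrel m v
          exact ⟨X, X', h1, h2, h3, h4⟩
        have h1 := mfderiv_leviCivita (g := g) hf.smooth hf.immersion hrel' hY hY' hYY' v
          ((hrange m _).2 (hn hY hYD))
        have h2 := mfderiv_leviCivita (g := g) hf.smooth hf.immersion hrel' hφY
          (fun k => hφ's.contMDiffAt_apply (hY' k)) (fun k => by
            have := hφ' k (Y' k)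
            rw [hYY'] at this
            exact this) v ((hrange m _).2 (hn hφY hφYD))
        have h3 := h.covDerivEndo_φ_of_hSq_eq_zero hQ hYn
          (.of_forall fun y => (hK _ _).1 (hYD y)) (hdf m v) (hn hY hYD)
        rw [covDerivEndo_eq_of_apply_eq hφ's hY₀.mdifferentiableAt
          (smoothNear_of_contMDiff hY' m).mdifferentiableAt hYm.symm]
        refine hf.immersion m ?_
        change df m _ = df m _
        change df m _ = _ at h1 h2
        rw [covDerivEndo, map_sub, h2, hφ', h1, map_sub, map_smul, map_smul, hξ', ← hYm]
        rw [← hYY'] at h3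
        exact h3 }

end IsWeakNearlySasakian

/-! ### The foliations of the theorem -/

namespace IsWeakNearlySasakian
variable {E : Type*} [NormedAddCommGroup E] [NormedSpace ℝ E] [FiniteDimensional ℝ E]
  {M : Type u} [TopologicalSpace M] [ChartedSpace E M] [IsManifold 𝓘(ℝ, E) ∞ M] [T2Space M]
  {g : RiemMetric E M} {φ Q : EndoField E M} {ξ : VField E M} {η : OneForm E M}
  (h : IsWeakNearlySasakian g φ Q ξ η)
  (hQ : ∀ (x : M) (X Y : VField E M), SmoothNear X x → SmoothNear Y x → η x (Y x) = 0 →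
    covDerivEndo g (smallTensor Q) Y x (X x) = 0)
  {r p : ℕ} {l : Fin r → ℝ} (hspec : ∀ x : M, ∃ y ∈ connectedComponent x,
    HasSpectralForm g φ ξ l p y)
include h hQ hspec

lemma polyTensor_specPoly_idem (μ : ℝ) (x : M) (v : TangentSpace 𝓘(ℝ, E) x) :
    polyTensor g φ ξ (specPoly l μ) x (polyTensor g φ ξ (specPoly l μ) x v) =
      polyTensor g φ ξ (specPoly l μ) x v := by
  refine h.polyTensor_polyTensor_of_eval hQ hspec (fun ν hν => ?_) x v
  rcases eq_or_ne μ ν with rfl | hne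
  · rw [eval_specPoly_self l hν, one_mul]
  · rw [eval_specPoly_of_ne l hne hν, zero_mul]

lemma polyTensor_sum_specPoly_idem (hl : ∀ i, 0 < l i) (hl' : Function.Injective l) (x : M)
    (v : TangentSpace 𝓘(ℝ, E) x) :
    polyTensor g φ ξ (∑ i, specPoly l (-(l i) ^ 2)) x
      (polyTensor g φ ξ (∑ i, specPoly l (-(l i) ^ 2)) x v) =
        polyTensor g φ ξ (∑ i, specPoly l (-(l i) ^ 2)) x v := by
  refine h.polyTensor_polyTensor_of_eval hQ hspec (fun ν hν => ?_) x v
  rw [← Finset.mem_coe, coe_specSet] at hν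
  obtain rfl | ⟨j, rfl⟩ := hν
  · rw [eval_sum_specPoly_zero hl, zero_mul]
  · rw [eval_sum_specPoly hl hl', one_mul]

lemma mem_polyDistribution_specPoly_zero (x : M) (v : TangentSpace 𝓘(ℝ, E) x) :
    v ∈ polyDistribution g φ ξ η (specPoly l 0) x ↔ hSq g φ ξ x v = 0 := by
  have h0 : (0 : ℝ) ∈ specSet l := Finset.mem_insert_self _ _
  have h1 (v : TangentSpace 𝓘(ℝ, E) x) :
      v ∈ (hSq g φ ξ x).eigenspace 0 ↔ hSq g φ ξ x v = 0 := by
    rw [Module.End.mem_eigenspace_iff, zero_smul]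
  rw [mem_polyDistribution, projTensor_apply, eval_specPoly_self l h0, sub_self, zero_mul,
    zero_smul, add_zero, ← h1]
  refine ⟨fun hv => ?_, fun hv => ?_⟩
  · rw [← hv]
    exact h.polyTensor_specPoly_mem_eigenspace hQ hspec 0 v
  · rw [polyTensor_of_mem_eigenspace hv, eval_specPoly_self l h0, one_smul]

lemma dim_eq_of_isIntegralManifold {d : ℕ} {N : Type u} [TopologicalSpace N]
    [ChartedSpace (EuclideanSpace ℝ (Fin d)) N] [IsManifold (𝓡 d) ∞ N] {f : N → M}
    (hf : IsIntegralManifold d (polyDistribution g φ ξ η (specPoly l 0)) f) : d = 2 * p + 1 := by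
  obtain ⟨m⟩ := hf.connected.toNonempty
  have h1 : polyDistribution g φ ξ η (specPoly l 0) (f m) = (hSq g φ ξ (f m)).eigenspace 0 := by
    ext v
    rw [h.mem_polyDistribution_specPoly_zero hQ hspec, Module.End.mem_eigenspace_iff, zero_smul]
  have h2 := LinearMap.finrank_range_of_inj (f := (mfderiv (𝓡 d) 𝓘(ℝ, E) f m).toLinearMap)
    (hf.immersion m)
  rw [hf.tangent m, h1, (h.hasSpectralForm hQ hspec (f m)).2] at h2
  exact (h2.trans (finrank_euclideanSpace_fin (𝕜 := ℝ))).symm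

end IsWeakNearlySasakian

end

end WNS

theorem theorem4p2 {n : ℕ} (hn : 1 ≤ n)
    {M : Type u} [TopologicalSpace M] [T2Space M] [SecondCountableTopology M]
    [ChartedSpace (EuclideanSpace ℝ (Fin (2 * n + 1))) M] [IsManifold (𝓡 (2 * n + 1)) ∞ M]
    (g : RiemMetric (EuclideanSpace ℝ (Fin (2 * n + 1))) M)
    (φ Q : EndoField (EuclideanSpace ℝ (Fin (2 * n + 1))) M)
    (ξ : VField (EuclideanSpace ℝ (Fin (2 * n + 1))) M)
    (η : OneForm (EuclideanSpace ℝ (Fin (2 * n + 1))) M)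
    (hS : IsWeakNearlySasakian g φ Q ξ η)
    (hQ : ∀ (x : M) (X Y : VField (EuclideanSpace ℝ (Fin (2 * n + 1))) M),
      SmoothNear X x → SmoothNear Y x → η x (Y x) = 0 →
      covDerivEndo g (smallTensor Q) Y x (X x) = 0)
    (hR : ∀ (x : M) (X Y Z : VField (EuclideanSpace ℝ (Fin (2 * n + 1))) M),
      SmoothNear X x → SmoothNear Y x → SmoothNear Z x → η x (Y x) = 0 → η x (Z x) = 0 →
      η x (curvature g (fun y => smallTensor Q y (X y)) Y Z x) = 0)
    (r p : ℕ) (l : Fin r → ℝ) (hl : ∀ i, 0 < l i) (hl' : Function.Injective l)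
    (hspec : ∀ x : M, ∃ y ∈ connectedComponent x, HasSpectralForm g φ ξ l p y) :
    (∀ x : M, HasSpectralForm g φ ξ l p x) ∧
    IsTotallyGeodesicFoliation g (spanXi ξ ⊔ D0 g φ ξ) ∧
    (∀ i, IsTotallyGeodesicFoliation g (spanXi ξ ⊔ Dev g φ ξ (l i))) ∧
    (0 < p →
      (IsTotallyGeodesicFoliation g (spanXi ξ ⊔ ⨆ i, Dev g φ ξ (l i)) ∧
        IsRiemannianFoliation g (spanXi ξ ⊔ ⨆ i, Dev g φ ξ (l i))) ∧
      ∀ (d : ℕ) (N : Type u) [TopologicalSpace N] [ChartedSpace (EuclideanSpace ℝ (Fin d)) N]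
        [IsManifold (𝓡 d) ∞ N] (f : N → M), IsIntegralManifold d (spanXi ξ ⊔ D0 g φ ξ) f →
        d = 2 * p + 1 ∧ InducesSasakian d g φ ξ η f) := by
  have hE := hS.spanXi_sup_D0_eq hQ hspec
  have hI := hS.polyTensor_specPoly_idem hQ hspec
  refine ⟨hS.hasSpectralForm hQ hspec, ?_, fun i => ?_, fun _ => ⟨?_, ?_⟩⟩
  · rw [hE]
    exact hS.isTotallyGeodesicFoliation_polyDistribution hQ (hI 0)
  · rw [hS.spanXi_sup_Dev_eq hQ hspec hl]
    exact hS.isTotallyGeodesicFoliation_polyDistribution hQ (hI _)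
  · rw [hS.spanXi_sup_iSup_Dev_eq hQ hspec hl hl']
    have he := hS.polyTensor_sum_specPoly_idem hQ hspec hl hl'
    exact ⟨hS.isTotallyGeodesicFoliation_polyDistribution hQ he,
      hS.isRiemannianFoliation_polyDistribution hQ he⟩
  · intro d N _ _ _ f hf
    rw [hE] at hf
    exact ⟨hS.dim_eq_of_isIntegralManifold hQ hspec hf, hS.inducesSasakian hQ (hI 0)
      (hS.mem_polyDistribution_specPoly_zero hQ hspec) hf⟩
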